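/- Let $F$ be a non-archimedean local field with ring of integers $O_F$, residue field of cardinality $q$ and normalized absolute value $|\cdot|_F$. Let $K/F$ be an unramified quadratic field extension and $\eta_{K/F}$ its quadratic character ($1$ on norms from $K^\times$, $-1$ on the other elements of $F^\times$). Let $h\ge 1$, write $\mathbf G_n=\mathrm{GL}_n$, and let $\zeta=(a,b)$ with $a,b\in O_F^\times$ be a generator of the $O_F$-algebra $O_F\times O_F$; put $\zeta^\sigma=(b,a)$. Let $\tau_1:O_F\times O_F\to \mathrm{Mat}_{2h}(O_F)$ be $(x,y)\mapsto \mathrm{diag}(xI_h,yI_h)$, so $\tau_1(\zeta)=\mathrm{diag}(aI_h,bI_h)$, let $g\in\mathbf G_{2h}(O_F)$ and $\tau_2=g\tau_1g^{-1}$. Put $$i=\tau_1(\zeta)-\tau_2(\zeta^\sigma),\qquad e=\tau_1(\zeta)-\tau_2(\zeta),\qquad \delta=i\circ e,$$ all in $\mathrm{Mat}_{2h}(O_F)$. Let $C(\tau_j)\subset \mathbf G_{2h}(F)$ be the centralizer of $\tau_j$, let $L\subset\mathrm{Mat}_{2h}(F)$ be the algebra of matrices commuting with $\tau_1$ and $\tau_2$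 (so $L^\times=C(\tau_1)\cap C(\tau_2)$), and $O_L$ its ring of elements integral over $O_F$. Assume that $\delta\in \mathbf G_{2h}(F)$ and that the invariant polynomial of $(\tau_1,\tau_2)$, i.e. the characteristic polynomial of $(a-b)^{-2}i^2$ on $F^h\oplus 0$, has distinct roots; then $L$ is a commutative étale $F$-algebra. For $x=(x_1,x_2)\in C(\tau_1)=\mathbf G_h(F)\times\mathbf G_h(F)$ put $|x|=|\det(x_1^{-1}x_2)|_F$ and $\eta_{K/F}(x)=\eta_{K/F}(\det(x_1x_2))$. For $s\in\mathbb C$ let $$O_\tau(\mathbf 1_{\mathbf G_{2h}(O_F)},s)=\int_{L^\times\backslash C(\tau_1)\times C(\tau_1)}\mathbf 1_{\mathbf G_{2h}(O_F)}(u_1^{-1}gu_2)\,\eta_{K/F}(u_2)\,|u_1u_2|^s\,du_1\,du_2,$$ where $l\in L^\times$ acts by $(u_1,u_2)\mapsto(lu_1,g^{-1}lgu_2)$, and the integral is for the quotient of the Haar measure on $C(\tau_1)\times C(\tau_1)$ by a Haar measure on $L^\times$; the Haar measure on $C(\tau_1)$ gives $C(\tau_1)\cap\mathbf G_{2h}(O_F)$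 volume $1$. A lattice is a finitely generated $O_F$-submodule $\Lambda\subset F^{2h}$ that spans $F^{2h}$. For a lattice with $\tau_1(\zeta)\Lambda=\Lambda$ let $\Lambda=\Lambda_+\oplus\Lambda_-$, where $\tau_1(\zeta)$ is $a$ on $\Lambda_+=\Lambda\cap(F^h\oplus 0)$ and $b$ on $\Lambda_-=\Lambda\cap(0\oplus F^h)$. Let $\Lambda_0=O_F^{2h}$, let $\mathcal L$ be the set of lattices $\Lambda$ with $\tau_j(\zeta)\Lambda=\Lambda$ for $j=1,2$, up to the action of $L^\times$, and let $\mathrm{Stab}(\Lambda)=\{l\in L: l\Lambda\subset\Lambda\}$. Theorem. Assume $\Lambda_{0,-}=\delta\Lambda_{0,+}$. Then $\mathcal L$ is finite and the integral converges absolutely for every $s\in\mathbb C$. Let $k=2$ if $i\in\mathbf G_{2h}(O_F)$, or $k=0$ if $e\in\mathbf G_{2h}(O_F)$. If the Haar measure on $L^\times$ gives $O_L^\times$ volume $1$, then $$O_\tau(\mathbf 1_{\mathbf G_{2h}(O_F)},s)=\sum_{[\Lambda]\in\mathcal L}[O_L^\times:\mathrm{Stab}(\Lambda)^\times]\,(-q^{ks})^{\mathrm{length}(\Lambda_-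 /\delta\Lambda_+)}.$$ If instead it gives $L^\times\cap\mathbf G_{2h}(O_F)$ volume $1$, the same holds with the left-hand side multiplied by $[O_L^\times:L^\times\cap\mathbf G_{2h}(O_F)]$. -/

import Mathlib

open ValuativeRel MeasureTheory
open scoped Matrix ENNReal

noncomputable section

namespace LinearAFL

/-! ### The local field and its characters -/

section Field

variable (F : Type*) [Field F] [ValuativeRel F] [TopologicalSpace F] [IsNonarchimedeanLocalField F]

/-- The cardinality `q` of the residue field of `F`. -/
def resCard : ℕ := Nat.card 𝓀[F]

variable {F}

open Classical in
/-- The normalized absolute value of `F`, for which a uniformizer has absolute value `1 / q`. -/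
def normAbs (x : F) : ℝ :=
  if x = 0 then 0 else
    (resCard F : ℝ) ^
      (WithZero.log (IsNonarchimedeanLocalField.valueGroupWithZeroIsoInt F (valuation F x)))

open Classical in
/-- The quadratic character `η_{K/F}` of `Fˣ` attached to a quadratic extension `K / F`: it is `1`
on norms from `K` and `-1` on all other elements (the value at `0` is irrelevant). -/
def quadChar (K : Type*) [Field K] [Algebra F K] (x : F) : ℂ :=
  if ∃ y : K, Algebra.norm F y = x then 1 else -1

end Field

variable {F : Type*} [Field F] [ValuativeRel F] [TopologicalSpace F] [IsNonarchimedeanLocalField F]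
variable {h : ℕ}

/-! ### The pair of embeddings -/

/-- The index set of the `2h` coordinates, split into the two blocks of size `h`. -/
abbrev Idx (h : ℕ) : Type := Fin h ⊕ Fin h

/-- The embedding `τ₁ : 𝒪 × 𝒪 → Mat_{2h}(𝒪)`, `(x, y) ↦ diag(x I_h, y I_h)`. -/
def tau1 (F : Type*) [Field F] [ValuativeRel F] [TopologicalSpace F]
    [IsNonarchimedeanLocalField F] (h : ℕ) :
    (𝒪[F] × 𝒪[F]) →ₐ[𝒪[F]] Matrix (Idx h) (Idx h) 𝒪[F] where
  toFun x := Matrix.fromBlocks (x.1 • 1) 0 0 (x.2 • 1)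
  map_one' := by simp
  map_zero' := by simp
  map_mul' x y := by
    simp only [Matrix.fromBlocks_multiply, Prod.fst_mul, Prod.snd_mul, smul_mul_smul_comm, mul_one,
      mul_zero, zero_mul, add_zero, zero_add]
  map_add' x y := by simp [Matrix.fromBlocks_add, add_smul]
  commutes' r := by
    rw [Algebra.algebraMap_eq_smul_one, Algebra.algebraMap_eq_smul_one, ← Matrix.fromBlocks_one,
      Matrix.fromBlocks_smul]
    simp

/-- The embedding `τ₂ = g τ₁ g⁻¹ : 𝒪 × 𝒪 → Mat_{2h}(𝒪)`. -/
def tau2 (g : GL (Idx h) 𝒪[F]) :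
    (𝒪[F] × 𝒪[F]) →ₐ[𝒪[F]] Matrix (Idx h) (Idx h) 𝒪[F] where
  toFun x := g.val * tau1 F h x * g⁻¹.val
  map_one' := by simp
  map_zero' := by simp
  map_mul' x y := by simp only [map_mul, mul_assoc, Units.inv_mul_cancel_left]
  map_add' x y := by simp only [map_add, mul_add, add_mul]
  commutes' r := by
    rw [AlgHom.commutes, ← Algebra.commutes, mul_assoc, Units.mul_inv, mul_one]

/-- A matrix over `𝒪`, seen over `F`. -/
def toF (M : Matrix (Idx h) (Idx h) 𝒪[F]) : Matrix (Idx h) (Idx h) F :=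
  M.map (algebraMap 𝒪[F] F)

/-- The map `GL_{2h}(𝒪) → GL_{2h}(F)`. -/
def glMap : GL (Idx h) 𝒪[F] →* GL (Idx h) F :=
  Matrix.GeneralLinearGroup.map (algebraMap 𝒪[F] F)

/-- `GL_{2h}(𝒪)` as a subgroup of `GL_{2h}(F)`. -/
def intGL (F : Type*) [Field F] [ValuativeRel F] [TopologicalSpace F]
    [IsNonarchimedeanLocalField F] (h : ℕ) : Subgroup (GL (Idx h) F) :=
  (glMap (F := F) (h := h)).range

/-- The centralizer of the image of `τ` in `Mat_{2h}(F)`. -/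
def centAlg (τ : (𝒪[F] × 𝒪[F]) →ₐ[𝒪[F]] Matrix (Idx h) (Idx h) 𝒪[F]) :
    Subalgebra F (Matrix (Idx h) (Idx h) F) :=
  Subalgebra.centralizer F (Set.range fun x => toF (τ x))

/-- The centralizer `C(τ₁)` in `GL_{2h}(F)`. -/
def C1 (F : Type*) [Field F] [ValuativeRel F] [TopologicalSpace F]
    [IsNonarchimedeanLocalField F] (h : ℕ) : Subgroup (GL (Idx h) F) :=
  (centAlg (tau1 F h)).toSubmonoid.units

/-- The algebra `L` of matrices over `F` commuting with `τ₁` and `τ₂`. -/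
def algL (g : GL (Idx h) 𝒪[F]) : Subalgebra F (Matrix (Idx h) (Idx h) F) :=
  centAlg (tau1 F h) ⊓ centAlg (tau2 g)

/-- `Lˣ = C(τ₁) ∩ C(τ₂)`, as a subgroup of `GL_{2h}(F)`. -/
def unitsL (g : GL (Idx h) 𝒪[F]) : Subgroup (GL (Idx h) F) := (algL g).toSubmonoid.units

/-- The ring of integers `O_L`: the `𝒪`-algebra generated by all elements of `L` that are integral
over `𝒪`. As soon as `L` is commutative, it is the set of these elements. -/
def intL (g : GL (Idx h) 𝒪[F]) : Subalgebra 𝒪[F] (Matrix (Idx h) (Idx h) F) :=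
  Algebra.adjoin 𝒪[F] {l | l ∈ algL g ∧ IsIntegral 𝒪[F] l}

/-- `O_Lˣ`, as a subgroup of `GL_{2h}(F)`. -/
def unitsIntL (g : GL (Idx h) 𝒪[F]) : Subgroup (GL (Idx h) F) := (intL g).toSubmonoid.units

/-! ### The operators `i`, `e`, `δ` and the invariant polynomial

Here `ζ = (a, b)` and `ζ^σ = (b, a)`. -/

/-- `i = τ₁(ζ) - τ₂(ζ^σ)`; it satisfies `i τ₁(x) = τ₂(x) i`. -/
def opI (a b : 𝒪[F]) (g : GL (Idx h) 𝒪[F]) : Matrix (Idx h) (Idx h) 𝒪[F] :=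
  tau1 F h (a, b) - tau2 g (b, a)

/-- `e = τ₁(ζ) - τ₂(ζ)`; it satisfies `e τ₁(x) = τ₂(x^σ) e`. -/
def opE (a b : 𝒪[F]) (g : GL (Idx h) 𝒪[F]) : Matrix (Idx h) (Idx h) 𝒪[F] :=
  tau1 F h (a, b) - tau2 g (a, b)

/-- `δ = i ∘ e`. -/
def opDelta (a b : 𝒪[F]) (g : GL (Idx h) 𝒪[F]) : Matrix (Idx h) (Idx h) 𝒪[F] :=
  opI a b g * opE a b g

/-- The invariant polynomial (of degree `h`) of the pair: the characteristic polynomial of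
`(a - b)⁻² i²` on the subspace `F^h ⊕ 0`, which is stable under `i²`. -/
def invPoly (a b : 𝒪[F]) (g : GL (Idx h) 𝒪[F]) : Polynomial F :=
  ((((a : F) - (b : F)) ^ 2)⁻¹ • toF (opI a b g * opI a b g)).toBlocks₁₁.charpoly

/-! ### Lattices -/

/-- The image `M Λ` of an `𝒪`-submodule `Λ` of `F^{2h}` under a matrix `M`. -/
def latMap (M : Matrix (Idx h) (Idx h) F) (Λ : Submodule 𝒪[F] (Idx h → F)) :
    Submodule 𝒪[F] (Idx h → F) :=
  Λ.map ((Matrix.mulVecLin M).restrictScalars 𝒪[F])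

/-- The standard lattice `Λ₀ = 𝒪^{2h}`. -/
def lat0 (F : Type*) [Field F] [ValuativeRel F] [TopologicalSpace F]
    [IsNonarchimedeanLocalField F] (h : ℕ) : Submodule 𝒪[F] (Idx h → F) :=
  LinearMap.range ((Algebra.linearMap 𝒪[F] F).compLeft (Idx h))

/-- `Λ ∩ ker (τ₁(ζ) - c)`, for `ζ = (a, b)`. -/
def eigenPart (a b c : 𝒪[F]) (Λ : Submodule 𝒪[F] (Idx h → F)) : Submodule 𝒪[F] (Idx h → F) :=
  Λ ⊓ LinearMap.ker
    ((Matrix.mulVecLin (toF (tau1 F h (a, b) - c • 1))).restrictScalars 𝒪[F])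

/-- `Λ₊`: the part of `Λ` on which `τ₁(ζ)` is `a`. -/
def latPlus (a b : 𝒪[F]) (Λ : Submodule 𝒪[F] (Idx h → F)) : Submodule 𝒪[F] (Idx h → F) :=
  eigenPart a b a Λ

/-- `Λ₋`: the part of `Λ` on which `τ₁(ζ)` is `b`. -/
def latMinus (a b : 𝒪[F]) (Λ : Submodule 𝒪[F] (Idx h → F)) : Submodule 𝒪[F] (Idx h → F) :=
  eigenPart a b b Λ

/-- The lattices `Λ ⊂ F^{2h}` with `τᵢ(ζ) Λ = Λ` for `i = 1, 2`. -/
def StableLat (a b : 𝒪[F]) (g : GL (Idx h) 𝒪[F]) : Type _ :=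
  {Λ : Submodule 𝒪[F] (Idx h → F) // Submodule.IsLattice F Λ ∧
    latMap (toF (tau1 F h (a, b))) Λ = Λ ∧ latMap (toF (tau2 g (a, b))) Λ = Λ}

set_option linter.unusedSectionVars false in
lemma latMap_one (Λ : Submodule 𝒪[F] (Idx h → F)) : latMap 1 Λ = Λ := by
  ext v; simp [latMap]

set_option linter.unusedSectionVars false in
lemma latMap_mul (M N : Matrix (Idx h) (Idx h) F) (Λ : Submodule 𝒪[F] (Idx h → F)) :
    latMap (M * N) Λ = latMap M (latMap N Λ) := by
  ext v; simp [latMap, Matrix.mulVec_mulVec]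

/-- Two stable lattices are equivalent if they differ by an element of `Lˣ`. -/
def latSetoid (a b : 𝒪[F]) (g : GL (Idx h) 𝒪[F]) : Setoid (StableLat a b g) where
  r Λ Λ' := ∃ l ∈ unitsL g, Λ.1 = latMap l.val Λ'.1
  iseqv :=
    { refl := fun Λ => ⟨1, one_mem _, by simp [latMap_one]⟩
      symm := by
        rintro Λ Λ' ⟨l, hl, e⟩
        exact ⟨l⁻¹, inv_mem hl, by rw [e, ← latMap_mul, Units.inv_mul, latMap_one]⟩
      trans := by
        rintro Λ Λ' Λ'' ⟨l, hl, e⟩ ⟨m, hm, e'⟩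
        exact ⟨l * m, mul_mem hl hm, by rw [e, e', ← latMap_mul, Units.val_mul]⟩ }

/-- The set of `Lˣ`-classes of stable lattices. -/
abbrev LatClasses (a b : 𝒪[F]) (g : GL (Idx h) 𝒪[F]) : Type _ := Quotient (latSetoid a b g)

/-- The order `Stab(Λ) = {l ∈ L : l Λ ⊂ Λ}`. -/
def stab (g : GL (Idx h) 𝒪[F]) (Λ : Submodule 𝒪[F] (Idx h → F)) :
    Subring (Matrix (Idx h) (Idx h) F) where
  carrier := {l | l ∈ algL g ∧ ∀ v ∈ Λ, l *ᵥ v ∈ Λ}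
  one_mem' := ⟨one_mem _, fun v hv => by simpa using hv⟩
  zero_mem' := ⟨zero_mem _, fun v _ => by simp⟩
  mul_mem' := fun ⟨hx, hx'⟩ ⟨hy, hy'⟩ =>
    ⟨mul_mem hx hy, fun v hv => by
      rw [← Matrix.mulVec_mulVec]; exact hx' _ (hy' v hv)⟩
  add_mem' := fun ⟨hx, hx'⟩ ⟨hy, hy'⟩ =>
    ⟨add_mem hx hy, fun v hv => by
      rw [Matrix.add_mulVec]; exact Λ.add_mem (hx' v hv) (hy' v hv)⟩
  neg_mem' := fun ⟨hx, hx'⟩ =>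
    ⟨neg_mem hx, fun v hv => by
      rw [Matrix.neg_mulVec]; exact Λ.neg_mem (hx' v hv)⟩

/-- `Stab(Λ)ˣ`, as a subgroup of `GL_{2h}(F)`. -/
def unitsStab (g : GL (Idx h) 𝒪[F]) (Λ : Submodule 𝒪[F] (Idx h → F)) : Subgroup (GL (Idx h) F) :=
  (stab g Λ).toSubmonoid.units

/-- The length of the `𝒪`-module `Λ₋ / δ Λ₊` (finite for a stable lattice if `δ` is
invertible). -/
def latLength (a b : 𝒪[F]) (g : GL (Idx h) 𝒪[F]) (Λ : Submodule 𝒪[F] (Idx h → F)) : ℕ :=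
  (Module.length 𝒪[F] (latMinus a b Λ ⧸
    (latMap (toF (opDelta a b g)) (latPlus a b Λ)).submoduleOf (latMinus a b Λ))).toNat

/-- The lattice count `∑ [O_Lˣ : Stab(Λ)ˣ] (-q^{ks})^{length(Λ₋ / δ Λ₊)}` over the classes of stable
lattices. The summand does not depend on the representative of the class. -/
def latticeCount (a b : 𝒪[F]) (g : GL (Idx h) 𝒪[F]) (k : ℕ) (s : ℂ) : ℂ :=
  ∑ᶠ c : LatClasses a b g,
    ((unitsStab g c.out.1).relIndex (unitsIntL g) : ℂ) *
      (-((resCard F : ℂ) ^ ((k : ℂ) * s))) ^ latLength a b g c.out.1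

/-! ### The orbital integral -/

instance : MeasurableSpace (C1 F h) := borel _
instance : BorelSpace (C1 F h) := ⟨rfl⟩
instance (g : GL (Idx h) 𝒪[F]) : MeasurableSpace (unitsL g) := borel _
instance (g : GL (Idx h) 𝒪[F]) : BorelSpace (unitsL g) := ⟨rfl⟩

/-- For `x = (x₁, x₂) ∈ C(τ₁) = GL_h(F) × GL_h(F)`, `|x| = |det(x₁⁻¹ x₂)|`. -/
def absC (x : C1 F h) : ℝ :=
  normAbs ((x.1.val.toBlocks₁₁⁻¹ * x.1.val.toBlocks₂₂).det)

/-- For `x = (x₁, x₂) ∈ C(τ₁) = GL_h(F) × GL_h(F)`, `η_{K/F}(x) = η_{K/F}(det(x₁ x₂))`. -/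
def etaC (K : Type*) [Field K] [Algebra F K] (x : C1 F h) : ℂ :=
  quadChar K ((x.1.val.toBlocks₁₁ * x.1.val.toBlocks₂₂).det)

lemma mem_C1_iff {u : GL (Idx h) F} : u ∈ C1 F h ↔ ∀ x, Commute (toF (tau1 F h x)) u.val := by
  constructor
  · intro hu x
    exact hu.1 _ ⟨x, rfl⟩
  · intro hu
    refine ⟨?_, ?_⟩
    · rintro _ ⟨x, rfl⟩
      exact hu x
    · rintro _ ⟨x, rfl⟩
      exact (hu x).units_inv_right

lemma unitsL_le_C1 (g : GL (Idx h) 𝒪[F]) {l : GL (Idx h) F} (hl : l ∈ unitsL g) : l ∈ C1 F h :=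
  ⟨hl.1.1, hl.2.1⟩

lemma conj_mem_C1 (g : GL (Idx h) 𝒪[F]) {l : GL (Idx h) F} (hl : l ∈ unitsL g) :
    (glMap g)⁻¹ * l * glMap g ∈ C1 F h := by
  rw [mem_C1_iff]
  intro x
  have h2 : toF (tau2 g x) = (glMap g).val * toF (tau1 F h x) * (glMap g)⁻¹.val := by
    have e : (glMap g)⁻¹.val = toF g⁻¹.val := by rw [← map_inv]; rfl
    have e' : (glMap g).val = toF g.val := rfl
    rw [e, e']
    simp only [toF, tau2, ← Matrix.map_mul]
    rfl
  have h1 : toF (tau2 g x) * l.val = l.val * toF (tau2 g x) := hl.1.2 _ ⟨x, rfl⟩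
  rw [h2] at h1
  have h3 := congrArg (fun M => (glMap g)⁻¹.val * M * (glMap g).val) h1
  simp only [mul_assoc, Units.inv_mul_cancel_left, Units.inv_mul, mul_one] at h3
  simp only [Commute, SemiconjBy, Units.val_mul, mul_assoc]
  exact h3

/-- The embedding `l ↦ (l, g⁻¹ l g)` of `Lˣ = C(τ₁) ∩ C(τ₂)` into `C(τ₁) × C(τ₁)`. Through left
translation by its image, `Lˣ` acts on `C(τ₁) × C(τ₁)`, and `u₁⁻¹ g u₂` is invariant. -/
def embL (g : GL (Idx h) 𝒪[F]) : unitsL g →* C1 F h × C1 F h where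
  toFun l := (⟨l.1, unitsL_le_C1 g l.2⟩, ⟨(glMap g)⁻¹ * l.1 * glMap g, conj_mem_C1 g l.2⟩)
  map_one' := by ext1 <;> ext1 <;> simp
  map_mul' x y := by ext1 <;> ext1 <;> simp [mul_assoc]

/-- The quotient `(C(τ₁) ∩ C(τ₂)) \ (C(τ₁) × C(τ₁))`, with the quotient `σ`-algebra. -/
abbrev OrbitSpace (g : GL (Idx h) 𝒪[F]) : Type _ :=
  Quotient (QuotientGroup.rightRel (embL g).range)

/-- `m` is the quotient of the measure `μ` on `C(τ₁) × C(τ₁)` by the measure `ν` on `Lˣ`: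
`∫ φ dμ = ∫_{Lˣ \ C(τ₁) × C(τ₁)} (∫_{Lˣ} φ(l u) dν(l)) dm(u)` for all measurable `φ ≥ 0`. -/
def IsQuotientMeasure (g : GL (Idx h) 𝒪[F]) (μ : Measure (C1 F h × C1 F h))
    (ν : Measure (unitsL g)) (m : Measure (OrbitSpace g)) : Prop :=
  ∀ φ : C1 F h × C1 F h → ℝ≥0∞, Measurable φ →
    ∫⁻ u, φ u ∂μ = ∫⁻ c : OrbitSpace g, (∫⁻ l, φ (embL g l * c.out) ∂ν) ∂m

open Classical in
/-- The quotient measure on `Lˣ \ (C(τ₁) × C(τ₁))`. -/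
def quotientMeasure (g : GL (Idx h) 𝒪[F]) (μ : Measure (C1 F h × C1 F h))
    (ν : Measure (unitsL g)) : Measure (OrbitSpace g) :=
  if H : ∃ m, IsQuotientMeasure g μ ν m then H.choose else 0

/-- The integrand `f(u₁⁻¹ g u₂) η_{K/F}(u₂) |u₁ u₂|^s` of the orbital integral. -/
def orbIntegrand (K : Type*) [Field K] [Algebra F K] (g : GL (Idx h) 𝒪[F])
    (f : GL (Idx h) F → ℂ) (s : ℂ) (u : C1 F h × C1 F h) : ℂ :=
  f (u.1.1⁻¹ * glMap g * u.2.1) * etaC K u.2 * ((absC (u.1 * u.2) : ℝ) : ℂ) ^ s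

/-- The relative orbital integral `O_τ(f, s)` of the pair `(τ₁, τ₂)`, for the Haar measures `μ` on
`C(τ₁)` and `ν` on `Lˣ`. The integrand is a function on the quotient as it is invariant under
`Lˣ` (if `δ` is invertible). -/
def orbitalIntegral (K : Type*) [Field K] [Algebra F K] (g : GL (Idx h) 𝒪[F])
    (μ : Measure (C1 F h)) (ν : Measure (unitsL g)) (f : GL (Idx h) F → ℂ) (s : ℂ) : ℂ :=
  ∫ c : OrbitSpace g, orbIntegrand K g f s c.out ∂(quotientMeasure g (μ.prod μ) ν)

/-- The characteristic function of `GL_{2h}(𝒪)` on `GL_{2h}(F)`. -/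
def charIntGL (F : Type*) [Field F] [ValuativeRel F] [TopologicalSpace F]
    [IsNonarchimedeanLocalField F] (h : ℕ) : GL (Idx h) F → ℂ :=
  Set.indicator (intGL F h : Set (GL (Idx h) F)) 1

end LinearAFL

end

open LinearAFL

/-! The integral is a count of double cosets, and the double cosets are lattices. Put `U = (C(τ₁) ∩
GL_{2h}(𝒪))²`, of volume 1. A pair `(u₁, u₂)` lies in the support of the integrand exactly when
`u₁Λ₀ = g u₂Λ₀`. This common lattice is stable under `τ₁`, because `u₁` commutes with `τ₁`, and
under `τ₂ = gτ₁g⁻¹`, because `u₂` does. Conversely every stable lattice arises, from a single coset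
of `U`. Translation by `Lˣ` on cosets is translation of lattices, and the stabilizer of a coset is
`Stab(Λ)ˣ`. Its image in the quotient therefore has mass `1 / ν(Stab(Λ)ˣ)`, which is the index
`[O_Lˣ : Stab(Λ)ˣ]` divided by `ν(O_Lˣ)` (`integrable_and_integral_quotient`,
`inv_mul_mem_intC1Sq_iff`, `relIndex_mul_measure`).

The integrand depends only on the valuations `p_j`, `m_j` of the determinants of the two blocks of
`u_j`. Since `K / F` is unramified, `η(x) = (-1)^{ord x}` (`quadChar_eq`), so the integrand is
`(-1)^{p₂+m₂} q^{s(p₁+p₂-m₁-m₂)}`. An integrally invertible `i` preserves `Λ` and matches the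
gradings of `τ₁` and `τ₂`, whence `p₂ = p₁` and `m₂ = m₁`; an integrally invertible `e` exchanges
the signs, whence `p₂ = m₁` and `m₂ = p₁`. The exponent of `q^s` is thus `2(p₁-m₁)` or `0`, and the
sign is `(-1)^{p₁-m₁}` in both cases. Finally `p₁ - m₁` is the length of `Λ₋ / δΛ₊`: this length is
the valuation of the determinant of `δ : Λ₊ → Λ₋`, and the condition on `Λ₀` makes the constant term
vanish (`latLength_latMap_lat0`, `orbIntegrand_eq_pow`).

For finiteness, separability identifies `L` with `F[x]/(χ)`, a product of fields, acting on `F^h ⊕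
0` with a cyclic vector. A compactness argument for the norm shows that modules over the order
`𝒪[x]/(χ)` can be scaled by `Lˣ` to lie between two fixed lattices; `δ` transfers the bounds from
`Λ₊` to `Λ₋` (`exists_unit_forall_smul_mem`, `exists_finite_representatives`). The same bounds make
the unit indices finite. -/

noncomputable section

namespace LinearAFL

set_option linter.unusedSectionVars false

variable {F : Type*} [Field F] [ValuativeRel F] [TopologicalSpace F] [IsNonarchimedeanLocalField F]

section

/-! ### The normalized additive valuation -/

/-- The normalized additive valuation of `F`, with value `0` at `0`. -/
def ord (x : F) : ℤ :=
  -WithZero.log (IsNonarchimedeanLocalField.valueGroupWithZeroIsoInt F (valuation F x))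

lemma iso_valuation_ne_zero {x : F} (hx : x ≠ 0) :
    IsNonarchimedeanLocalField.valueGroupWithZeroIsoInt F (valuation F x) ≠ 0 := by
  simpa using hx

lemma normAbs_eq {x : F} (hx : x ≠ 0) : normAbs x = (resCard F : ℝ) ^ (-ord x) := by
  simp [normAbs, hx, ord]

lemma ord_mul {x y : F} (hx : x ≠ 0) (hy : y ≠ 0) : ord (x * y) = ord x + ord y := by
  unfold ord
  rw [map_mul, map_mul, WithZero.log_mul (iso_valuation_ne_zero hx) (iso_valuation_ne_zero hy)]
  ring

@[simp] lemma ord_one : ord (1 : F) = 0 := by simp [ord]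

lemma ord_inv {x : F} (hx : x ≠ 0) : ord x⁻¹ = -ord x := by
  have := ord_mul hx (inv_ne_zero hx)
  rw [mul_inv_cancel₀ hx, ord_one] at this
  linarith

lemma ord_nonneg_iff {x : F} (hx : x ≠ 0) : 0 ≤ ord x ↔ valuation F x ≤ 1 := by
  unfold ord
  rw [neg_nonneg, ← WithZero.log_one, WithZero.log_le_log (iso_valuation_ne_zero hx) one_ne_zero,
    ← map_one (IsNonarchimedeanLocalField.valueGroupWithZeroIsoInt F)]
  exact map_le_map_iff (IsNonarchimedeanLocalField.valueGroupWithZeroIsoInt F)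

lemma ord_nonneg (x : 𝒪[F]) (hx : x ≠ 0) : 0 ≤ ord (x : F) :=
  (ord_nonneg_iff (by simpa using hx)).2 x.2

lemma ord_eq_zero_of_isUnit {x : 𝒪[F]} (hx : IsUnit x) : ord (x : F) = 0 := by
  obtain ⟨u, rfl⟩ := hx
  have h1 := ord_nonneg (u : 𝒪[F]) u.ne_zero
  have h2 := ord_nonneg (↑u⁻¹ : 𝒪[F]) (Units.ne_zero _)
  have h3 : ((u : 𝒪[F]) : F) * ((↑u⁻¹ : 𝒪[F]) : F) = 1 := by
    exact_mod_cast congrArg (Subtype.val) u.mul_inv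
  have h4 := ord_mul (F := F) (x := ((u : 𝒪[F]) : F)) (y := ((↑u⁻¹ : 𝒪[F]) : F))
    (by simp) (by simp)
  rw [h3, ord_one] at h4
  omega

lemma exists_ord_eq (n : ℤ) : ∃ x : F, x ≠ 0 ∧ ord x = n := by
  obtain ⟨y, hy⟩ : ∃ y, IsNonarchimedeanLocalField.valueGroupWithZeroIsoInt F y = WithZero.exp (-n) :=
    (IsNonarchimedeanLocalField.valueGroupWithZeroIsoInt F).surjective _
  obtain ⟨x, rfl⟩ := ValuativeRel.valuation_surjective y
  refine ⟨x, ?_, ?_⟩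
  · rintro rfl
    rw [map_zero, map_zero] at hy
    exact WithZero.exp_ne_zero hy.symm
  · rw [ord, hy]
    simp

lemma isUnit_of_ord_eq_zero {x : F} (hx : x ≠ 0) (h : ord x = 0) :
    ∃ u : 𝒪[F]ˣ, ((u : 𝒪[F]) : F) = x := by
  have h1 := (ord_nonneg_iff hx).1 h.ge
  have h2 := (ord_nonneg_iff (inv_ne_zero hx)).1 (by rw [ord_inv hx, h]; simp)
  exact ⟨⟨⟨x, h1⟩, ⟨x⁻¹, h2⟩, Subtype.ext (mul_inv_cancel₀ hx), Subtype.ext (inv_mul_cancel₀ hx)⟩,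
    rfl⟩

/-- A uniformizer of `F`. -/
def unif (F : Type*) [Field F] [ValuativeRel F] [TopologicalSpace F]
    [IsNonarchimedeanLocalField F] : 𝒪[F] :=
  (IsDiscreteValuationRing.exists_irreducible 𝒪[F]).choose

lemma irreducible_unif : Irreducible (unif F) :=
  (IsDiscreteValuationRing.exists_irreducible 𝒪[F]).choose_spec

lemma unif_ne_zero : unif F ≠ 0 := irreducible_unif.ne_zero

lemma coe_unif_ne_zero : (unif F : F) ≠ 0 := by simpa using unif_ne_zero (F := F)

lemma ord_pow {x : F} (hx : x ≠ 0) (n : ℕ) : ord (x ^ n) = n * ord x := by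
  induction n with
  | zero => simp
  | succ n ih => rw [pow_succ, ord_mul (pow_ne_zero _ hx) hx, ih]; push_cast; ring

lemma ord_zpow {x : F} (hx : x ≠ 0) (n : ℤ) : ord (x ^ n) = n * ord x := by
  cases n with
  | ofNat n => simpa using ord_pow hx n
  | negSucc n =>
    rw [zpow_negSucc, ord_inv (pow_ne_zero _ hx), ord_pow hx, Int.negSucc_eq]; push_cast; ring

@[simp] lemma ord_unif : ord (unif F : F) = 1 := by
  obtain ⟨x, hx, h1⟩ := exists_ord_eq (F := F) 1
  have hxO : valuation F x ≤ 1 := (ord_nonneg_iff hx).1 (by omega)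
  obtain ⟨n, u, hn⟩ := IsDiscreteValuationRing.eq_unit_mul_pow_irreducible
    (x := (⟨x, hxO⟩ : 𝒪[F])) (by simpa [Subtype.ext_iff] using hx) (irreducible_unif (F := F))
  have hn' : x = ((u : 𝒪[F]) : F) * (unif F : F) ^ n := by
    simpa using congrArg Subtype.val hn
  rw [hn', ord_mul (by simp) (pow_ne_zero _ coe_unif_ne_zero), ord_pow coe_unif_ne_zero,
    ord_eq_zero_of_isUnit u.isUnit] at h1
  have := ord_nonneg (unif F) unif_ne_zero
  have h2 : (n : ℤ) ∣ 1 := ⟨_, by linarith⟩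
  have h3 : (n : ℤ) = 1 := Int.eq_one_of_dvd_one (by positivity) h2
  rw [h3] at h1
  linarith

/-- Every nonzero element is a unit times a power of the uniformizer. -/
lemma exists_unit_mul_zpow {x : F} (hx : x ≠ 0) :
    ∃ u : 𝒪[F]ˣ, x = ((u : 𝒪[F]) : F) * (unif F : F) ^ ord x := by
  have h0 : (unif F : F) ^ ord x ≠ 0 := zpow_ne_zero _ coe_unif_ne_zero
  obtain ⟨u, hu⟩ := isUnit_of_ord_eq_zero (x := x * ((unif F : F) ^ ord x)⁻¹)
    (mul_ne_zero hx (inv_ne_zero h0))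
    (by rw [ord_mul hx (inv_ne_zero h0), ord_inv h0, ord_zpow coe_unif_ne_zero, ord_unif]; ring)
  exact ⟨u, by rw [hu, inv_mul_cancel_right₀ h0]⟩

/-- `length (𝒪 / x) = ord x`. -/
lemma ringOrd_eq (x : 𝒪[F]) (hx : x ≠ 0) : Ring.ord 𝒪[F] x = (ord (x : F)).toNat := by
  obtain ⟨n, u, hn⟩ := IsDiscreteValuationRing.eq_unit_mul_pow_irreducible hx
    (irreducible_unif (F := F))
  have h1 : Ring.ord 𝒪[F] (unif F) = 1 := by
    rw [Ring.ord, Module.length_eq_one_iff, isSimpleModule_iff_isCoatom, ← Ideal.isMaximal_def]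
    exact PrincipalIdealRing.isMaximal_of_irreducible irreducible_unif
  have h2 : ∀ n : ℕ, Ring.ord 𝒪[F] (unif F ^ n) = n := by
    intro n
    induction n with
    | zero => simp
    | succ n ih =>
      rw [pow_succ, Ring.ord_mul _ (mem_nonZeroDivisors_of_ne_zero unif_ne_zero), ih, h1]
      push_cast; rfl
  have h3 : ord (x : F) = n := by
    rw [hn, Subring.coe_mul, ord_mul (by simp) (by simp [unif_ne_zero]),
      ord_eq_zero_of_isUnit u.isUnit]
    simp [ord_pow coe_unif_ne_zero]
  rw [h3, hn, Ring.ord_mul _ (mem_nonZeroDivisors_of_ne_zero (pow_ne_zero _ unif_ne_zero)), h2,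
    Ring.ord_of_isUnit u.isUnit]
  simp

end

section

/-! ### Topology of the local field and of its general linear groups -/

instance : T2Space F :=
  letI := IsTopologicalAddGroup.rightUniformSpace F
  haveI := isUniformAddGroup_of_addCommGroup (G := F)
  inferInstance

lemma hasAntitoneBasis_nhds_zero :
    (nhds (0 : F)).HasBasis (fun _ : ℕ => True)
      (fun n => {x | valuation F x ≤ valuation F ((unif F : F) ^ n)}) := by
  refine ⟨fun t => ?_⟩
  rw [(IsValuativeTopology.hasBasis_nhds_zero' F).mem_iff]
  constructor
  · rintro ⟨γ, hγ, ht⟩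
    obtain ⟨y, rfl⟩ := ValuativeRel.valuation_surjective γ
    have hy : y ≠ 0 := by simpa using hγ
    -- The extra 1 turns the weak inequality of the closed ball into the strict one demanded by the
    -- valuative basis.
    refine ⟨(ord y).toNat + 1, trivial, fun x hx => ht ?_⟩
    simp only [Set.mem_ofPred_eq] at hx ⊢
    refine hx.trans_lt ?_
    have h0 : ((unif F : F) ^ ((ord y).toNat + 1)) ≠ 0 := pow_ne_zero _ coe_unif_ne_zero
    by_contra hc
    have h1 : valuation F (y * ((unif F : F) ^ ((ord y).toNat + 1))⁻¹) ≤ 1 := by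
      rw [map_mul, map_inv₀]
      exact mul_inv_le_one_of_le₀ (not_lt.1 hc) zero_le
    have := (ord_nonneg_iff (mul_ne_zero hy (inv_ne_zero h0))).2 h1
    rw [ord_mul hy (inv_ne_zero h0), ord_inv h0, ord_pow coe_unif_ne_zero, ord_unif] at this
    push_cast at this
    omega
  · rintro ⟨n, -, ht⟩
    refine ⟨valuation F ((unif F : F) ^ n), by simp [unif_ne_zero], fun x hx => ht ?_⟩
    exact (Set.mem_ofPred_eq ▸ hx : _ < _).le

lemma isOpen_integers : IsOpen (𝒪[F] : Set F) := Valuation.isOpen_integer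

instance : FirstCountableTopology F := by
  have h0 : (nhds (0 : F)).IsCountablyGenerated :=
    (hasAntitoneBasis_nhds_zero (F := F)).isCountablyGenerated
  refine ⟨fun a => ?_⟩
  rw [← add_zero a, ← map_add_left_nhds]
  infer_instance

instance : SigmaCompactSpace F := by
  refine ⟨⟨fun n => {x | valuation F x ≤ valuation F ((unif F : F) ^ n)⁻¹},
    fun n => IsNonarchimedeanLocalField.isCompact_closedBall F _, ?_⟩⟩
  refine Set.eq_univ_of_forall fun x => ?_
  rw [Set.mem_iUnion]
  rcases eq_or_ne x 0 with rfl | hx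
  · exact ⟨0, by simp⟩
  · refine ⟨(-ord x).toNat, ?_⟩
    have h0 : (unif F : F) ^ (-ord x).toNat ≠ 0 := pow_ne_zero _ coe_unif_ne_zero
    have h1 : valuation F (x * (unif F : F) ^ (-ord x).toNat) ≤ 1 := by
      rw [← ord_nonneg_iff (mul_ne_zero hx h0), ord_mul hx h0, ord_pow coe_unif_ne_zero, ord_unif]
      omega
    rw [map_mul] at h1
    simp only [Set.mem_ofPred_eq, map_inv₀]
    exact (le_mul_inv_iff₀ (zero_lt_iff.2 (by simpa using h0))).2 h1 |>.trans_eq (one_mul _)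

/-- A σ-compact pseudometrizable space is second countable. Countability is what later allows
countably many cosets to cover `C(τ₁) × C(τ₁)`. -/
instance : SecondCountableTopology F :=
  letI := IsTopologicalAddGroup.rightUniformSpace F
  haveI := isUniformAddGroup_of_addCommGroup (G := F)
  haveI : (uniformity F).IsCountablyGenerated := IsUniformAddGroup.uniformity_countably_generated
  haveI : TopologicalSpace.PseudoMetrizableSpace F := UniformSpace.pseudoMetrizableSpace
  letI := TopologicalSpace.pseudoMetrizableSpacePseudoMetric F
  EMetric.secondCountable_of_sigmaCompact F

variable {n : Type*} [Fintype n] [DecidableEq n]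

instance : T2Space (Matrix n n F) := inferInstanceAs (T2Space (n → n → F))
instance : LocallyCompactSpace (Matrix n n F) := inferInstanceAs (LocallyCompactSpace (n → n → F))
instance : SecondCountableTopology (Matrix n n F) :=
  inferInstanceAs (SecondCountableTopology (n → n → F))
instance : CompactSpace (Matrix n n 𝒪[F]) := inferInstanceAs (CompactSpace (n → n → 𝒪[F]))
instance : T2Space (Matrix n n 𝒪[F]) := inferInstanceAs (T2Space (n → n → 𝒪[F]))

instance : SecondCountableTopology (GL n F) :=
  haveI : SecondCountableTopology (Matrix n n F)ᵐᵒᵖ :=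
    MulOpposite.opHomeomorph.symm.secondCountableTopology
  Units.isEmbedding_embedProduct.secondCountableTopology
instance : T2Space (GL n F) := inferInstanceAs (T2Space (Matrix n n F)ˣ)
instance : LocallyCompactSpace (GL n F) := inferInstanceAs (LocallyCompactSpace (Matrix n n F)ˣ)
instance : CompactSpace (GL n 𝒪[F]) := inferInstanceAs (CompactSpace (Matrix n n 𝒪[F])ˣ)

variable {h : ℕ}

lemma continuous_toF : Continuous (toF (F := F) (h := h)) :=
  Continuous.matrix_map continuous_id continuous_subtype_val

lemma isCompact_intGL : IsCompact (intGL F h : Set (GL (Idx h) F)) := by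
  have : Continuous (glMap (F := F) (h := h)) := Continuous.units_map _ continuous_toF
  rw [intGL, MonoidHom.coe_range]
  exact isCompact_range this

lemma mem_intGL_iff {u : GL (Idx h) F} :
    u ∈ intGL F h ↔ (∀ i j, u.val i j ∈ 𝒪[F]) ∧ ∀ i j, u⁻¹.val i j ∈ 𝒪[F] := by
  constructor
  · rintro ⟨g, rfl⟩
    refine ⟨fun i j => (g.val i j).2, fun i j => ?_⟩
    rw [← map_inv]
    exact (g⁻¹.val i j).2
  · rintro ⟨h1, h2⟩
    have hinj : Function.Injective (toF (F := F) (h := h)) :=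
      Matrix.map_injective Subtype.val_injective
    let A : Matrix (Idx h) (Idx h) 𝒪[F] := fun i j => ⟨_, h1 i j⟩
    let B : Matrix (Idx h) (Idx h) 𝒪[F] := fun i j => ⟨_, h2 i j⟩
    have hA : toF A = u.val := rfl
    have hB : toF B = u⁻¹.val := rfl
    have hm : ∀ X Y : Matrix (Idx h) (Idx h) 𝒪[F], toF (X * Y) = toF X * toF Y :=
      fun X Y => Matrix.map_mul
    have h1 : toF (1 : Matrix (Idx h) (Idx h) 𝒪[F]) = 1 := by simp [toF]
    refine ⟨⟨A, B, hinj ?_, hinj ?_⟩, Units.ext hA⟩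
    · rw [hm, h1, hA, hB, Units.mul_inv]
    · rw [hm, h1, hA, hB, Units.inv_mul]

lemma isOpen_intGL : IsOpen (intGL F h : Set (GL (Idx h) F)) := by
  have h1 : IsOpen {M : Matrix (Idx h) (Idx h) F | ∀ i j, M i j ∈ 𝒪[F]} := by
    simp only [Set.ofPred_forall]
    exact isOpen_iInter_of_finite fun i => isOpen_iInter_of_finite fun j =>
      isOpen_integers.preimage (continuous_id.matrix_elem i j)
  have h2 : (intGL F h : Set (GL (Idx h) F)) =
      (fun u : GL (Idx h) F => u.val) ⁻¹' {M | ∀ i j, M i j ∈ 𝒪[F]} ∩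
      (fun u : GL (Idx h) F => u⁻¹.val) ⁻¹' {M | ∀ i j, M i j ∈ 𝒪[F]} := by
    ext u
    exact mem_intGL_iff
  rw [h2]
  exact (h1.preimage Units.continuous_val).inter
    (h1.preimage (Units.continuous_val.comp continuous_inv))

lemma isClosed_units_centAlg (τ : (𝒪[F] × 𝒪[F]) →ₐ[𝒪[F]] Matrix (Idx h) (Idx h) 𝒪[F]) :
    IsClosed ((centAlg τ).toSubmonoid.units : Set (GL (Idx h) F)) := by
  have h1 : IsClosed (centAlg τ : Set (Matrix (Idx h) (Idx h) F)) := by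
    have : (centAlg τ : Set (Matrix (Idx h) (Idx h) F)) =
        ⋂ x, {M | toF (τ x) * M = M * toF (τ x)} := by
      ext M
      rw [Set.mem_iInter]
      exact ⟨fun hM x => hM _ ⟨x, rfl⟩, fun hM => by rintro _ ⟨x, rfl⟩; exact hM x⟩
    rw [this]
    exact isClosed_iInter fun x => isClosed_eq (continuous_const.mul continuous_id)
      (continuous_id.mul continuous_const)
  have h2 : ((centAlg τ).toSubmonoid.units : Set (GL (Idx h) F)) =
      (fun u : GL (Idx h) F => u.val) ⁻¹' (centAlg τ) ∩
      (fun u : GL (Idx h) F => u⁻¹.val) ⁻¹' (centAlg τ) := by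
    ext u
    rfl
  rw [h2]
  exact (h1.preimage Units.continuous_val).inter
    (h1.preimage (Units.continuous_val.comp continuous_inv))

lemma isClosed_C1 : IsClosed (C1 F h : Set (GL (Idx h) F)) := isClosed_units_centAlg _

lemma isClosed_unitsL (g : GL (Idx h) 𝒪[F]) : IsClosed (unitsL g : Set (GL (Idx h) F)) := by
  have : (unitsL g : Set (GL (Idx h) F)) = (C1 F h : Set (GL (Idx h) F)) ∩
      ((centAlg (tau2 g)).toSubmonoid.units : Set (GL (Idx h) F)) := by
    ext u
    exact ⟨fun hu => ⟨⟨hu.1.1, hu.2.1⟩, ⟨hu.1.2, hu.2.2⟩⟩,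
      fun hu => ⟨⟨hu.1.1, hu.2.1⟩, ⟨hu.1.2, hu.2.2⟩⟩⟩
  rw [this]
  exact isClosed_C1.inter (isClosed_units_centAlg _)

instance : LocallyCompactSpace (C1 F h) := isClosed_C1.isClosedEmbedding_subtypeVal.locallyCompactSpace
instance (g : GL (Idx h) 𝒪[F]) : LocallyCompactSpace (unitsL g) :=
  (isClosed_unitsL g).isClosedEmbedding_subtypeVal.locallyCompactSpace

end

section

/-! ### The quadratic character of an unramified extension -/

/-- A quadratic polynomial over a finite field without roots is separable. -/
lemma four_mul_ne_sq_of_no_root {k : Type*} [Field k] [Finite k] {t n : k}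
    (hf : ∀ c : k, c ^ 2 - t * c + n ≠ 0) : 4 * n - t ^ 2 ≠ 0 := by
  intro h0
  -- A vanishing discriminant forces a root: in characteristic 2 it gives `t = 0`, and `n` has a
  -- square root; otherwise `t / 2` is a double root.
  by_cases h2 : (2 : k) = 0
  · have ht : t = 0 := by
      have : t ^ 2 = 0 := by linear_combination -h0 + 2 * n * h2
      exact pow_eq_zero_iff (two_ne_zero) |>.1 this
    have : CharP k 2 := CharTwo.of_one_ne_zero_of_two_eq_zero one_ne_zero h2
    obtain ⟨s, hs⟩ := FiniteField.isSquare_of_char_two (F := k) (ringChar.eq k 2) n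
    refine hf s ?_
    rw [ht, hs]
    linear_combination s * s * h2
  · refine hf (t / 2) ?_
    field_simp
    linear_combination h0

/-- The norm form of an irreducible quadratic polynomial over a finite field is universal. -/
lemma exists_norm_form_eq {k : Type*} [Field k] [Finite k] {t n : k}
    (hf : ∀ c : k, c ^ 2 - t * c + n ≠ 0) (u : k) :
    ∃ p q : k, p ^ 2 + t * p * q + n * q ^ 2 = u := by
  classical
  have := Fintype.ofFinite k
  by_cases h2 : (2 : k) = 0
  · have : CharP k 2 := CharTwo.of_one_ne_zero_of_two_eq_zero one_ne_zero h2
    obtain ⟨s, hs⟩ := FiniteField.isSquare_of_char_two (F := k) (ringChar.eq k 2) u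
    exact ⟨s, 0, by rw [hs]; ring⟩
  · have hd := four_mul_ne_sq_of_no_root hf
    have hchar : ringChar k ≠ 2 := by
      intro hc
      apply h2
      have := ringChar.Nat.cast_ringChar (R := k)
      rw [hc] at this
      exact_mod_cast this
    -- Completing the square by `p = a - (t / 2) b` turns the form into `a² + (n - t² / 4) b²`, so
    -- two quadratic polynomials have to take opposite values; in odd characteristic this follows by
    -- counting values.
    obtain ⟨a, b, hab⟩ := FiniteField.exists_root_sum_quadratic (R := k)
      (f := Polynomial.C 1 * Polynomial.X ^ 2 + Polynomial.C 0 * Polynomial.X + Polynomial.C (-u))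
      (g := Polynomial.C (n - t ^ 2 / 4) * Polynomial.X ^ 2 + Polynomial.C 0 * Polynomial.X
        + Polynomial.C 0)
      (Polynomial.degree_quadratic one_ne_zero)
      (Polynomial.degree_quadratic (by
        intro h0
        apply hd
        have h4 : (4 : k) ≠ 0 := by
          intro h4
          exact h2 (pow_eq_zero_iff (two_ne_zero) |>.1 (by linear_combination h4 : (2 : k) ^ 2 = 0))
        field_simp at h0
        linear_combination h0))
      (FiniteField.odd_card_of_char_ne_two hchar)
    refine ⟨a - t / 2 * b, b, ?_⟩
    simp only [Polynomial.eval_add, Polynomial.eval_mul, Polynomial.eval_C, Polynomial.eval_pow,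
      Polynomial.eval_X] at hab
    have h4 : (4 : k) = 2 * 2 := by norm_num
    rw [h4] at hab
    field_simp at hab ⊢
    linear_combination hab

/-- Hensel's lemma for monic quadratic polynomials. -/
lemma hensel_quadratic (b c a₀ : 𝒪[F]) (h0 : a₀ ^ 2 + b * a₀ + c ∈ IsLocalRing.maximalIdeal 𝒪[F])
    (h1 : 2 * a₀ + b ∉ IsLocalRing.maximalIdeal 𝒪[F]) : ∃ a : 𝒪[F], a ^ 2 + b * a + c = 0 := by
  let := IsTopologicalAddGroup.rightUniformSpace F
  have := isUniformAddGroup_of_addCommGroup (G := F)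
  have hH : HenselianRing 𝒪[F] (IsLocalRing.maximalIdeal 𝒪[F]) := inferInstance
  obtain ⟨a, ha, -⟩ := hH.is_henselian
    (Polynomial.X ^ 2 + (Polynomial.C b * Polynomial.X + Polynomial.C c))
    (Polynomial.monic_X_pow_add (lt_of_le_of_lt Polynomial.degree_linear_le (by norm_num))) a₀
    (by simpa [add_assoc] using h0)
    (by
      refine IsUnit.map _ ?_
      have : IsUnit (2 * a₀ + b) := by simpa using h1
      simpa [one_add_one_eq_two] using this)
  exact ⟨a, by simpa [Polynomial.IsRoot, add_assoc] using ha⟩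

lemma mem_maximalIdeal_iff_residue (x : 𝒪[F]) :
    x ∈ IsLocalRing.maximalIdeal 𝒪[F] ↔ IsLocalRing.residue 𝒪[F] x = 0 :=
  (IsLocalRing.residue_eq_zero_iff x).symm

/-- The norm form of a quadratic polynomial which is irreducible over the residue field represents
every unit. -/
lemma exists_norm_form_eq_unit {t n : 𝒪[F]}
    (hf : ∀ c : 𝒪[F], c ^ 2 - t * c + n ∉ IsLocalRing.maximalIdeal 𝒪[F]) {u : 𝒪[F]}
    (hu : IsUnit u) : ∃ p q : 𝒪[F], p ^ 2 + t * p * q + n * q ^ 2 = u := by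
  set r := IsLocalRing.residue 𝒪[F] with hr
  have hsurj : Function.Surjective r := IsLocalRing.residue_surjective
  have hf' : ∀ c : 𝓀[F], c ^ 2 - r t * c + r n ≠ 0 := by
    intro c hc
    obtain ⟨c, rfl⟩ := hsurj c
    refine hf c ?_
    rw [mem_maximalIdeal_iff_residue, ← hr]
    simpa using hc
  have hn : IsUnit n := by simpa using hf 0
  obtain ⟨p', q', hpq⟩ := exists_norm_form_eq hf' (r u)
  obtain ⟨p, rfl⟩ := hsurj p'
  obtain ⟨q, rfl⟩ := hsurj q'
  -- The gradient of the form at `(p, q)` is `(2p + tq, tp + 2nq)`, a linear system of determinant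
  -- `4n - t²`. If both entries vanished in the residue field, so would `p` and `q`, although the
  -- form takes the unit value `u` there. Hensel's lemma applies in a variable whose partial
  -- derivative is a unit.
  by_cases h1 : 2 * p + t * q ∈ IsLocalRing.maximalIdeal 𝒪[F]
  · by_cases h2 : t * p + 2 * n * q ∈ IsLocalRing.maximalIdeal 𝒪[F]
    · exfalso
      have hd := four_mul_ne_sq_of_no_root hf'
      rw [mem_maximalIdeal_iff_residue, ← hr] at h1 h2
      simp only [map_add, map_mul, map_ofNat] at h1 h2
      have hp : r p = 0 := by
        have : (4 * r n - r t ^ 2) * r p = 0 := by linear_combination 2 * r n * h1 - r t * h2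
        exact (mul_eq_zero.1 this).resolve_left hd
      have hq : r q = 0 := by
        have : (4 * r n - r t ^ 2) * r q = 0 := by linear_combination 2 * h2 - r t * h1
        exact (mul_eq_zero.1 this).resolve_left hd
      rw [hp, hq] at hpq
      have : IsUnit (r u) := hu.map r
      rw [← hpq] at this
      simp at this
    -- Division by the unit `n` makes the equation monic in `q`.
    · obtain ⟨v, hv⟩ := isUnit_iff_exists_inv.1 hn
      obtain ⟨a, ha⟩ := hensel_quadratic (v * (t * p)) (v * (p ^ 2 - u)) q
        (by
          have : q ^ 2 + v * (t * p) * q + v * (p ^ 2 - u)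
              = v * (p ^ 2 + t * p * q + n * q ^ 2 - u) := by
            linear_combination (-q ^ 2) * hv
          rw [this]
          refine Ideal.mul_mem_left _ _ ?_
          rw [mem_maximalIdeal_iff_residue, ← hr]
          simp [hpq])
        (by
          intro hc
          apply h2
          have : t * p + 2 * n * q = n * (2 * q + v * (t * p)) := by
            linear_combination (- t * p) * hv
          rw [this]
          exact Ideal.mul_mem_left _ _ hc)
      exact ⟨p, a, by linear_combination n * ha + (u - p ^ 2 - t * p * a) * hv⟩
  · obtain ⟨a, ha⟩ := hensel_quadratic (t * q) (n * q ^ 2 - u) p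
      (by
        rw [mem_maximalIdeal_iff_residue, ← hr]
        have : p ^ 2 + t * q * p + (n * q ^ 2 - u) = p ^ 2 + t * p * q + n * q ^ 2 - u := by ring
        rw [this]
        simp [hpq]) h1
    exact ⟨a, q, by linear_combination ha⟩

/-- The norm form of a quadratic polynomial which is irreducible over the residue field takes unit
values at primitive vectors. -/
lemma isUnit_norm_form {t n : 𝒪[F]}
    (hf : ∀ c : 𝒪[F], c ^ 2 - t * c + n ∉ IsLocalRing.maximalIdeal 𝒪[F]) {p q : 𝒪[F]}
    (hpq : IsUnit p ∨ IsUnit q) : IsUnit (p ^ 2 + t * p * q + n * q ^ 2) := by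
  by_contra hc
  replace hc : p ^ 2 + t * p * q + n * q ^ 2 ∈ IsLocalRing.maximalIdeal 𝒪[F] := hc
  by_cases hq : IsUnit q
  · obtain ⟨v, rfl⟩ := hq
    have hv : (v : 𝒪[F]) * ↑v⁻¹ = 1 := v.mul_inv
    -- A nonunit value with `q` a unit makes `-p / q` a root in the residue field.
    refine hf (-p * ↑v⁻¹) ?_
    have : (-p * (↑v⁻¹ : 𝒪[F])) ^ 2 - t * (-p * ↑v⁻¹) + n
        = (p ^ 2 + t * p * v + n * v ^ 2) * (↑v⁻¹) ^ 2 := by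
      linear_combination (- t * p * ↑v⁻¹ - n * (v * ↑v⁻¹ + 1)) * hv
    rw [this]
    exact Ideal.mul_mem_right _ _ hc
  · have hp : IsUnit p := hpq.resolve_right hq
    replace hq : q ∈ IsLocalRing.maximalIdeal 𝒪[F] := hq
    have h2 : p ^ 2 ∈ IsLocalRing.maximalIdeal 𝒪[F] := by
      have h3 : p ^ 2 = (p ^ 2 + t * p * q + n * q ^ 2) - (t * p + n * q) * q := by ring
      rw [h3]
      exact Ideal.sub_mem _ hc (Ideal.mul_mem_left _ _ hq)
    exact (IsLocalRing.mem_maximalIdeal _).1 h2 (hp.pow 2)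

/-- A nonzero vector of `F²` is a power of the uniformizer times a primitive vector. -/
lemma exists_primitive_pair {p q : F} (hpq : p ≠ 0 ∨ q ≠ 0) :
    ∃ (k : ℤ) (p' q' : 𝒪[F]), p = (unif F : F) ^ k * p' ∧ q = (unif F : F) ^ k * q' ∧
      (IsUnit p' ∨ IsUnit q') := by
  have key : ∀ {p q : F}, p ≠ 0 → (q = 0 ∨ ord p ≤ ord q) →
      ∃ (k : ℤ) (p' q' : 𝒪[F]), p = (unif F : F) ^ k * p' ∧ q = (unif F : F) ^ k * q' ∧
        IsUnit p' := by
    intro p q hp hq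
    obtain ⟨u, hu⟩ := exists_unit_mul_zpow hp
    have h0 : (unif F : F) ^ ord p ≠ 0 := zpow_ne_zero _ coe_unif_ne_zero
    have hq' : valuation F (((unif F : F) ^ ord p)⁻¹ * q) ≤ 1 := by
      rcases eq_or_ne q 0 with rfl | hq0
      · simp
      · rw [← ord_nonneg_iff (mul_ne_zero (inv_ne_zero h0) hq0), ord_mul (inv_ne_zero h0) hq0,
          ord_inv h0, ord_zpow coe_unif_ne_zero, ord_unif]
        have := hq.resolve_left hq0
        omega
    refine ⟨ord p, u, ⟨_, hq'⟩, ?_, ?_, u.isUnit⟩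
    · rw [mul_comm]; exact hu
    · exact (mul_inv_cancel_left₀ h0 q).symm
  by_cases hp : p = 0
  · obtain ⟨k, q', p', h1, h2, h3⟩ := key (hpq.resolve_left (not_not.2 hp)) (Or.inl hp)
    exact ⟨k, p', q', h2, h1, Or.inr h3⟩
  · by_cases hq : q = 0 ∨ ord p ≤ ord q
    · obtain ⟨k, p', q', h1, h2, h3⟩ := key hp hq
      exact ⟨k, p', q', h1, h2, Or.inl h3⟩
    · push Not at hq
      obtain ⟨k, q', p', h1, h2, h3⟩ := key hq.1 (Or.inr hq.2.le : p = 0 ∨ ord q ≤ ord p)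
      exact ⟨k, p', q', h2, h1, Or.inr h3⟩

end

/-! ### The integral closure and the norm of an unramified quadratic extension -/

section

/-- An unramified quadratic extension is generated by an integral element whose minimal polynomial
has no root in the residue field. -/
lemma exists_unramified_generator (K : Type*) [Field K] [Algebra F K] [Algebra.IsSeparable F K]
    (hK : Module.finrank F K = 2)
    (hunr : Algebra.FormallyUnramified 𝒪[F] (integralClosure 𝒪[F] K)) :
    ∃ (t n : 𝒪[F]) (b : Module.Basis (Fin 2) F K), b 0 = 1 ∧
      b 1 * b 1 = (t : F) • b 1 - (n : F) • 1 ∧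
      ∀ c : 𝒪[F], c ^ 2 - t * c + n ∉ IsLocalRing.maximalIdeal 𝒪[F] := by
  have hfd : FiniteDimensional F K := Module.finite_of_finrank_eq_succ hK
  set B := integralClosure 𝒪[F] K with hB
  have : IsIntegralClosure B 𝒪[F] K := integralClosure.isIntegralClosure _ _
  have : Module.Finite 𝒪[F] B := IsIntegralClosure.finite 𝒪[F] F K B
  have : IsFractionRing B K := integralClosure.isFractionRing_of_finite_extension F K
  have : Module.IsTorsionFree 𝒪[F] B := inferInstance
  have hfree : Module.Free 𝒪[F] B := inferInstance
  have hrank : Module.finrank 𝒪[F] B = 2 := by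
    rw [IsIntegralClosure.rank 𝒪[F] F K B, hK]
  -- a basis of `B` over `𝒪` containing `1`
  obtain ⟨θ, hθ⟩ : ∃ θ : B, ∀ z : B, ∃ x y : 𝒪[F], z = x • 1 + y • θ := by
    let b := Module.finBasisOfFinrankEq 𝒪[F] B hrank
    have key : ∀ i j : Fin 2, (∀ z, z = b.repr z i • b i + b.repr z j • b j) →
        IsUnit (b.repr 1 i) → ∃ θ : B, ∀ z : B, ∃ x y : 𝒪[F], z = x • 1 + y • θ := by
      intro i j hij hu
      obtain ⟨w, hw⟩ := isUnit_iff_exists_inv.1 hu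
      refine ⟨b j, fun z => ⟨b.repr z i * w, b.repr z j - b.repr z i * w * b.repr 1 j, ?_⟩⟩
      have h1 : b i = w • 1 - (w * b.repr 1 j) • b j := by
        have h2 : w • (1 : B) = w • (b.repr 1 i • b i + b.repr 1 j • b j) :=
          congrArg (w • ·) (hij 1)
        rw [h2, smul_add, smul_smul, smul_smul, mul_comm w (b.repr 1 i), hw, one_smul,
          add_sub_cancel_right]
      conv_lhs => rw [hij z, h1]
      module
    have hb : ∀ z, z = b.repr z 0 • b 0 + b.repr z 1 • b 1 := fun z => by
      conv_lhs => rw [← b.sum_repr z, Fin.sum_univ_two]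
    by_cases h0 : IsUnit (b.repr 1 0)
    · exact key 0 1 hb h0
    · by_cases h1 : IsUnit (b.repr 1 1)
      · exact key 1 0 (fun z => by rw [add_comm]; exact hb z) h1
      -- If no coordinate of `1` were a unit, then `1 = πz` in `B`, so `π⁻¹` would be integral over
      -- `𝒪` and hence lie in `𝒪`.
      · exfalso
        replace h0 : b.repr 1 0 ∈ IsLocalRing.maximalIdeal 𝒪[F] := h0
        replace h1 : b.repr 1 1 ∈ IsLocalRing.maximalIdeal 𝒪[F] := h1
        rw [irreducible_unif.maximalIdeal_eq, Ideal.mem_span_singleton] at h0 h1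
        obtain ⟨x, hx⟩ := h0
        obtain ⟨y, hy⟩ := h1
        have h2 : (1 : B) = unif F • (x • b 0 + y • b 1) := by
          conv_lhs => rw [hb 1, hx, hy]
          module
        set z := x • b 0 + y • b 1 with hz
        have h3 : (z : K) = algebraMap F K (unif F : F)⁻¹ := by
          rw [map_inv₀]
          refine eq_inv_of_mul_eq_one_right ?_
          have := congrArg (algebraMap B K) h2
          rw [Algebra.smul_def, map_mul, map_one] at this
          exact this.symm
        have h4 : IsIntegral 𝒪[F] (unif F : F)⁻¹ := by
          have := z.2
          rw [h3] at this
          exact (isIntegral_algebraMap_iff (algebraMap F K).injective).1 this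
        obtain ⟨w, hw⟩ := IsIntegrallyClosed.isIntegral_iff.1 h4
        refine irreducible_unif.not_isUnit (isUnit_iff_exists_inv.2 ⟨w, ?_⟩)
        apply Subtype.ext
        change (unif F : F) * (algebraMap 𝒪[F] F w) = 1
        rw [hw, mul_inv_cancel₀ coe_unif_ne_zero]
  let bO : Module.Basis (Fin 2) 𝒪[F] B := basisOfTopLeSpanOfCardEqFinrank ![1, θ]
    (fun z _ => by
      obtain ⟨x, y, rfl⟩ := hθ z
      exact Submodule.add_mem _ (Submodule.smul_mem _ _ (Submodule.subset_span ⟨0, rfl⟩))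
        (Submodule.smul_mem _ _ (Submodule.subset_span ⟨1, rfl⟩)))
    (by simp [hrank])
  have hbO : ⇑bO = ![1, θ] := coe_basisOfTopLeSpanOfCardEqFinrank _ _ _
  have hindep : ∀ x y : 𝒪[F], x • (1 : B) + y • θ = 0 → x = 0 ∧ y = 0 := by
    have := bO.linearIndependent
    rw [hbO] at this
    exact LinearIndependent.pair_iff.1 this
  obtain ⟨n', t, htn⟩ := hθ (θ * θ)
  have hnotF : ∀ c : F, (θ : K) ≠ algebraMap F K c := by
    intro c hc
    have h1 : IsIntegral 𝒪[F] c := by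
      have := θ.2
      rw [hc] at this
      exact (isIntegral_algebraMap_iff (algebraMap F K).injective).1 this
    obtain ⟨w, hw⟩ := IsIntegrallyClosed.isIntegral_iff.1 h1
    have h2 : w • (1 : B) + (-1 : 𝒪[F]) • θ = 0 := by
      refine Subtype.ext ?_
      have : ((w • (1 : B) : B) : K) = algebraMap F K (algebraMap 𝒪[F] F w) := by
        rw [← IsScalarTower.algebraMap_apply, Algebra.smul_def, mul_one]; rfl
      simp [this, hw, hc]
    simpa using (hindep _ _ h2).2
  have hlin : LinearIndependent F ![(1 : K), (θ : K)] := by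
    rw [LinearIndependent.pair_iff]
    intro x y hxy
    by_cases hy : y = 0
    · subst hy
      simpa using hxy
    · exfalso
      refine hnotF (-x / y) ?_
      rw [Algebra.smul_def, Algebra.smul_def, mul_one] at hxy
      have hy' : algebraMap F K y ≠ 0 := by simpa using hy
      rw [map_div₀, map_neg, eq_div_iff hy']
      linear_combination hxy
  let bK : Module.Basis (Fin 2) F K := basisOfLinearIndependentOfCardEqFinrank hlin (by simp [hK])
  have hbK : ⇑bK = ![(1 : K), (θ : K)] := coe_basisOfLinearIndependentOfCardEqFinrank _ _
  have htnK : (θ : K) * θ = (t : F) • (θ : K) + (n' : F) • (1 : K) := by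
    have := congrArg (algebraMap B K) htn
    rw [add_comm, map_mul, map_add] at this
    exact this
  refine ⟨t, -n', bK, by simp [hbK], ?_, ?_⟩
  · simp only [hbK, Matrix.cons_val_one, Matrix.cons_val_zero]
    rw [htnK]
    simp
  · intro c hc
    -- Suppose that `c` is a root modulo `π`. If it is a double root, then `(θ - c)² ∈ πB`;
    -- unramifiedness makes `πB` radical, so `π` divides `θ - c`, which contradicts that `1, θ` is a
    -- basis. If it is simple, it lifts to a root `a ∈ 𝒪`, so `θ` is `a` or `t - a` and lies in `F`.
    by_cases hd : 2 * c + (-t) ∈ IsLocalRing.maximalIdeal 𝒪[F]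
    · have hm : (IsLocalRing.maximalIdeal 𝒪[F]).map (algebraMap 𝒪[F] B) =
          Ideal.span {algebraMap 𝒪[F] B (unif F)} := by
        rw [irreducible_unif.maximalIdeal_eq, Ideal.map_span, Set.image_singleton]
      have hrad : ((IsLocalRing.maximalIdeal 𝒪[F]).map (algebraMap 𝒪[F] B)).IsRadical :=
        Algebra.FormallyUnramified.isRadical_map_isMaximal _ _ _
      have h1 : (θ - c • 1) ^ 2 ∈ (IsLocalRing.maximalIdeal 𝒪[F]).map (algebraMap 𝒪[F] B) := by
        have h2 : (θ - c • 1) ^ 2 = algebraMap 𝒪[F] B (-(2 * c + (-t))) * θ +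
            algebraMap 𝒪[F] B (c * (2 * c + (-t)) - (c ^ 2 - t * c + -n')) := by
          rw [sq, sub_mul, mul_sub, htn]
          simp only [map_neg, map_add, map_sub, map_mul, map_ofNat, map_pow, Algebra.smul_def]
          ring
        rw [h2]
        exact Ideal.add_mem _ (Ideal.mul_mem_right _ _ (Ideal.mem_map_of_mem _ (neg_mem hd)))
          (Ideal.mem_map_of_mem _ (sub_mem (Ideal.mul_mem_left _ _ hd) hc))
      have h2 := hrad ⟨2, h1⟩
      rw [hm, Ideal.mem_span_singleton] at h2
      obtain ⟨z, hz⟩ := h2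
      obtain ⟨x, y, rfl⟩ := hθ z
      have h3 : (-c - unif F * x) • (1 : B) + (1 - unif F * y) • θ = 0 := by
        rw [← Algebra.smul_def, sub_eq_iff_eq_add] at hz
        conv_lhs => rw [sub_smul 1, one_smul]; enter [2, 1]; rw [hz]
        module
      refine irreducible_unif.not_isUnit (isUnit_iff_exists_inv.2 ⟨y, ?_⟩)
      exact (sub_eq_zero.1 (hindep _ _ h3).2).symm
    · obtain ⟨a, ha⟩ := hensel_quadratic (-t) (-n') c (by simpa [sub_eq_add_neg] using hc) hd
      have h1 : ((θ : K) - algebraMap F K a) * ((θ : K) - algebraMap F K (t - a)) = 0 := by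
        have ha' : (a : F) ^ 2 + -(t : F) * a + -(n' : F) = 0 := by
          simpa using congrArg (Subtype.val) ha
        have ha'' := congrArg (algebraMap F K) ha'
        simp only [map_add, map_mul, map_neg, map_pow, map_zero] at ha''
        rw [Algebra.smul_def, Algebra.smul_def] at htnK
        rw [map_sub]
        linear_combination htnK - ha''
      rcases mul_eq_zero.1 h1 with h2 | h2
      · exact hnotF _ (sub_eq_zero.1 h2)
      · exact hnotF _ (sub_eq_zero.1 h2)

/-- The quadratic character of an unramified quadratic extension. -/
lemma quadChar_eq (K : Type*) [Field K] [Algebra F K] [Algebra.IsSeparable F K]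
    (hK : Module.finrank F K = 2)
    (hunr : Algebra.FormallyUnramified 𝒪[F] (integralClosure 𝒪[F] K)) {x : F} (hx : x ≠ 0) :
    quadChar K x = (-1) ^ ord x := by
  obtain ⟨t, n, b, hb0, hb1, hf⟩ := exists_unramified_generator K hK hunr
  have hnorm : ∀ p q : F, Algebra.norm F (p • b 0 + q • b 1) = p ^ 2 + t * p * q + n * q ^ 2 := by
    intro p q
    rw [Algebra.norm_eq_matrix_det b, Matrix.det_fin_two]
    have e0 : (p • b 0 + q • b 1) * b 0 = p • b 0 + q • b 1 := by rw [hb0, mul_one]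
    have e1 : (p • b 0 + q • b 1) * b 1 = (-(n * q)) • b 0 + (p + t * q) • b 1 := by
      rw [add_mul, smul_mul_assoc, smul_mul_assoc, hb1, hb0, one_mul]
      module
    simp only [Algebra.leftMulMatrix_eq_repr_mul, e0, e1]
    simp
    ring
  have hunif : ∀ k : ℤ, ((unif F : F) ^ k) ^ 2 = (unif F : F) ^ (2 * k) := fun k => by
    rw [mul_comm, zpow_mul]; norm_cast
  -- A nonzero element of `K` is `π^k` times a primitive one, whose norm is a unit, so norms have
  -- even valuation. Conversely units are norms, and `π^{2k}` is the norm of `π^k`.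
  have hiff : (∃ y : K, Algebra.norm F y = x) ↔ Even (ord x) := by
    constructor
    · rintro ⟨y, rfl⟩
      have hy : y = b.repr y 0 • b 0 + b.repr y 1 • b 1 := by
        conv_lhs => rw [← b.sum_repr y, Fin.sum_univ_two]
      have hpq : b.repr y 0 ≠ 0 ∨ b.repr y 1 ≠ 0 := by
        by_contra! hc
        rw [hc.1, hc.2, zero_smul, zero_smul, add_zero] at hy
        rw [hy] at hx
        exact hx (by simpa using hnorm 0 0)
      obtain ⟨k, p, q, hp, hq, hu⟩ := exists_primitive_pair hpq
      rw [hy, hnorm, hp, hq]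
      have h1 : ((unif F : F) ^ k * p) ^ 2 + t * ((unif F : F) ^ k * p) * ((unif F : F) ^ k * q) +
          n * ((unif F : F) ^ k * q) ^ 2 =
          ((p ^ 2 + t * p * q + n * q ^ 2 : 𝒪[F]) : F) * (unif F : F) ^ (2 * k) := by
        rw [← hunif]
        push_cast
        ring
      have h2 := isUnit_norm_form hf hu
      rw [h1, ord_mul (by simpa only [ne_eq, ZeroMemClass.coe_eq_zero] using h2.ne_zero) (zpow_ne_zero _ coe_unif_ne_zero),
        ord_eq_zero_of_isUnit h2, ord_zpow coe_unif_ne_zero, ord_unif]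
      exact ⟨k, by ring⟩
    · rintro ⟨k, hk⟩
      obtain ⟨u, hu⟩ := exists_unit_mul_zpow hx
      obtain ⟨p, q, hpq⟩ := exists_norm_form_eq_unit hf u.isUnit
      refine ⟨((unif F : F) ^ k * p) • b 0 + ((unif F : F) ^ k * q) • b 1, ?_⟩
      rw [hnorm, hu, ← hpq, show ord x = 2 * k by omega, ← hunif]
      push_cast
      ring
  rw [quadChar]
  by_cases he : Even (ord x)
  · rw [if_pos (hiff.2 he), he.neg_one_zpow]
  · rw [if_neg (fun hc => he (hiff.1 hc)), (Int.not_even_iff_odd.1 he).neg_one_zpow]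

end

section

/-! ### Finiteness of modules over the ring of integers -/

/-- There are finitely many submodules between a finitely generated module and a nonzero multiple
of it. -/
lemma finite_submodules_between {V : Type*} [AddCommGroup V] [Module 𝒪[F] V]
    {X : Submodule 𝒪[F] V} (hX : X.FG) (n : ℕ) :
    {Y : Submodule 𝒪[F] V | Y ≤ X ∧ ∀ x ∈ X, unif F ^ n • x ∈ Y}.Finite := by
  -- A submodule containing `πⁿX` is determined by its image in `X / πⁿX`, which is finite, being
  -- finitely generated over the finite ring `𝒪 / πⁿ`.
  set I : Ideal 𝒪[F] := IsLocalRing.maximalIdeal 𝒪[F] ^ n with hI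
  have : Finite (𝒪[F] ⧸ I) := by
    have : Finite (𝒪[F] ⧸ IsLocalRing.maximalIdeal 𝒪[F]) := inferInstanceAs (Finite 𝓀[F])
    exact Ideal.finite_quotient_pow (IsNoetherian.noetherian _) n
  have : Module.Finite 𝒪[F] X := Module.Finite.iff_fg.2 hX
  let Q := X ⧸ (I • ⊤ : Submodule 𝒪[F] X)
  have : Module.Finite (𝒪[F] ⧸ I) Q := Module.Finite.of_restrictScalars_finite 𝒪[F] _ _
  have hQ : Finite Q := Module.finite_of_finite (𝒪[F] ⧸ I)
  have : Finite (Submodule 𝒪[F] Q) := Finite.of_injective _ SetLike.coe_injective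
  refine Set.Finite.of_finite_image (f := fun Y => (Y.submoduleOf X).map
    (Submodule.mkQ (I • ⊤ : Submodule 𝒪[F] X)))
    (Set.toFinite (α := Submodule 𝒪[F] Q) _) ?_
  have hle : ∀ Y : Submodule 𝒪[F] V, (∀ x ∈ X, unif F ^ n • x ∈ Y) →
      (I • ⊤ : Submodule 𝒪[F] X) ≤ Y.submoduleOf X := by
    intro Y hY
    rw [Submodule.smul_le]
    intro r hr x _
    rw [hI, irreducible_unif.maximalIdeal_eq, Ideal.span_singleton_pow,
      Ideal.mem_span_singleton] at hr
    obtain ⟨s, rfl⟩ := hr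
    rw [mul_comm, mul_smul]
    exact Submodule.smul_mem _ _ (hY _ x.2)
  rintro Y ⟨hY1, hY2⟩ Z ⟨hZ1, hZ2⟩ hYZ
  have h1 := congrArg (Submodule.comap (Submodule.mkQ _)) hYZ
  simp only [Submodule.comap_map_mkQ] at h1
  rw [sup_eq_right.2 (hle Y hY2), sup_eq_right.2 (hle Z hZ2)] at h1
  have h2 := congrArg (Submodule.map X.subtype) h1
  simpa [Submodule.submoduleOf, Submodule.map_comap_subtype, inf_eq_right.2 hY1,
    inf_eq_right.2 hZ1] using h2

lemma exists_pow_mul_mem_of_isOpen {U : Set 𝒪[F]} (hU : IsOpen U) (h0 : (0 : 𝒪[F]) ∈ U) :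
    ∃ n : ℕ, ∀ x : 𝒪[F], unif F ^ n * x ∈ U := by
  have h1 : U ∈ nhds (0 : 𝒪[F]) := hU.mem_nhds h0
  rw [nhds_subtype_eq_comap] at h1
  obtain ⟨n, -, hn⟩ := ((hasAntitoneBasis_nhds_zero (F := F)).comap _).mem_iff.1 h1
  refine ⟨n, fun x => hn ?_⟩
  simp only [Set.mem_preimage, Set.mem_ofPred_eq, Subring.coe_mul, map_mul, Subring.coe_pow]
  exact mul_le_of_le_one_right' x.2

/-! ### Divisibility in an order -/

section Order

variable {A : Type*} [CommRing A] [Algebra 𝒪[F] A] [Module.Finite 𝒪[F] A] [Module.Free 𝒪[F] A]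

omit [Module.Finite 𝒪[F] A] [Module.Free 𝒪[F] A] in
/-- An element divides its norm. -/
lemma exists_mul_eq_norm {ι : Type*} [Fintype ι] [DecidableEq ι] (b : Module.Basis ι 𝒪[F] A)
    (z : A) : ∃ w : A, z * w = algebraMap 𝒪[F] A (Algebra.norm 𝒪[F] z) := by
  -- The cofactor is the adjugate of the multiplication matrix applied to `1`.
  refine ⟨b.equivFun.symm ((Algebra.leftMulMatrix b z).adjugate *ᵥ (b.equivFun 1)), ?_⟩
  apply b.equivFun.injective
  have h1 : ∀ y, b.equivFun (z * y) = Algebra.leftMulMatrix b z *ᵥ b.equivFun y := fun y =>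
    (Algebra.leftMulMatrix_mulVec_repr b z y).symm
  rw [h1, LinearEquiv.apply_symm_apply, Matrix.mulVec_mulVec, Matrix.mul_adjugate,
    Algebra.algebraMap_eq_smul_one, map_smul, Algebra.norm_eq_matrix_det b, Matrix.smul_mulVec,
    Matrix.one_mulVec]

/-- In an order in a field, all elements outside `πA` divide a fixed power of `π`. -/
lemma exists_forall_dvd_pow_unif [IsDomain A] :
    ∃ N : ℕ, ∀ z : A, (¬ ∃ w : A, z = unif F • w) → ∃ w : A, z * w = unif F ^ N • 1 := by
  classical
  let b := Module.Free.chooseBasis 𝒪[F] A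
  let ι := Module.Free.ChooseBasisIndex 𝒪[F] A
  -- The norm `f` is a continuous function of the coordinates. It has no zero on the compact set of
  -- vectors with a unit coordinate, that is, outside `πA`; its image there is closed and misses
  -- `0`, hence misses some `π^N 𝒪`. The norms of such elements therefore divide `π^N`, and each
  -- element divides its norm.
  let f : (ι → 𝒪[F]) → 𝒪[F] := fun c => (Algebra.leftMulMatrix b (b.equivFun.symm c)).det
  have hf : Continuous f := by
    refine Continuous.matrix_det ?_
    have : (fun c : ι → 𝒪[F] => Algebra.leftMulMatrix b (b.equivFun.symm c)) =
        fun c => ∑ i, c i • Algebra.leftMulMatrix b (b i) := by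
      ext1 c
      rw [b.equivFun_symm_apply, map_sum]
      simp only [map_smul]
    rw [this]
    exact continuous_finsetSum _ fun i _ => (continuous_apply i).smul continuous_const
  have hunits : IsClosed {x : 𝒪[F] | IsUnit x} := by
    have : {x : 𝒪[F] | IsUnit x} = Set.range (Units.val : 𝒪[F]ˣ → 𝒪[F]) := by
      ext x; rfl
    rw [this]
    exact (isCompact_range Units.continuous_val).isClosed
  have hS : IsClosed (⋃ i, {c : ι → 𝒪[F] | IsUnit (c i)}) :=
    isClosed_iUnion_of_finite fun i => IsClosed.preimage (f := fun c : ι → 𝒪[F] => c i)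
      (continuous_apply i) hunits
  have hfS : IsClosed (f '' (⋃ i, {c : ι → 𝒪[F] | IsUnit (c i)})) :=
    (hS.isCompact.image hf).isClosed
  have hf0 : ∀ c, f c = Algebra.norm 𝒪[F] (b.equivFun.symm c) := fun c =>
    (Algebra.norm_eq_matrix_det b _).symm
  obtain ⟨N, hN⟩ := exists_pow_mul_mem_of_isOpen hfS.isOpen_compl (by
    rintro ⟨c, hc, h0⟩
    rw [hf0, ← not_ne_iff, Algebra.norm_ne_zero_iff, not_ne_iff,
      LinearEquiv.map_eq_zero_iff] at h0
    obtain ⟨i, hi⟩ := Set.mem_iUnion.1 hc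
    rw [h0] at hi
    exact not_isUnit_zero hi)
  refine ⟨N, fun z hz => ?_⟩
  have hzS : b.equivFun z ∈ ⋃ i, {c : ι → 𝒪[F] | IsUnit (c i)} := by
    by_contra hc
    simp only [Set.mem_iUnion, not_exists] at hc
    have h1 : ∀ i, ∃ s, b.equivFun z i = unif F * s := fun i => by
      have : b.equivFun z i ∈ IsLocalRing.maximalIdeal 𝒪[F] := hc i
      rwa [irreducible_unif.maximalIdeal_eq, Ideal.mem_span_singleton] at this
    choose s hs using h1
    refine hz ⟨b.equivFun.symm s, b.equivFun.injective ?_⟩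
    rw [map_smul, LinearEquiv.apply_symm_apply]
    ext1 i
    exact hs i
  obtain ⟨w, hw⟩ := exists_mul_eq_norm b z
  have hnorm : ∃ s, unif F ^ N = Algebra.norm 𝒪[F] z * s := by
    have h1 : ¬ ∃ r, Algebra.norm 𝒪[F] z = unif F ^ N * r := by
      rintro ⟨r, hr⟩
      refine hN r ⟨_, hzS, ?_⟩
      rw [hf0, LinearEquiv.symm_apply_apply, hr]
    rcases ValuationRing.dvd_total (Algebra.norm 𝒪[F] z) (unif F ^ N) with h | h
    · exact h
    · exact absurd h h1
  obtain ⟨s, hs⟩ := hnorm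
  refine ⟨s • w, ?_⟩
  rw [mul_smul_comm, hw, hs, Algebra.algebraMap_eq_smul_one, smul_smul, mul_comm]

omit [Algebra 𝒪[F] A] [Module.Finite 𝒪[F] A] [Module.Free 𝒪[F] A] in
/-- Nonzero elements of a finite free module are not divisible by all powers of `π`. -/
lemma exists_not_pow_unif_dvd [Algebra 𝒪[F] A] [Module.Free 𝒪[F] A] {z : A} (hz : z ≠ 0) :
    ∃ k : ℕ, ¬ ∃ w : A, z = unif F ^ k • w := by
  let b := Module.Free.chooseBasis 𝒪[F] A
  obtain ⟨i, hi⟩ : ∃ i, b.repr z i ≠ 0 := by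
    by_contra! hc
    exact hz (b.repr.injective (by ext i; simpa using hc i))
  obtain ⟨k, u, hk⟩ := IsDiscreteValuationRing.eq_unit_mul_pow_irreducible hi
    (irreducible_unif (F := F))
  refine ⟨k + 1, ?_⟩
  rintro ⟨w, hw⟩
  have h1 : unif F ^ k * (unif F * b.repr w i) = unif F ^ k * u := by
    rw [mul_comm _ (u : 𝒪[F]), ← hk, hw, map_smul, Finsupp.smul_apply, smul_eq_mul, pow_succ,
      mul_assoc]
  have h2 := mul_left_cancel₀ (pow_ne_zero _ unif_ne_zero) h1
  exact irreducible_unif.not_isUnit (isUnit_of_mul_isUnit_left (h2 ▸ u.isUnit))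

end Order

/-! ### Modules over an order in a field -/

section Fields

variable {E : Type*} [Field E] [Algebra F E] [Algebra 𝒪[F] E] [IsScalarTower 𝒪[F] F E]

lemma unif_smul_ne_zero {V : Type*} [AddCommGroup V] [Module F V] [Module 𝒪[F] V]
    [IsScalarTower 𝒪[F] F V] (n : ℕ) {v : V} (hv : v ≠ 0) : unif F ^ n • v ≠ 0 := by
  rw [← algebraMap_smul F (unif F ^ n) v]
  refine smul_ne_zero ?_ hv
  rw [map_pow]
  exact pow_ne_zero _ coe_unif_ne_zero

lemma unif_smul_injective {V : Type*} [AddCommGroup V] [Module F V] [Module 𝒪[F] V]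
    [IsScalarTower 𝒪[F] F V] (n : ℕ) {v w : V} (h : unif F ^ n • v = unif F ^ n • w) : v = w := by
  by_contra hc
  refine unif_smul_ne_zero (F := F) n (sub_ne_zero.2 hc) ?_
  rw [smul_sub, h, sub_self]

lemma exists_pow_smul_mem_of_fg {V : Type*} [AddCommGroup V] [Module 𝒪[F] V]
    {X Y : Submodule 𝒪[F] V} (hX : X.FG) (hY : ∀ v, ∃ n : ℕ, unif F ^ n • v ∈ Y) :
    ∃ n : ℕ, ∀ x ∈ X, unif F ^ n • x ∈ Y := by
  classical
  obtain ⟨S, rfl⟩ := hX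
  choose m hm using hY
  refine ⟨S.sup m, fun x hx => ?_⟩
  have : Submodule.span 𝒪[F] (S : Set V) ≤
      Y.comap (unif F ^ (S.sup m) • LinearMap.id : V →ₗ[𝒪[F]] V) := by
    rw [Submodule.span_le]
    intro v hv
    simp only [SetLike.mem_coe, Submodule.mem_comap, LinearMap.smul_apply, LinearMap.id_apply]
    obtain ⟨j, hj⟩ := Nat.exists_eq_add_of_le (Finset.le_sup (f := m) hv)
    rw [hj, add_comm, pow_add, mul_smul]
    exact Y.smul_mem _ (hm v)
  exact this hx

/-- Every nonzero finitely generated module in a field `E` has an element `x` such that all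
`y / x` lie in a fixed multiple of a given order. -/
lemma exists_forall_smul_inv_mul_mem (A : Subalgebra 𝒪[F] E) [Module.Finite 𝒪[F] A]
    (hA : ∀ e : E, ∃ n : ℕ, unif F ^ n • e ∈ A) :
    ∃ N : ℕ, ∀ Λ : Submodule 𝒪[F] E, Λ.FG → Λ ≠ ⊥ →
      ∃ x ∈ Λ, x ≠ 0 ∧ ∀ y ∈ Λ, unif F ^ N • (x⁻¹ * y) ∈ A := by
  have hinj : Function.Injective (algebraMap 𝒪[F] E) := by
    rw [IsScalarTower.algebraMap_eq 𝒪[F] F E]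
    exact (algebraMap F E).injective.comp Subtype.val_injective
  have : Module.IsTorsionFree 𝒪[F] E := Module.isTorsionFree_iff_algebraMap_injective.2 hinj
  have hfree : Module.Free 𝒪[F] A := inferInstance
  obtain ⟨N, hN⟩ := exists_forall_dvd_pow_unif (F := F) (A := A)
  refine ⟨N, fun Λ hfg hne => ?_⟩
  obtain ⟨m, hm⟩ := exists_pow_smul_mem_of_fg (Y := A.toSubmodule) hfg hA
  obtain ⟨x₀, hx₀, hx₀'⟩ := Submodule.exists_mem_ne_zero_of_ne_bot hne
  have hex : ∃ k : ℕ, ∃ x ∈ Λ, ¬ ∃ w ∈ A, unif F ^ m • x = unif F ^ (k + 1) • w := by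
    obtain ⟨k, hk⟩ := exists_not_pow_unif_dvd (F := F) (A := A)
      (z := ⟨unif F ^ m • x₀, hm _ hx₀⟩)
      (fun hc => unif_smul_ne_zero (F := F) m hx₀' (congrArg Subtype.val hc))
    refine ⟨k, x₀, hx₀, ?_⟩
    rintro ⟨w, hw, hw'⟩
    refine hk ⟨unif F • ⟨w, hw⟩, Subtype.ext ?_⟩
    rw [smul_smul, ← pow_succ]
    exact hw'
  classical
  -- The number `k` is the largest with `π^m Λ ⊂ π^k A`, and `x` attains it. Thus `π^m x = π^k x'`
  -- with `x' ∈ A` outside `πA`, so `x'` divides `π^N`. For `y ∈ Λ`, writing `π^m y = π^k y'` gives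
  -- `y / x = y' / x'`.
  obtain ⟨x, hx, hxk⟩ := Nat.find_spec hex
  set k := Nat.find hex with hk
  have hall : ∀ y ∈ Λ, ∃ w ∈ A, unif F ^ m • y = unif F ^ k • w := by
    intro y hy
    rcases Nat.eq_zero_or_pos k with h0 | h0
    · exact ⟨_, hm y hy, by rw [h0, pow_zero, one_smul]⟩
    · have := Nat.find_min hex (m := k - 1) (by omega)
      push Not at this
      have h1 := this y hy
      rwa [Nat.sub_add_cancel h0] at h1
  obtain ⟨x', hx'A, hx'⟩ := hall x hx
  obtain ⟨w, hw⟩ := hN ⟨x', hx'A⟩ (by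
    rintro ⟨w, hw⟩
    refine hxk ⟨w, w.2, ?_⟩
    rw [hx', pow_succ, mul_smul]
    exact congrArg (unif F ^ k • ·) (congrArg Subtype.val hw))
  have hw' : x' * (w : E) = unif F ^ N • 1 := congrArg Subtype.val hw
  have hx'0 : x' ≠ 0 := by
    rintro rfl
    rw [zero_mul] at hw'
    exact unif_smul_ne_zero (F := F) N (one_ne_zero (α := E)) hw'.symm
  have hx0 : x ≠ 0 := by
    rintro rfl
    rw [smul_zero] at hx'
    exact unif_smul_ne_zero (F := F) k hx'0 hx'.symm
  refine ⟨x, hx, hx0, fun y hy => ?_⟩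
  obtain ⟨y', hy'A, hy'⟩ := hall y hy
  have h1 : x⁻¹ * y = x'⁻¹ * y' := by
    have h2 : x' * y = y' * x := by
      apply unif_smul_injective (F := F) (m + k)
      simp only [Algebra.smul_def, map_mul, map_pow, pow_add] at hx' hy' ⊢
      linear_combination (algebraMap 𝒪[F] E (unif F) ^ k * x') * hy' -
        (algebraMap 𝒪[F] E (unif F) ^ k * y') * hx'
    field_simp
    linear_combination h2
  have h2 : unif F ^ N • (x'⁻¹ * y') = (w : E) * y' := by
    rw [← smul_mul_assoc, ← mul_one x'⁻¹, ← mul_smul_comm, ← hw', inv_mul_cancel_left₀ hx'0]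
  rw [h1, h2]
  exact A.mul_mem w.2 hy'A

end Fields

/-! ### Lattices and integral elements in a finite reduced algebra -/

section Reduced

variable {L : Type*} [CommRing L] [Algebra F L] [FiniteDimensional F L] [IsReduced L]
  [Algebra 𝒪[F] L] [IsScalarTower 𝒪[F] F L]

/-- Lattices in a commutative étale algebra which are stable under a fixed order are, up to
scaling by units of the algebra, between two fixed multiples of that order. -/
lemma exists_unit_forall_smul_mem (A : Subalgebra 𝒪[F] L) (hAfg : A.toSubmodule.FG)
    (hA : ∀ l : L, ∃ n : ℕ, unif F ^ n • l ∈ A) :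
    ∃ N : ℕ, ∀ Λ : Submodule 𝒪[F] L, Λ.FG → (∀ l : L, ∃ n : ℕ, unif F ^ n • l ∈ Λ) →
      (∀ a ∈ A, ∀ y ∈ Λ, a * y ∈ Λ) →
      ∃ x : Lˣ, unif F ^ N • (x : L) ∈ Λ ∧ ∀ y ∈ Λ, unif F ^ N • ((↑x⁻¹ : L) * y) ∈ A := by
  classical
  have : IsArtinianRing L := isArtinian_of_tower F inferInstance
  have := Fintype.ofFinite (MaximalSpectrum L)
  let E : MaximalSpectrum L → Type _ := fun I => L ⧸ I.asIdeal
  let _ : ∀ I, Field (E I) := fun I => Ideal.Quotient.field I.asIdeal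
  let p : ∀ I : MaximalSpectrum L, L →ₐ[𝒪[F]] L ⧸ I.asIdeal := fun I => Ideal.Quotient.mkₐ _ _
  have hp : ∀ I, Function.Surjective (p I) := fun I => Ideal.Quotient.mkₐ_surjective _ _
  let e := IsArtinianRing.equivPi L
  have he : ∀ l I, e l I = p I l := fun l I => IsArtinianRing.equivPi_apply L l I
  -- the factors
  have hfac : ∀ I, ∃ N : ℕ, ∀ Λ : Submodule 𝒪[F] (E I), Λ.FG → Λ ≠ ⊥ →
      ∃ x ∈ Λ, x ≠ 0 ∧ ∀ y ∈ Λ, unif F ^ N • (x⁻¹ * y) ∈ A.map (p I) := by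
    intro I
    have : Module.Finite 𝒪[F] (A.map (p I)) := by
      have h1 : (A.map (p I)).toSubmodule.FG := by
        rw [Subalgebra.map_toSubmodule]
        exact hAfg.map _
      exact Module.Finite.iff_fg.2 h1
    refine exists_forall_smul_inv_mul_mem (E := E I) (A.map (p I)) fun x => ?_
    obtain ⟨l, rfl⟩ := hp I x
    obtain ⟨n, hn⟩ := hA l
    exact ⟨n, ⟨_, hn, map_smul (p I) _ _⟩⟩
  choose N₁ hN₁ using hfac
  let ε : MaximalSpectrum L → L := fun I => e.symm (Pi.single I 1)
  have hε : ∀ I J, p J (ε I) = if J = I then 1 else 0 := by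
    intro I J
    rw [← he, AlgEquiv.apply_symm_apply]
    split_ifs with h
    · subst h
      exact Pi.single_eq_same _ _
    · exact Pi.single_eq_of_ne h _
  -- The order need not contain the idempotents of the factors; `n` clears their denominators
  -- simultaneously.
  choose n₁ hn₁ using fun I => hA (ε I)
  set n := Finset.univ.sup n₁ with hn
  have hεA : ∀ I, unif F ^ n • ε I ∈ A := by
    intro I
    obtain ⟨j, hj⟩ := Nat.exists_eq_add_of_le (Finset.le_sup (f := n₁) (Finset.mem_univ I))
    rw [hn, hj, add_comm, pow_add, mul_smul]
    exact A.smul_mem (hn₁ I) _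
  set N := Finset.univ.sup N₁ with hN
  have hext : ∀ l l' : L, (∀ I, p I l = p I l') → l = l' := fun l l' h =>
    e.injective (funext fun I => by rw [he, he, h])
  refine ⟨n + N, fun Λ hfg hfull hstab => ?_⟩
  have hx : ∀ I, ∃ l ∈ Λ, p I l ≠ 0 ∧ ∀ y ∈ Λ, ∃ a ∈ A,
      unif F ^ N • ((show E I from p I l)⁻¹ * p I y) = p I a := by
    intro I
    obtain ⟨x, hx, hx0, hxy⟩ := hN₁ I (Λ.map (p I).toLinearMap) (hfg.map _) (by
      obtain ⟨m, hm⟩ := hfull 1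
      intro hbot
      have h1 : p I (unif F ^ m • 1) ∈ Λ.map (p I).toLinearMap := ⟨_, hm, rfl⟩
      rw [hbot, Submodule.mem_bot, map_smul, map_one] at h1
      exact unif_smul_ne_zero (F := F) m (one_ne_zero (α := E I)) h1)
    obtain ⟨l, hl, rfl⟩ := hx
    refine ⟨l, hl, hx0, fun y hy => ?_⟩
    obtain ⟨a, ha, ha'⟩ := hxy _ ⟨y, hy, rfl⟩
    obtain ⟨j, hj⟩ := Nat.exists_eq_add_of_le (Finset.le_sup (f := N₁) (Finset.mem_univ I))
    refine ⟨unif F ^ j • a, A.smul_mem ha _, ?_⟩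
    rw [hN, hj, add_comm, pow_add, mul_smul, map_smul]
    exact congrArg (unif F ^ j • ·) ha'.symm
  choose l hl hl0 hly using hx
  -- The scaling elements of the factors are glued by the idempotents, so that `x` and `l J` agree
  -- in the factor `J`. Since `πⁿ ε I ∈ A` and `Λ` is stable under `A`, the multiple `πⁿx` lies in
  -- `Λ`.
  let x : L := ∑ I, ε I * l I
  have hpx : ∀ J, p J x = p J (l J) := by
    intro J
    simp only [x, map_sum, map_mul, hε, ite_mul, one_mul, zero_mul]
    simp
  let x' : L := e.symm fun I => (show E I from p I (l I))⁻¹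
  have hpx' : ∀ J, p J x' = (show E J from p J (l J))⁻¹ := by
    intro J
    rw [← he, AlgEquiv.apply_symm_apply]
  have hxx' : x * x' = 1 := hext _ _ fun I => by
    rw [map_mul, map_one, hpx, hpx']
    exact mul_inv_cancel₀ (hl0 I)
  refine ⟨⟨x, x', hxx', by rw [mul_comm, hxx']⟩, ?_, fun y hy => ?_⟩
  · rw [add_comm, pow_add, mul_smul]
    refine Λ.smul_mem _ ?_
    simp only [x, Finset.smul_sum]
    refine Λ.sum_mem fun I _ => ?_
    rw [← smul_mul_assoc]
    exact hstab _ (hεA I) _ (hl I)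
  · choose a haA ha using fun I => hly I y hy
    have h1 : unif F ^ (n + N) • (x' * y) = ∑ I, (unif F ^ n • ε I) * a I := by
      refine hext _ _ fun J => ?_
      simp only [map_sum, map_mul, map_smul, hε, smul_ite, smul_zero, ite_mul, zero_mul]
      rw [Finset.sum_ite_eq, if_pos (Finset.mem_univ _), hpx', smul_mul_assoc, one_mul, ← ha,
        pow_add, mul_smul]
    change unif F ^ (n + N) • (x' * y) ∈ A
    rw [h1]
    exact A.sum_mem fun I _ => A.mul_mem (hεA I) (haA I)

/-- The integral elements of a commutative étale algebra lie in a fixed multiple of a given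
order. -/
lemma exists_forall_isIntegral_smul_mem (A : Subalgebra 𝒪[F] L) (hAfg : A.toSubmodule.FG)
    (hA : ∀ l : L, ∃ n : ℕ, unif F ^ n • l ∈ A) :
    ∃ N : ℕ, ∀ z : L, IsIntegral 𝒪[F] z → unif F ^ N • z ∈ A := by
  obtain ⟨N, hN⟩ := exists_unit_forall_smul_mem A hAfg hA
  refine ⟨N + N, fun z hz => ?_⟩
  -- The module `Λ = A · 𝒪[z]` is finitely generated because `z` is integral, and it is stable under
  -- `A` and `z`. With `x` the scaling unit, `π^N x ∈ Λ` gives `π^N z x ∈ Λ`, and dividing by `x`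
  -- gives `π^{2N} z ∈ A`; this explains the exponent `N + N`.
  set Λ := A.toSubmodule * (Algebra.adjoin 𝒪[F] {z}).toSubmodule with hΛ
  have hle : A.toSubmodule ≤ Λ := fun a ha => by
    rw [← mul_one a]
    exact Submodule.mul_mem_mul ha (one_mem (Algebra.adjoin 𝒪[F] {z}))
  have hstab : ∀ a ∈ A, ∀ y ∈ Λ, a * y ∈ Λ := by
    intro a ha y hy
    have : A.toSubmodule * Λ ≤ Λ := by
      rw [hΛ, ← mul_assoc]
      exact mul_le_mul' ((Subalgebra.mul_toSubmodule_le A A).trans_eq (by rw [sup_idem])) le_rfl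
    exact this (Submodule.mul_mem_mul ha hy)
  have hzΛ : ∀ y ∈ Λ, z * y ∈ Λ := by
    intro y hy
    have : Λ * (Algebra.adjoin 𝒪[F] {z}).toSubmodule ≤ Λ := by
      rw [hΛ, mul_assoc]
      exact mul_le_mul' le_rfl ((Subalgebra.mul_toSubmodule_le _ _).trans_eq (by rw [sup_idem]))
    rw [mul_comm]
    exact this (Submodule.mul_mem_mul hy (Algebra.self_mem_adjoin_singleton _ _))
  obtain ⟨x, hx, hxy⟩ := hN Λ (hAfg.mul hz.fg_adjoin_singleton)
    (fun l => (hA l).imp fun n hn => hle hn) hstab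
  have h1 := hxy _ (hzΛ _ hx)
  rwa [mul_smul_comm, mul_smul_comm, mul_comm z, Units.inv_mul_cancel_left, smul_smul,
    ← pow_add] at h1

end Reduced

end

section

/-! ### Matrices with separable characteristic polynomial -/

section Cyclic

variable {k : Type*} [Field k] {n : Type*} [Fintype n] [DecidableEq n]

/-- The characteristic polynomial divides a power of each polynomial annihilating the matrix. -/
lemma charpoly_dvd_pow {N : Matrix n n k} {p : Polynomial k} (hp : Polynomial.aeval N p = 0) :
    N.charpoly ∣ p ^ Fintype.card n := by
  -- With `a = x · 1` and `b = N`, which commute, `a - b` divides `p(a) - p(b) = p(x) · 1`.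
  -- Determinants give the claim.
  set a : Matrix n n (Polynomial k) := algebraMap (Polynomial k) _ Polynomial.X with ha
  set b : Matrix n n (Polynomial k) := (Polynomial.CAlgHom (R := k) (A := k)).mapMatrix N with hb
  have hab : Commute a b := Algebra.commutes _ _
  have h1 : a - b ∣ Polynomial.aeval a p - Polynomial.aeval b p := by
    rw [Polynomial.aeval_eq_sum_range, Polynomial.aeval_eq_sum_range, ← Finset.sum_sub_distrib]
    refine Finset.dvd_sum fun i _ => ?_
    rw [← smul_sub]
    obtain ⟨c, hc⟩ := hab.sub_dvd_pow_sub_pow i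
    exact ⟨p.coeff i • c, by rw [hc, mul_smul_comm]⟩
  have h2 : Polynomial.aeval a p = algebraMap (Polynomial k) _ p := by
    rw [ha, Polynomial.aeval_algebraMap_apply, Polynomial.aeval_X_left_apply]
  have h3 : Polynomial.aeval b p = 0 := by
    rw [hb, Polynomial.aeval_algHom_apply, hp, map_zero]
  have h4 : a - b = N.charmatrix := by
    rw [Matrix.charmatrix]
    rfl
  rw [h2, h3, sub_zero, h4] at h1
  obtain ⟨c, hc⟩ := h1
  refine ⟨c.det, ?_⟩
  rw [Matrix.charpoly, ← Matrix.det_mul, ← hc, Algebra.algebraMap_eq_smul_one, Matrix.det_smul,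
    Matrix.det_one, mul_one]

/-- The algebra homomorphism `k[x] / (χ) → Mat_n(k)` given by a matrix with characteristic
polynomial `χ`. -/
def charHom (N : Matrix n n k) : AdjoinRoot N.charpoly →ₐ[k] Matrix n n k :=
  Ideal.Quotient.liftₐ _ (Polynomial.aeval N) (by
    intro p hp
    obtain ⟨q, rfl⟩ := Ideal.mem_span_singleton.1 hp
    rw [map_mul, Matrix.aeval_self_charpoly, zero_mul])

lemma charHom_mk (N : Matrix n n k) (p : Polynomial k) :
    charHom N (AdjoinRoot.mk _ p) = Polynomial.aeval N p := rfl

variable {N : Matrix n n k} (hN : N.charpoly.Separable)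
include hN

lemma aeval_eq_zero_iff_charpoly_dvd (p : Polynomial k) :
    Polynomial.aeval N p = 0 ↔ N.charpoly ∣ p := by
  constructor
  · intro hp
    rcases isEmpty_or_nonempty n with h | h
    · rw [Matrix.charpoly, Matrix.det_isEmpty]
      exact one_dvd _
    · exact (hN.squarefree.dvd_pow_iff_dvd Fintype.card_ne_zero).1 (charpoly_dvd_pow hp)
  · rintro ⟨q, rfl⟩
    rw [map_mul, Matrix.aeval_self_charpoly, zero_mul]

lemma charHom_injective : Function.Injective (charHom N) := by
  rw [injective_iff_map_eq_zero]
  intro l hl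
  obtain ⟨p, rfl⟩ := AdjoinRoot.mk_surjective l
  rw [charHom_mk, aeval_eq_zero_iff_charpoly_dvd hN] at hl
  exact AdjoinRoot.mk_eq_zero.2 hl

lemma isReduced_adjoinRoot_charpoly : IsReduced (AdjoinRoot N.charpoly) := by
  refine (Ideal.isRadical_iff_quotient_reduced _).1 ?_
  exact isRadical_iff_span_singleton.1 hN.squarefree.isRadical

/-- A matrix with separable characteristic polynomial has a cyclic vector. -/
lemma exists_cyclic_vector :
    ∃ v : n → k, Function.Bijective fun l : AdjoinRoot N.charpoly => charHom N l *ᵥ v := by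
  classical
  set L := AdjoinRoot N.charpoly with hL
  have := isReduced_adjoinRoot_charpoly hN
  have hfd : FiniteDimensional k L := (AdjoinRoot.powerBasis hN.ne_zero).finite
  have : IsArtinianRing L := isArtinian_of_tower k inferInstance
  have := Fintype.ofFinite (MaximalSpectrum L)
  let e := IsArtinianRing.equivPi L
  let ε : MaximalSpectrum L → L := fun I => e.symm (Pi.single I 1)
  have hε0 : ∀ I, ε I ≠ 0 := by
    intro I h0
    have h1 : (Pi.single I 1 : ∀ I : MaximalSpectrum L, L ⧸ I.asIdeal) = 0 :=
      e.symm.injective (h0.trans (map_zero _).symm)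
    have h2 := congrFun h1 I
    rw [Pi.single_eq_same] at h2
    exact one_ne_zero h2
  have hεε : ∀ I J, ε I * ε J = if I = J then ε I else 0 := by
    intro I J
    split_ifs with h
    · subst h
      rw [← map_mul, ← Pi.single_mul, one_mul]
    · rw [← map_mul]
      have : (Pi.single I 1 : ∀ I : MaximalSpectrum L, L ⧸ I.asIdeal) * Pi.single J 1 = 0 := by
        ext1 K
        rw [Pi.mul_apply]
        by_cases hK : K = I
        · subst hK
          rw [Pi.single_eq_of_ne h, mul_zero]; rfl
        · rw [Pi.single_eq_of_ne hK, zero_mul]; rfl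
      rw [this, map_zero]
  have hu : ∀ I, ∃ u, charHom N (ε I) *ᵥ u ≠ 0 := by
    intro I
    by_contra! hc
    apply hε0 I
    apply charHom_injective hN
    rw [map_zero]
    exact Matrix.mulVec_injective (funext fun u => by rw [hc u, Matrix.zero_mulVec])
  choose u hu using hu
  -- By construction no idempotent `ε I` kills `v`. A nonzero `l` has a nonzero component in some
  -- factor, so a multiple of it equals `ε I`; thus `l` does not kill `v` either. Equality of
  -- dimensions gives surjectivity.
  let v := ∑ I, charHom N (ε I) *ᵥ u I
  have hv : ∀ I, charHom N (ε I) *ᵥ v = charHom N (ε I) *ᵥ u I := by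
    intro I
    simp only [v, Matrix.mulVec_sum, Matrix.mulVec_mulVec, ← map_mul, hεε]
    rw [Finset.sum_eq_single I]
    · rw [if_pos rfl]
    · intro J _ hJ
      rw [if_neg hJ.symm, map_zero, Matrix.zero_mulVec]
    · exact fun h => absurd (Finset.mem_univ I) h
  let f : L →ₗ[k] (n → k) :=
    { toFun := fun l => charHom N l *ᵥ v
      map_add' := fun x y => by rw [map_add, Matrix.add_mulVec]
      map_smul' := fun c x => by rw [map_smul, Matrix.smul_mulVec]; rfl }
  have hinj : Function.Injective f := by
    rw [injective_iff_map_eq_zero]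
    intro l hl
    by_contra hl0
    obtain ⟨I, hI⟩ : ∃ I, e l I ≠ 0 := by
      by_contra! hc
      exact hl0 (e.injective ((funext hc).trans (map_zero e).symm))
    let _ : Field (L ⧸ I.asIdeal) := Ideal.Quotient.field I.asIdeal
    let l' : L := e.symm (Pi.single I (e l I)⁻¹)
    have h1 : l' * l = ε I := by
      apply e.injective
      rw [map_mul, AlgEquiv.apply_symm_apply, AlgEquiv.apply_symm_apply]
      ext1 K
      rw [Pi.mul_apply]
      by_cases hK : K = I
      · subst hK
        rw [Pi.single_eq_same, Pi.single_eq_same, inv_mul_cancel₀ hI]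
      · rw [Pi.single_eq_of_ne hK, Pi.single_eq_of_ne hK, zero_mul]
    apply hu I
    rw [← hv, ← h1, map_mul, ← Matrix.mulVec_mulVec]
    rw [show charHom N l *ᵥ v = 0 from hl, Matrix.mulVec_zero]
  have hdim : Module.finrank k L = Module.finrank k (n → k) := by
    rw [(AdjoinRoot.powerBasis hN.ne_zero).finrank, AdjoinRoot.powerBasis_dim,
      Matrix.charpoly_natDegree_eq_dim, Module.finrank_fintype_fun_eq_card]
  exact ⟨v, hinj, (LinearMap.injective_iff_surjective_of_finrank_eq_finrank hdim).1 hinj⟩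

/-- The commutant of a matrix with separable characteristic polynomial consists of polynomials in
the matrix. -/
lemma exists_charHom_eq_of_commute {X : Matrix n n k} (hX : Commute X N) :
    ∃ l, charHom N l = X := by
  obtain ⟨v, hv⟩ := exists_cyclic_vector hN
  -- Matrices commuting with all polynomials in `N` are determined by their value at the cyclic
  -- vector: `X(mv) = m(Xv) = m(lv) = l(mv)`.
  obtain ⟨l, hl⟩ := hv.2 (X *ᵥ v)
  refine ⟨l, Matrix.mulVec_injective (funext fun w => ?_)⟩
  obtain ⟨m, rfl⟩ := hv.2 w
  have hXm : Commute X (charHom N m) := by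
    obtain ⟨p, rfl⟩ := AdjoinRoot.mk_surjective m
    rw [charHom_mk]
    induction p using Polynomial.induction_on' with
    | add p q hp hq => rw [map_add]; exact hp.add_right hq
    | monomial i c =>
      rw [Polynomial.aeval_monomial]
      exact Commute.mul_right (Algebra.commutes c X).symm (hX.pow_right i)
  simp only at hl ⊢
  rw [Matrix.mulVec_mulVec, Matrix.mulVec_mulVec, hXm.eq, ← map_mul, mul_comm, map_mul,
    ← Matrix.mulVec_mulVec, hl, Matrix.mulVec_mulVec]

end Cyclic

end

section

/-! ### The two idempotents attached to the pair of embeddings -/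

variable {h : ℕ}

/-- The idempotent `τ₁(1, 0)`. -/
def idem1 (F : Type*) [Field F] (h : ℕ) : Matrix (Idx h) (Idx h) F :=
  Matrix.fromBlocks 1 0 0 0

/-- The idempotent `τ₂(1, 0)`. -/
def idem2 (g : GL (Idx h) 𝒪[F]) : Matrix (Idx h) (Idx h) F :=
  (glMap g).val * idem1 F h * (glMap g)⁻¹.val

lemma toF_mul (X Y : Matrix (Idx h) (Idx h) 𝒪[F]) : toF (X * Y) = toF X * toF Y := Matrix.map_mul

lemma toF_add (X Y : Matrix (Idx h) (Idx h) 𝒪[F]) : toF (X + Y) = toF X + toF Y :=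
  Matrix.map_add _ (map_add _) _ _

lemma toF_sub (X Y : Matrix (Idx h) (Idx h) 𝒪[F]) : toF (X - Y) = toF X - toF Y :=
  Matrix.map_sub _ (map_sub _) _ _

lemma toF_one : toF (1 : Matrix (Idx h) (Idx h) 𝒪[F]) = 1 := by simp [toF]

lemma toF_glMap_inv (g : GL (Idx h) 𝒪[F]) : (glMap g)⁻¹.val = toF g⁻¹.val := by
  rw [← map_inv]; rfl

lemma toF_tau1 (x : 𝒪[F] × 𝒪[F]) :
    toF (tau1 F h x) = (x.1 : F) • idem1 F h + (x.2 : F) • (1 - idem1 F h) := by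
  have : (1 : Matrix (Idx h) (Idx h) F) - idem1 F h = Matrix.fromBlocks 0 0 0 1 := by
    rw [idem1, ← Matrix.fromBlocks_one, sub_eq_iff_eq_add, Matrix.fromBlocks_add]
    simp
  rw [this, idem1, Matrix.fromBlocks_smul, Matrix.fromBlocks_smul, Matrix.fromBlocks_add]
  change (Matrix.fromBlocks (x.1 • 1) 0 0 (x.2 • 1)).map (algebraMap 𝒪[F] F) = _
  rw [Matrix.fromBlocks_map]
  have h1 : ∀ y : 𝒪[F], (y • (1 : Matrix (Fin h) (Fin h) 𝒪[F])).map (algebraMap 𝒪[F] F) =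
      (y : F) • 1 := by
    intro y
    ext i j
    rcases eq_or_ne i j with rfl | hij
    · simp; rfl
    · simp [hij]
  rw [h1, h1]
  simp

lemma toF_tau2 (g : GL (Idx h) 𝒪[F]) (x : 𝒪[F] × 𝒪[F]) :
    toF (tau2 g x) = (x.1 : F) • idem2 g + (x.2 : F) • (1 - idem2 g) := by
  have h1 : toF (tau2 g x) = (glMap g).val * toF (tau1 F h x) * (glMap g)⁻¹.val := by
    rw [toF_glMap_inv]
    change toF (g.val * tau1 F h x * g⁻¹.val) = toF g.val * _ * _
    rw [toF_mul, toF_mul]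
  rw [h1, toF_tau1, idem2]
  simp only [mul_add, add_mul, mul_sub, sub_mul, mul_smul_comm, smul_mul_assoc, mul_one,
    Units.mul_inv]

lemma idem1_mul_self : idem1 F h * idem1 F h = idem1 F h := by
  simp [idem1, Matrix.fromBlocks_multiply]

lemma idem2_mul_self (g : GL (Idx h) 𝒪[F]) : idem2 g * idem2 g = idem2 g := by
  simp only [idem2, mul_assoc, Units.inv_mul_cancel_left]
  rw [← mul_assoc (idem1 F h) (idem1 F h), idem1_mul_self]

lemma mem_centAlg_tau1_iff {X : Matrix (Idx h) (Idx h) F} :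
    X ∈ centAlg (tau1 F h) ↔ Commute X (idem1 F h) := by
  constructor
  · intro hX
    have := hX _ ⟨(1, 0), rfl⟩
    simp only [toF_tau1, OneMemClass.coe_one, one_smul, ZeroMemClass.coe_zero, zero_smul,
      add_zero] at this
    exact this.symm
  · rintro hX _ ⟨x, rfl⟩
    simp only [toF_tau1]
    exact ((hX.smul_right _).add_right (((Commute.one_right X).sub_right hX).smul_right _)).symm

lemma mem_centAlg_tau2_iff {g : GL (Idx h) 𝒪[F]} {X : Matrix (Idx h) (Idx h) F} :
    X ∈ centAlg (tau2 g) ↔ Commute X (idem2 g) := by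
  constructor
  · intro hX
    have := hX _ ⟨(1, 0), rfl⟩
    simp only [toF_tau2, OneMemClass.coe_one, one_smul, ZeroMemClass.coe_zero, zero_smul,
      add_zero] at this
    exact this.symm
  · rintro hX _ ⟨x, rfl⟩
    simp only [toF_tau2]
    exact ((hX.smul_right _).add_right (((Commute.one_right X).sub_right hX).smul_right _)).symm

lemma mem_algL_iff {g : GL (Idx h) 𝒪[F]} {X : Matrix (Idx h) (Idx h) F} :
    X ∈ algL g ↔ Commute X (idem1 F h) ∧ Commute X (idem2 g) := by
  rw [algL, Algebra.mem_inf, mem_centAlg_tau1_iff, mem_centAlg_tau2_iff]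

lemma mem_unitsL_iff {g : GL (Idx h) 𝒪[F]} {u : GL (Idx h) F} : u ∈ unitsL g ↔ u.val ∈ algL g := by
  refine ⟨fun hu => hu.1, fun hu => ⟨hu, ?_⟩⟩
  change u⁻¹.val ∈ algL g
  rw [mem_algL_iff] at hu ⊢
  exact ⟨hu.1.units_inv_left, hu.2.units_inv_left⟩

lemma mem_C1_iff_commute {u : GL (Idx h) F} : u ∈ C1 F h ↔ Commute u.val (idem1 F h) := by
  rw [← mem_centAlg_tau1_iff]
  refine ⟨fun hu => hu.1, fun hu => ⟨hu, ?_⟩⟩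
  change u⁻¹.val ∈ centAlg (tau1 F h)
  rw [mem_centAlg_tau1_iff] at hu ⊢
  exact hu.units_inv_left

variable {a b : 𝒪[F]}

/-- If `(a, b)` generates `𝒪 × 𝒪` then `a - b` is a unit. -/
lemma isUnit_sub_of_adjoin_eq_top
    (hζ : Algebra.adjoin 𝒪[F] {(a, b)} = (⊤ : Subalgebra 𝒪[F] (𝒪[F] × 𝒪[F]))) :
    IsUnit (a - b) := by
  have h1 : ((1, 0) : 𝒪[F] × 𝒪[F]) ∈ Algebra.adjoin 𝒪[F] {(a, b)} := by rw [hζ]; trivial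
  rw [Algebra.adjoin_singleton_eq_range_aeval] at h1
  obtain ⟨p, hp⟩ := h1
  have h2 : p.eval a = 1 := by
    have : AlgHom.fst 𝒪[F] 𝒪[F] 𝒪[F] (Polynomial.aeval (a, b) p) = _ :=
      congrArg (AlgHom.fst 𝒪[F] 𝒪[F] 𝒪[F]) hp
    rw [← Polynomial.aeval_algHom_apply] at this
    simpa using this
  have h3 : p.eval b = 0 := by
    have : AlgHom.snd 𝒪[F] 𝒪[F] 𝒪[F] (Polynomial.aeval (a, b) p) = _ :=
      congrArg (AlgHom.snd 𝒪[F] 𝒪[F] 𝒪[F]) hp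
    rw [← Polynomial.aeval_algHom_apply] at this
    simpa using this
  -- The polynomial `p` with `p(ζ) = (1, 0)` has `p(a) - p(b) = 1`, which `a - b` divides.
  have h4 := Polynomial.sub_dvd_eval_sub a b p
  rw [h2, h3, sub_zero] at h4
  exact isUnit_of_dvd_one h4

variable (g : GL (Idx h) 𝒪[F])

/-- The operator `(a - b)⁻¹ i`. -/
def opI0 : Matrix (Idx h) (Idx h) F := idem1 F h + idem2 g - 1

/-- The operator `(a - b)⁻¹ e`. -/
def opE0 : Matrix (Idx h) (Idx h) F := idem1 F h - idem2 g

/-- The operator `(a - b)⁻² δ`. -/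
def opD0 : Matrix (Idx h) (Idx h) F := idem2 g * idem1 F h - idem1 F h * idem2 g

/-- The operator `(a - b)⁻² i²`. -/
def opM0 : Matrix (Idx h) (Idx h) F := opI0 g * opI0 g

lemma toF_opI : toF (opI a b g) = ((a : F) - b) • opI0 g := by
  rw [opI, toF_sub, toF_tau1, toF_tau2, opI0]
  module

lemma toF_opE : toF (opE a b g) = ((a : F) - b) • opE0 g := by
  rw [opE, toF_sub, toF_tau1, toF_tau2, opE0]
  module

lemma opI0_mul_opE0 : opI0 g * opE0 g = opD0 g := by
  rw [opI0, opE0, opD0]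
  have h1 := idem1_mul_self (F := F) (h := h)
  have h2 := idem2_mul_self g
  simp only [mul_sub, sub_mul, add_mul, one_mul, h1, h2]
  abel

lemma toF_opDelta : toF (opDelta a b g) = ((a : F) - b) ^ 2 • opD0 g := by
  rw [opDelta, toF_mul, toF_opI, toF_opE, smul_mul_smul_comm, opI0_mul_opE0, sq]

/-- The operator `i` carries the eigenspaces of `τ₁` to those of `τ₂` with the same sign, and back;
`e` reverses the sign, and `δ` exchanges the two eigenspaces of `τ₁`. All comparisons of block
determinants below come from these relations. -/
lemma opI0_mul_idem1 : opI0 g * idem1 F h = idem2 g * opI0 g := by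
  rw [opI0]
  simp only [mul_sub, sub_mul, add_mul, mul_add, one_mul, mul_one, idem1_mul_self, idem2_mul_self]
  abel

lemma opI0_mul_idem2 : opI0 g * idem2 g = idem1 F h * opI0 g := by
  rw [opI0]
  simp only [mul_sub, sub_mul, add_mul, mul_add, one_mul, mul_one, idem1_mul_self, idem2_mul_self]
  abel

lemma opE0_mul_idem1 : opE0 g * idem1 F h = (1 - idem2 g) * opE0 g := by
  rw [opE0]
  simp only [mul_sub, sub_mul, one_mul, idem1_mul_self, idem2_mul_self]
  abel

lemma opD0_mul_idem1 : opD0 g * idem1 F h = (1 - idem1 F h) * opD0 g := by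
  rw [opD0]
  simp only [mul_sub, sub_mul, one_mul, ← mul_assoc, idem1_mul_self]
  simp only [mul_assoc, idem1_mul_self]
  abel

lemma idem1_mul_opD0 : idem1 F h * opD0 g = opD0 g * (1 - idem1 F h) := by
  rw [mul_sub, opD0_mul_idem1, sub_mul, mul_one, one_mul, sub_sub_cancel]

lemma opM0_mem_algL : opM0 g ∈ algL g := by
  rw [mem_algL_iff, opM0]
  constructor
  · rw [Commute, SemiconjBy, mul_assoc, opI0_mul_idem1, ← mul_assoc, opI0_mul_idem2, mul_assoc]
  · rw [Commute, SemiconjBy, mul_assoc, opI0_mul_idem2, ← mul_assoc, opI0_mul_idem1, mul_assoc]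

variable {g}

lemma commute_opI0_of_mem_algL {X : Matrix (Idx h) (Idx h) F} (hX : X ∈ algL g) :
    Commute X (opI0 g) := by
  rw [mem_algL_iff] at hX
  exact (hX.1.add_right hX.2).sub_right (Commute.one_right _)

lemma commute_opD0_of_mem_algL {X : Matrix (Idx h) (Idx h) F} (hX : X ∈ algL g) :
    Commute X (opD0 g) := by
  rw [mem_algL_iff] at hX
  exact (hX.2.mul_right hX.1).sub_right (hX.1.mul_right hX.2)

lemma isUnit_opD0 (hδ : IsUnit (toF (opDelta a b g))) : IsUnit (opD0 g) := by
  rw [toF_opDelta, Matrix.isUnit_iff_isUnit_det, Matrix.det_smul, IsUnit.mul_iff] at hδ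
  rw [Matrix.isUnit_iff_isUnit_det]
  exact hδ.2

lemma toBlocks₁₁_mul_of_commute {X Y : Matrix (Idx h) (Idx h) F} (hX : Commute X (idem1 F h)) :
    (X * Y).toBlocks₁₁ = X.toBlocks₁₁ * Y.toBlocks₁₁ := by
  have h12 : X.toBlocks₁₂ = 0 := by
    have := congrArg Matrix.toBlocks₁₂ hX.eq
    conv at this => rw [← Matrix.fromBlocks_toBlocks X, idem1, Matrix.fromBlocks_multiply,
      Matrix.fromBlocks_multiply]
    simpa using this.symm
  conv_lhs => rw [← Matrix.fromBlocks_toBlocks X, ← Matrix.fromBlocks_toBlocks Y,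
    Matrix.fromBlocks_multiply, Matrix.toBlocks_fromBlocks₁₁, h12, zero_mul, add_zero]

lemma toBlocks₂₂_mul_of_commute {X Y : Matrix (Idx h) (Idx h) F} (hX : Commute X (idem1 F h)) :
    (X * Y).toBlocks₂₂ = X.toBlocks₂₂ * Y.toBlocks₂₂ := by
  have h21 : X.toBlocks₂₁ = 0 := by
    have := congrArg Matrix.toBlocks₂₁ hX.eq
    conv at this => rw [← Matrix.fromBlocks_toBlocks X, idem1, Matrix.fromBlocks_multiply,
      Matrix.fromBlocks_multiply]
    simpa using this
  conv_lhs => rw [← Matrix.fromBlocks_toBlocks X, ← Matrix.fromBlocks_toBlocks Y,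
    Matrix.fromBlocks_multiply, Matrix.toBlocks_fromBlocks₂₂, h21, zero_mul, zero_add]

lemma eq_fromBlocks_of_commute {X : Matrix (Idx h) (Idx h) F} (hX : Commute X (idem1 F h)) :
    X = Matrix.fromBlocks X.toBlocks₁₁ 0 0 X.toBlocks₂₂ := by
  have h12 : X.toBlocks₁₂ = 0 := by
    have := congrArg Matrix.toBlocks₁₂ hX.eq
    conv at this => rw [← Matrix.fromBlocks_toBlocks X, idem1, Matrix.fromBlocks_multiply,
      Matrix.fromBlocks_multiply]
    simpa using this.symm
  have h21 : X.toBlocks₂₁ = 0 := by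
    have := congrArg Matrix.toBlocks₂₁ hX.eq
    conv at this => rw [← Matrix.fromBlocks_toBlocks X, idem1, Matrix.fromBlocks_multiply,
      Matrix.fromBlocks_multiply]
    simpa using this
  conv_lhs => rw [← Matrix.fromBlocks_toBlocks X, h12, h21]

/-- An element of `L` is determined by its restriction to `F^h ⊕ 0`. -/
lemma eq_zero_of_toBlocks₁₁_eq_zero (hD : IsUnit (opD0 g)) {X : Matrix (Idx h) (Idx h) F}
    (hX : X ∈ algL g) (h0 : X.toBlocks₁₁ = 0) : X = 0 := by
  have hX1 := (mem_algL_iff.1 hX).1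
  have h1 : X * idem1 F h = 0 := by
    rw [eq_fromBlocks_of_commute hX1, h0, idem1, Matrix.fromBlocks_multiply]
    simp
  -- Since `δ` commutes with `X` and exchanges the two summands, vanishing on the first summand
  -- passes to the second.
  have h2 : X * (1 - idem1 F h) * opD0 g = 0 := by
    rw [mul_assoc, ← opD0_mul_idem1, ← mul_assoc, (commute_opD0_of_mem_algL hX).eq, mul_assoc, h1,
      mul_zero]
  have h3 : X * (1 - idem1 F h) = 0 := by
    obtain ⟨d, hd⟩ := hD
    rw [← hd] at h2
    exact (Units.mul_left_eq_zero d).1 h2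
  rw [← mul_one X, ← sub_add_cancel 1 (idem1 F h), mul_add, h1, h3, add_zero]

lemma toBlocks₁₁_pow_opM0 (n : ℕ) : (opM0 g ^ n).toBlocks₁₁ = (opM0 g).toBlocks₁₁ ^ n := by
  induction n with
  | zero => simp [← Matrix.fromBlocks_one]
  | succ n ih =>
    rw [pow_succ', pow_succ', toBlocks₁₁_mul_of_commute (mem_algL_iff.1 (opM0_mem_algL g)).1, ih]

lemma toBlocks₁₁_aeval_opM0 (p : Polynomial F) :
    (Polynomial.aeval (opM0 g) p).toBlocks₁₁ = Polynomial.aeval (opM0 g).toBlocks₁₁ p := by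
  induction p using Polynomial.induction_on' with
  | add p q hp hq => rw [map_add, map_add, ← hp, ← hq]; rfl
  | monomial i c =>
    rw [Polynomial.aeval_monomial, Polynomial.aeval_monomial, ← Algebra.smul_def,
      ← Algebra.smul_def, ← toBlocks₁₁_pow_opM0]
    rfl

lemma aeval_opM0_mem_algL (p : Polynomial F) : Polynomial.aeval (opM0 g) p ∈ algL g :=
  Polynomial.aeval_mem_adjoin_singleton F (opM0 g) |>
    fun h => Algebra.adjoin_le (by simpa using opM0_mem_algL g) h

end

section

/-! ### Lattices in `F^{2h}` -/

variable {h : ℕ}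

lemma isLattice_iff {V : Type*} [AddCommGroup V] [Module F V] [Module 𝒪[F] V]
    [IsScalarTower 𝒪[F] F V] {Λ : Submodule 𝒪[F] V} :
    Submodule.IsLattice F Λ ↔ Λ.FG ∧ ∀ v, ∃ n : ℕ, unif F ^ n • v ∈ Λ := by
  constructor
  · intro hΛ
    refine ⟨hΛ.fg, fun v => ?_⟩
    have hv : v ∈ Submodule.span F (Λ : Set V) := by rw [hΛ.span_eq_top]; trivial
    induction hv using Submodule.span_induction with
    | mem x hx => exact ⟨0, by simpa using hx⟩
    | zero => exact ⟨0, by simp⟩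
    | add x y _ _ hx hy =>
      obtain ⟨n, hn⟩ := hx
      obtain ⟨m, hm⟩ := hy
      refine ⟨n + m, ?_⟩
      rw [smul_add]
      refine Λ.add_mem ?_ ?_
      · rw [add_comm, pow_add, mul_smul]; exact Λ.smul_mem _ hn
      · rw [pow_add, mul_smul]; exact Λ.smul_mem _ hm
    | smul c x _ hx =>
      obtain ⟨n, hn⟩ := hx
      rcases eq_or_ne c 0 with rfl | hc
      · exact ⟨0, by simp⟩
      obtain ⟨u, hu⟩ := exists_unit_mul_zpow hc
      refine ⟨(-ord c).toNat + n, ?_⟩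
      have h1 : (unif F : F) ^ ((-ord c).toNat) * c =
          ((u * unif F ^ (ord c).toNat : 𝒪[F]) : F) := by
        rw [show (unif F : F) ^ ((-ord c).toNat) * c = _ from
          congrArg ((unif F : F) ^ ((-ord c).toNat) * ·) hu]
        push_cast
        rw [mul_left_comm, ← zpow_natCast, ← zpow_natCast, ← zpow_add₀ coe_unif_ne_zero]
        congr 2
        omega
      have h2 : unif F ^ ((-ord c).toNat + n) • c • x =
          (u * unif F ^ (ord c).toNat : 𝒪[F]) • unif F ^ n • x := by
        rw [pow_add, mul_smul, ← smul_comm c (unif F ^ n) x,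
          ← algebraMap_smul F (unif F ^ (-ord c).toNat), smul_smul,
          ← algebraMap_smul F ((u : 𝒪[F]) * unif F ^ (ord c).toNat)]
        congr 1
      rw [h2]
      exact Λ.smul_mem _ hn
  · rintro ⟨h1, h2⟩
    refine ⟨h1, eq_top_iff.2 fun v _ => ?_⟩
    obtain ⟨n, hn⟩ := h2 v
    have h3 : v = ((unif F : F) ^ n)⁻¹ • (unif F ^ n • v) := by
      rw [← algebraMap_smul F (unif F ^ n) v, map_pow, smul_smul]
      have h4 : (algebraMap 𝒪[F] F (unif F)) ^ n ≠ 0 := pow_ne_zero _ coe_unif_ne_zero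
      exact ((congrArg (· • v) (inv_mul_cancel₀ h4)).trans (one_smul _ _)).symm
    rw [h3]
    exact Submodule.smul_mem _ _ (Submodule.subset_span hn)

lemma mem_latMap {M : Matrix (Idx h) (Idx h) F} {Λ : Submodule 𝒪[F] (Idx h → F)} {w : Idx h → F} :
    w ∈ latMap M Λ ↔ ∃ v ∈ Λ, M *ᵥ v = w := Iff.rfl

lemma mem_latMap_units {u : GL (Idx h) F} {Λ : Submodule 𝒪[F] (Idx h → F)} {w : Idx h → F} :
    w ∈ latMap u.val Λ ↔ u⁻¹.val *ᵥ w ∈ Λ := by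
  rw [mem_latMap]
  constructor
  · rintro ⟨v, hv, rfl⟩
    rwa [Matrix.mulVec_mulVec, Units.inv_mul, Matrix.one_mulVec]
  · intro hw
    exact ⟨_, hw, by rw [Matrix.mulVec_mulVec, Units.mul_inv, Matrix.one_mulVec]⟩

lemma mulVec_smul_unif (M : Matrix (Idx h) (Idx h) F) (c : 𝒪[F]) (v : Idx h → F) :
    M *ᵥ (c • v) = c • (M *ᵥ v) :=
  ((Matrix.mulVecLin M).restrictScalars 𝒪[F]).map_smul c v

lemma isLattice_latMap (u : GL (Idx h) F) {Λ : Submodule 𝒪[F] (Idx h → F)}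
    (hΛ : Submodule.IsLattice F Λ) : Submodule.IsLattice F (latMap u.val Λ) := by
  rw [isLattice_iff] at hΛ ⊢
  refine ⟨hΛ.1.map _, fun v => ?_⟩
  obtain ⟨n, hn⟩ := hΛ.2 (u⁻¹.val *ᵥ v)
  refine ⟨n, ?_⟩
  rwa [mem_latMap_units, mulVec_smul_unif]

/-- Stability under both idempotents. -/
def IsStable (g : GL (Idx h) 𝒪[F]) (Λ : Submodule 𝒪[F] (Idx h → F)) : Prop :=
  (∀ v ∈ Λ, idem1 F h *ᵥ v ∈ Λ) ∧ ∀ v ∈ Λ, idem2 g *ᵥ v ∈ Λ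

variable {a b : 𝒪[F]} {g : GL (Idx h) 𝒪[F]}

/-- As `a` and `b` are units, `aE + b(1 - E)` has the inverse `a⁻¹E + b⁻¹(1 - E)`, of the same
shape. As `a - b` is a unit, `E` is recovered from it as an integral linear combination with `1`. -/
lemma mulVec_mem_iff_latMap_eq (ha : IsUnit a) (hb : IsUnit b) (hab : IsUnit (a - b))
    {E : Matrix (Idx h) (Idx h) F} (hE : E * E = E) {Λ : Submodule 𝒪[F] (Idx h → F)} :
    (∀ v ∈ Λ, E *ᵥ v ∈ Λ) ↔ latMap ((a : F) • E + (b : F) • (1 - E)) Λ = Λ := by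
  have hact : ∀ (x y : 𝒪[F]) (v : Idx h → F), ((x : F) • E + (y : F) • (1 - E)) *ᵥ v =
      x • (E *ᵥ v) + y • (v - E *ᵥ v) := by
    intro x y v
    rw [Matrix.add_mulVec, Matrix.smul_mulVec, Matrix.smul_mulVec, Matrix.sub_mulVec,
      Matrix.one_mulVec]
    rfl
  constructor
  · intro hΛ
    have key : ∀ (x y : 𝒪[F]), ∀ v ∈ Λ, ((x : F) • E + (y : F) • (1 - E)) *ᵥ v ∈ Λ := by
      intro x y v hv
      rw [hact]
      exact Λ.add_mem (Λ.smul_mem _ (hΛ v hv)) (Λ.smul_mem _ (Λ.sub_mem hv (hΛ v hv)))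
    apply le_antisymm
    · rintro _ ⟨v, hv, rfl⟩
      exact key a b v hv
    · intro v hv
      obtain ⟨a', ha'⟩ := isUnit_iff_exists_inv.1 ha
      obtain ⟨b', hb'⟩ := isUnit_iff_exists_inv.1 hb
      refine ⟨_, key a' b' v hv, ?_⟩
      change ((a : F) • E + (b : F) • (1 - E)) *ᵥ _ = v
      rw [Matrix.mulVec_mulVec]
      have ha'' : (a : F) * a' = 1 := congrArg Subtype.val ha'
      have hb'' : (b : F) * b' = 1 := congrArg Subtype.val hb'
      have : ((a : F) • E + (b : F) • (1 - E)) * ((a' : F) • E + (b' : F) • (1 - E)) = 1 := by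
        simp only [mul_add, add_mul, smul_mul_smul_comm, mul_sub, sub_mul, hE, ha'', hb'', one_mul,
          mul_one, sub_self, smul_zero, one_smul]
        abel
      rw [this, Matrix.one_mulVec]
  · intro hΛ v hv
    have h1 : ((a : F) • E + (b : F) • (1 - E)) *ᵥ v ∈ Λ := by
      rw [← hΛ]; exact ⟨v, hv, rfl⟩
    rw [hact] at h1
    obtain ⟨c, hc⟩ := isUnit_iff_exists_inv.1 hab
    have h2 : E *ᵥ v = c • ((a • (E *ᵥ v) + b • (v - E *ᵥ v)) - b • v) := by
      have : (a • (E *ᵥ v) + b • (v - E *ᵥ v)) - b • v = (a - b) • (E *ᵥ v) := by module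
      rw [this, smul_smul, mul_comm, hc, one_smul]
    rw [h2]
    exact Λ.smul_mem _ (Λ.sub_mem h1 (Λ.smul_mem _ hv))

lemma isStable_iff (ha : IsUnit a) (hb : IsUnit b) (hab : IsUnit (a - b))
    {Λ : Submodule 𝒪[F] (Idx h → F)} :
    IsStable g Λ ↔ latMap (toF (tau1 F h (a, b))) Λ = Λ ∧ latMap (toF (tau2 g (a, b))) Λ = Λ := by
  rw [IsStable, mulVec_mem_iff_latMap_eq ha hb hab idem1_mul_self,
    mulVec_mem_iff_latMap_eq ha hb hab (idem2_mul_self g), toF_tau1, toF_tau2]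

lemma mulVec_mem_latMap_of_commute {u X : Matrix (Idx h) (Idx h) F} (hX : Commute u X)
    {Λ : Submodule 𝒪[F] (Idx h → F)} (hΛ : ∀ v ∈ Λ, X *ᵥ v ∈ Λ) :
    ∀ v ∈ latMap u Λ, X *ᵥ v ∈ latMap u Λ := by
  rintro _ ⟨v, hv, rfl⟩
  refine ⟨_, hΛ v hv, ?_⟩
  change u *ᵥ (X *ᵥ v) = X *ᵥ (u *ᵥ v)
  rw [Matrix.mulVec_mulVec, Matrix.mulVec_mulVec, hX.eq]

lemma IsStable.latMap_of_mem {u : Matrix (Idx h) (Idx h) F} (hu : u ∈ algL g)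
    {Λ : Submodule 𝒪[F] (Idx h → F)} (hΛ : IsStable g Λ) : IsStable g (latMap u Λ) := by
  rw [mem_algL_iff] at hu
  exact ⟨mulVec_mem_latMap_of_commute hu.1 hΛ.1, mulVec_mem_latMap_of_commute hu.2 hΛ.2⟩

lemma IsStable.opI0_mem {Λ : Submodule 𝒪[F] (Idx h → F)} (hΛ : IsStable g Λ) :
    ∀ v ∈ Λ, opI0 g *ᵥ v ∈ Λ := by
  intro v hv
  rw [opI0, Matrix.sub_mulVec, Matrix.add_mulVec, Matrix.one_mulVec]
  exact Λ.sub_mem (Λ.add_mem (hΛ.1 v hv) (hΛ.2 v hv)) hv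

lemma IsStable.opE0_mem {Λ : Submodule 𝒪[F] (Idx h → F)} (hΛ : IsStable g Λ) :
    ∀ v ∈ Λ, opE0 g *ᵥ v ∈ Λ := by
  intro v hv
  rw [opE0, Matrix.sub_mulVec]
  exact Λ.sub_mem (hΛ.1 v hv) (hΛ.2 v hv)

lemma IsStable.opD0_mem {Λ : Submodule 𝒪[F] (Idx h → F)} (hΛ : IsStable g Λ) :
    ∀ v ∈ Λ, opD0 g *ᵥ v ∈ Λ := by
  intro v hv
  rw [← opI0_mul_opE0, ← Matrix.mulVec_mulVec]
  exact hΛ.opI0_mem _ (hΛ.opE0_mem v hv)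

lemma IsStable.opM0_mem {Λ : Submodule 𝒪[F] (Idx h → F)} (hΛ : IsStable g Λ) :
    ∀ v ∈ Λ, opM0 g *ᵥ v ∈ Λ := by
  intro v hv
  rw [opM0, ← Matrix.mulVec_mulVec]
  exact hΛ.opI0_mem _ (hΛ.opI0_mem v hv)

/-! ### The algebra `L` -/

lemma invPoly_eq (hab : IsUnit (a - b)) : invPoly a b g = (opM0 g).toBlocks₁₁.charpoly := by
  have h0 : ((a : F) - b) ^ 2 ≠ 0 := by
    refine pow_ne_zero _ fun hc => hab.ne_zero (Subtype.ext hc)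
  rw [invPoly, toF_mul, toF_opI, smul_mul_smul_comm, smul_smul, ← sq, inv_mul_cancel₀ h0, one_smul,
    opM0]

variable (g) in
/-- `F[x] / (χ)` for the invariant polynomial `χ`. -/
abbrev LAlg : Type _ := AdjoinRoot (opM0 g).toBlocks₁₁.charpoly

/-- Cayley–Hamilton kills the block on `F^h ⊕ 0`, and elements of `L` are determined by that block.
-/
lemma aeval_opM0_charpoly (hD : IsUnit (opD0 g)) :
    Polynomial.aeval (opM0 g) (opM0 g).toBlocks₁₁.charpoly = 0 := by
  refine eq_zero_of_toBlocks₁₁_eq_zero hD (aeval_opM0_mem_algL _) ?_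
  rw [toBlocks₁₁_aeval_opM0, Matrix.aeval_self_charpoly]

/-- The identification of `F[x] / (χ)` with `L`. -/
def lHom (hD : IsUnit (opD0 g)) : LAlg g →ₐ[F] Matrix (Idx h) (Idx h) F :=
  Ideal.Quotient.liftₐ _ (Polynomial.aeval (opM0 g)) (by
    intro p hp
    obtain ⟨q, rfl⟩ := Ideal.mem_span_singleton.1 hp
    rw [map_mul, aeval_opM0_charpoly hD, zero_mul])

variable (hD : IsUnit (opD0 g))

lemma lHom_mk (p : Polynomial F) : lHom hD (AdjoinRoot.mk _ p) = Polynomial.aeval (opM0 g) p := rfl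

lemma lHom_root : lHom hD (AdjoinRoot.root _) = opM0 g := by
  rw [AdjoinRoot.root, lHom_mk, Polynomial.aeval_X]

lemma lHom_mem (l : LAlg g) : lHom hD l ∈ algL g := by
  obtain ⟨p, rfl⟩ := AdjoinRoot.mk_surjective l
  rw [lHom_mk]
  exact aeval_opM0_mem_algL p

lemma toBlocks₁₁_lHom (l : LAlg g) : (lHom hD l).toBlocks₁₁ = charHom (opM0 g).toBlocks₁₁ l := by
  obtain ⟨p, rfl⟩ := AdjoinRoot.mk_surjective l
  rw [lHom_mk, charHom_mk, toBlocks₁₁_aeval_opM0]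

lemma lHom_smul_int (c : 𝒪[F]) (l : LAlg g) : lHom hD (c • l) = c • lHom hD l :=
  map_smul ((lHom hD).restrictScalars 𝒪[F]) c l

lemma smul_mulVec_int (c : 𝒪[F]) (M : Matrix (Idx h) (Idx h) F) (v : Idx h → F) :
    (c • M) *ᵥ v = c • (M *ᵥ v) := by
  rw [← algebraMap_smul F c M, ← algebraMap_smul F c (M *ᵥ v), Matrix.smul_mulVec]

variable (hN : (opM0 g).toBlocks₁₁.charpoly.Separable)
include hN

lemma lHom_injective : Function.Injective (lHom hD) := by
  intro l m hlm
  apply charHom_injective hN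
  rw [← toBlocks₁₁_lHom hD, ← toBlocks₁₁_lHom hD, hlm]

/-- The block of `X` on `F^h ⊕ 0` commutes with that of `i²`, so by separability it is a polynomial
in it; the same polynomial in `i²` then equals `X`. This makes `L` commutative and reduced. -/
lemma exists_lHom_eq {X : Matrix (Idx h) (Idx h) F} (hX : X ∈ algL g) : ∃ l, lHom hD l = X := by
  have h1 : Commute X.toBlocks₁₁ (opM0 g).toBlocks₁₁ := by
    rw [Commute, SemiconjBy, ← toBlocks₁₁_mul_of_commute (mem_algL_iff.1 hX).1,
      ← toBlocks₁₁_mul_of_commute (mem_algL_iff.1 (opM0_mem_algL g)).1, opM0, ← mul_assoc,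
      (commute_opI0_of_mem_algL hX).eq, mul_assoc, (commute_opI0_of_mem_algL hX).eq, ← mul_assoc]
  obtain ⟨l, hl⟩ := exists_charHom_eq_of_commute hN h1
  refine ⟨l, ?_⟩
  rw [← sub_eq_zero]
  refine eq_zero_of_toBlocks₁₁_eq_zero hD (sub_mem (lHom_mem hD l) hX) ?_
  have : (lHom hD l - X).toBlocks₁₁ = (lHom hD l).toBlocks₁₁ - X.toBlocks₁₁ := rfl
  rw [this, toBlocks₁₁_lHom, hl, sub_self]

include hD in
lemma algL_mul_comm {X Y : Matrix (Idx h) (Idx h) F} (hX : X ∈ algL g) (hY : Y ∈ algL g) :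
    X * Y = Y * X := by
  obtain ⟨l, rfl⟩ := exists_lHom_eq hD hN hX
  obtain ⟨m, rfl⟩ := exists_lHom_eq hD hN hY
  rw [← map_mul, mul_comm, map_mul]

end

section

/-! ### Finiteness of the set of classes of stable lattices -/

variable {h : ℕ} {g : GL (Idx h) 𝒪[F]}

lemma exists_pow_mul_eq (c : F) : ∃ (n : ℕ) (d : 𝒪[F]), (unif F : F) ^ n * c = d := by
  rcases eq_or_ne c 0 with rfl | hc
  · exact ⟨0, 0, by simp⟩
  have h1 : (unif F : F) ^ (-ord c).toNat * c ≠ 0 :=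
    mul_ne_zero (pow_ne_zero _ coe_unif_ne_zero) hc
  refine ⟨(-ord c).toNat, ⟨_, (ord_nonneg_iff h1).1 ?_⟩, rfl⟩
  rw [ord_mul (pow_ne_zero _ coe_unif_ne_zero) hc, ord_pow coe_unif_ne_zero, ord_unif]
  omega

variable (g) in
/-- The order `𝒪[x] / (χ)` in `L`. -/
def LOrd : Subalgebra 𝒪[F] (LAlg g) := Algebra.adjoin 𝒪[F] {AdjoinRoot.root _}

lemma exists_toF_eq_opM0 : ∃ M, toF M = opM0 g := by
  have h1 : toF (Matrix.fromBlocks 1 0 0 0 : Matrix (Idx h) (Idx h) 𝒪[F]) = idem1 F h := by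
    rw [toF, Matrix.fromBlocks_map, idem1]
    simp
  refine ⟨(Matrix.fromBlocks 1 0 0 0 + g.val * Matrix.fromBlocks 1 0 0 0 * g⁻¹.val - 1) *
    (Matrix.fromBlocks 1 0 0 0 + g.val * Matrix.fromBlocks 1 0 0 0 * g⁻¹.val - 1), ?_⟩
  rw [toF_mul, toF_sub, toF_add, toF_mul, toF_mul, h1, toF_one, ← toF_glMap_inv]
  rfl

/-- The matrix `(a - b)⁻² i²` has integral entries, so `χ` is a monic polynomial over `𝒪`. -/
lemma isIntegral_root : IsIntegral 𝒪[F] (AdjoinRoot.root (opM0 g).toBlocks₁₁.charpoly) := by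
  obtain ⟨M, hM⟩ := exists_toF_eq_opM0 (g := g)
  have h1 : (opM0 g).toBlocks₁₁.charpoly = M.toBlocks₁₁.charpoly.map (algebraMap 𝒪[F] F) := by
    rw [← Matrix.charpoly_map, ← hM]
    rfl
  refine ⟨M.toBlocks₁₁.charpoly, Matrix.charpoly_monic _, ?_⟩
  rw [← Polynomial.aeval_def, ← Polynomial.aeval_map_algebraMap F, ← h1, AdjoinRoot.aeval_eq,
    AdjoinRoot.mk_self]

lemma fg_LOrd : (LOrd g).toSubmodule.FG := isIntegral_root.fg_adjoin_singleton

lemma exists_smul_mem_LOrd (l : LAlg g) : ∃ n : ℕ, unif F ^ n • l ∈ LOrd g := by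
  obtain ⟨p, rfl⟩ := AdjoinRoot.mk_surjective l
  induction p using Polynomial.induction_on' with
  | add p q hp hq =>
    obtain ⟨n, hn⟩ := hp
    obtain ⟨m, hm⟩ := hq
    refine ⟨n + m, ?_⟩
    rw [map_add, smul_add]
    refine (LOrd g).add_mem ?_ ?_
    · rw [add_comm, pow_add, mul_smul]; exact (LOrd g).smul_mem hn _
    · rw [pow_add, mul_smul]; exact (LOrd g).smul_mem hm _
  | monomial i c =>
    obtain ⟨n, d, hd⟩ := exists_pow_mul_eq c
    refine ⟨n, ?_⟩
    have h1 : AdjoinRoot.mk (opM0 g).toBlocks₁₁.charpoly (Polynomial.monomial i c) =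
        c • AdjoinRoot.root _ ^ i := by
      rw [← Polynomial.C_mul_X_pow_eq_monomial, map_mul, map_pow, AdjoinRoot.mk_C, AdjoinRoot.mk_X,
        Algebra.smul_def]
      rfl
    rw [h1, ← algebraMap_smul F (unif F ^ n), smul_smul, map_pow]
    change ((unif F : F) ^ n * c) • _ ∈ _
    rw [hd]
    change (algebraMap 𝒪[F] F d) • _ ∈ _
    rw [algebraMap_smul]
    exact (LOrd g).smul_mem (pow_mem (Algebra.self_mem_adjoin_singleton _ _) _) _

lemma finiteDimensional_LAlg : FiniteDimensional F (LAlg g) :=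
  (AdjoinRoot.powerBasis (Matrix.charpoly_monic _).ne_zero).finite

variable (hD : IsUnit (opD0 g))

lemma IsStable.lHom_mulVec_mem {Λ : Submodule 𝒪[F] (Idx h → F)} (hΛ : IsStable g Λ) {y : LAlg g}
    (hy : y ∈ LOrd g) : ∀ v ∈ Λ, lHom hD y *ᵥ v ∈ Λ := by
  induction hy using Algebra.adjoin_induction with
  | mem x hx =>
    rw [Set.mem_singleton_iff.1 hx, lHom_root]
    exact hΛ.opM0_mem
  | algebraMap r =>
    intro v hv
    rw [Algebra.algebraMap_eq_smul_one, lHom_smul_int, map_one, smul_mulVec_int, Matrix.one_mulVec]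
    exact Λ.smul_mem _ hv
  | add x y _ _ hx hy =>
    intro v hv
    rw [map_add, Matrix.add_mulVec]
    exact Λ.add_mem (hx v hv) (hy v hv)
  | mul x y _ _ hx hy =>
    intro v hv
    rw [map_mul, ← Matrix.mulVec_mulVec]
    exact hx _ (hy v hv)

variable (hN : (opM0 g).toBlocks₁₁.charpoly.Separable)
include hD hN

/-- Up to the action of `Lˣ` there are finitely many stable lattices. -/
lemma exists_finite_representatives :
    ∃ S : Set (Submodule 𝒪[F] (Idx h → F)), S.Finite ∧
      ∀ Λ : Submodule 𝒪[F] (Idx h → F), Submodule.IsLattice F Λ → IsStable g Λ →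
        ∃ l ∈ unitsL g, latMap l.val Λ ∈ S := by
  have := isReduced_adjoinRoot_charpoly hN
  have := finiteDimensional_LAlg (g := g)
  obtain ⟨N, hNB⟩ := exists_unit_forall_smul_mem (LOrd g) fg_LOrd exists_smul_mem_LOrd
  obtain ⟨v, hv⟩ := exists_cyclic_vector hN
  set v₀ : Idx h → F := Sum.elim v 0 with hv₀
  -- The cyclic vector identifies `L` with `F^h ⊕ 0`, so `Λ₊` becomes a module over the order `𝒪[x]
  -- / (χ)`.
  let k : LAlg g →ₗ[𝒪[F]] (Idx h → F) :=
    { toFun := fun l => lHom hD l *ᵥ v₀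
      map_add' := fun x y => by rw [map_add, Matrix.add_mulVec]
      map_smul' := fun c x => by rw [lHom_smul_int, smul_mulVec_int]; rfl }
  have hkdef : ∀ l, k l = lHom hD l *ᵥ v₀ := fun l => rfl
  have hk : ∀ l, k l = Sum.elim (charHom (opM0 g).toBlocks₁₁ l *ᵥ v) 0 := by
    intro l
    rw [hkdef, eq_fromBlocks_of_commute (mem_algL_iff.1 (lHom_mem hD l)).1, hv₀,
      Matrix.fromBlocks_mulVec, toBlocks₁₁_lHom]
    simp
  have hkinj : Function.Injective k := by
    intro l m hlm
    rw [hk, hk] at hlm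
    exact hv.1 (funext fun i => congrFun hlm (Sum.inl i))
  have hkmul : ∀ l m, k (l * m) = lHom hD l *ᵥ k m := by
    intro l m
    rw [hkdef, hkdef, map_mul, Matrix.mulVec_mulVec]
  have hE : ∀ w : Idx h → F, idem1 F h *ᵥ w = Sum.elim (fun i => w (Sum.inl i)) 0 := by
    intro w
    rw [idem1, Matrix.fromBlocks_mulVec]
    simp
    rfl
  have hkE : ∀ w, ∃ l, k l = idem1 F h *ᵥ w := by
    intro w
    obtain ⟨l, hl⟩ := hv.2 (fun i => w (Sum.inl i))
    exact ⟨l, by rw [hk, hE]; exact congrArg (fun f : Fin h → F => Sum.elim f (0 : Fin h → F)) hl⟩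
  have hEk : ∀ l, idem1 F h *ᵥ k l = k l := by
    intro l
    rw [hE, hk]
    rfl
  -- the two bounding modules
  let T := (LOrd g).toSubmodule.map k
  -- The second component controls the part of `w` in `0 ⊕ F^h`: up to a scalar, `δ` maps it into
  -- `F^h ⊕ 0`, where `T` lives. Both bounds on a stable lattice then follow from one on its plus
  -- part.
  let f : (Idx h → F) →ₗ[𝒪[F]] (Idx h → F) × (Idx h → F) :=
    (unif F ^ N • ((Matrix.mulVecLin (idem1 F h)).restrictScalars 𝒪[F])).prod
      (unif F ^ N • ((Matrix.mulVecLin (idem1 F h * opD0 g)).restrictScalars 𝒪[F]))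
  have hf : ∀ w, f w = (unif F ^ N • (idem1 F h *ᵥ w), unif F ^ N • (idem1 F h *ᵥ (opD0 g *ᵥ w))) :=
    fun w => by rw [Matrix.mulVec_mulVec]; rfl
  have hDinj : Function.Injective (opD0 g).mulVec :=
    Matrix.mulVec_injective_iff_isUnit.2 hD
  have hfinj : Function.Injective f := by
    rw [injective_iff_map_eq_zero]
    intro w hw
    rw [hf, Prod.mk_eq_zero] at hw
    have h1 : idem1 F h *ᵥ w = 0 := by
      by_contra hc
      exact unif_smul_ne_zero (F := F) N hc hw.1
    have h2 : idem1 F h *ᵥ (opD0 g *ᵥ w) = 0 := by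
      by_contra hc
      exact unif_smul_ne_zero (F := F) N hc hw.2
    rw [Matrix.mulVec_mulVec, idem1_mul_opD0, ← Matrix.mulVec_mulVec, Matrix.sub_mulVec, h1,
      Matrix.one_mulVec, sub_zero] at h2
    exact hDinj (by simpa using h2)
  let X := (T.prod T).comap f
  have hXfg : X.FG := by
    have hT : (T.prod T).FG := (fg_LOrd.map k).prod (fg_LOrd.map k)
    exact Submodule.fg_of_fg_map_injective f hfinj (hT.of_le (Submodule.map_comap_le _ _))
  let D : (Idx h → F) →ₗ[𝒪[F]] (Idx h → F) := (Matrix.mulVecLin (opD0 g)).restrictScalars 𝒪[F]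
  have hTfull : ∀ w, ∃ n : ℕ, unif F ^ n • (idem1 F h *ᵥ w) ∈ T := by
    intro w
    obtain ⟨l, hl⟩ := hkE w
    obtain ⟨n, hn⟩ := exists_smul_mem_LOrd l
    exact ⟨n, _, hn, by rw [map_smul, hl]⟩
  -- Up to a scalar, every vector is `δw' = E(δw') + δ(Ew')` with `E` the first idempotent, so some
  -- multiple lies in `T + δT`.
  obtain ⟨n, hn⟩ := exists_pow_smul_mem_of_fg (Y := T ⊔ T.map D) hXfg fun w => by
    obtain ⟨w', rfl⟩ := (Matrix.mulVec_surjective_iff_isUnit.2 hD) w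
    obtain ⟨n, hn⟩ := hTfull (opD0 g *ᵥ w')
    obtain ⟨m, hm⟩ := hTfull w'
    refine ⟨n + m, ?_⟩
    have h1 : opD0 g *ᵥ w' = idem1 F h *ᵥ (opD0 g *ᵥ w') + D (idem1 F h *ᵥ w') := by
      change _ = _ + opD0 g *ᵥ (idem1 F h *ᵥ w')
      rw [Matrix.mulVec_mulVec, Matrix.mulVec_mulVec, ← Matrix.add_mulVec, opD0_mul_idem1,
        ← add_mul, add_sub_cancel, one_mul]
    rw [h1, smul_add]
    refine Submodule.add_mem_sup ?_ ?_
    · rw [add_comm, pow_add, mul_smul]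
      exact T.smul_mem _ hn
    · rw [pow_add, mul_smul, ← map_smul D]
      exact Submodule.smul_mem _ _ ⟨_, hm, rfl⟩
  -- After scaling, the lattice lies in `X` and contains `π^N (T + δT)`, hence `π^{N+n} X`.
  refine ⟨_, finite_submodules_between hXfg (N + n), fun Λ hΛlat hΛ => ?_⟩
  rw [isLattice_iff] at hΛlat
  obtain ⟨x, hx1, hx2⟩ := hNB (Λ.comap k)
    (Submodule.fg_of_fg_map_injective k hkinj (hΛlat.1.of_le (Submodule.map_comap_le _ _)))
    (fun l => by
      obtain ⟨n, hn⟩ := hΛlat.2 (k l)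
      exact ⟨n, by rwa [Submodule.mem_comap, map_smul]⟩)
    (fun a ha y hy => by
      rw [Submodule.mem_comap, hkmul]
      exact hΛ.lHom_mulVec_mem hD ha _ hy)
  -- Division by `x` moves the element `π^N x` of the plus part to `π^N` times the cyclic vector.
  let l : GL (Idx h) F := ⟨lHom hD ↑x⁻¹, lHom hD x, by rw [← map_mul, Units.inv_mul, map_one],
    by rw [← map_mul, Units.mul_inv, map_one]⟩
  have hl : l ∈ unitsL g := mem_unitsL_iff.2 (lHom_mem hD _)
  have hΛ1 : IsStable g (latMap l.val Λ) := hΛ.latMap_of_mem (lHom_mem hD _)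
  have hbase : ∀ t ∈ T, unif F ^ N • t ∈ latMap l.val Λ := by
    rintro _ ⟨t, ht, rfl⟩
    have h1 : unif F ^ N • k 1 ∈ latMap l.val Λ := by
      refine ⟨_, hx1, ?_⟩
      change lHom hD ↑x⁻¹ *ᵥ k (unif F ^ N • (x : LAlg g)) = _
      rw [← hkmul, mul_smul_comm, Units.inv_mul, map_smul]
    have h2 := hΛ1.lHom_mulVec_mem hD ht _ h1
    rwa [mulVec_smul_unif, ← hkmul, mul_one] at h2
  have hplus : ∀ w ∈ latMap l.val Λ, unif F ^ N • (idem1 F h *ᵥ w) ∈ T := by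
    rintro _ ⟨w, hw, rfl⟩
    obtain ⟨y, hy⟩ := hkE w
    refine ⟨_, hx2 y ?_, ?_⟩
    · rw [Submodule.mem_comap, hy]
      exact hΛ.1 w hw
    · rw [map_smul, hkmul, hy]
      change unif F ^ N • (lHom hD ↑x⁻¹ *ᵥ (idem1 F h *ᵥ w)) =
        unif F ^ N • (idem1 F h *ᵥ (lHom hD ↑x⁻¹ *ᵥ w))
      rw [Matrix.mulVec_mulVec, Matrix.mulVec_mulVec, (mem_algL_iff.1 (lHom_mem hD _)).1.eq]
  refine ⟨l, hl, fun w hw => ?_, fun w hw => ?_⟩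
  · rw [Submodule.mem_comap, hf]
    exact ⟨hplus w hw, hplus _ (hΛ1.opD0_mem w hw)⟩
  · obtain ⟨t, ht, _, ⟨t', ht', rfl⟩, h2⟩ := Submodule.mem_sup.1 (hn w hw)
    rw [pow_add, mul_smul, ← h2, smul_add]
    refine Submodule.add_mem _ (hbase t ht) ?_
    rw [← map_smul D]
    exact hΛ1.opD0_mem _ (hbase t' ht')

end

/-! ### Finiteness of the class set and of the unit indices -/

section

variable {h : ℕ} {a b : 𝒪[F]} {g : GL (Idx h) 𝒪[F]}

lemma finite_latClasses (ha : IsUnit a) (hb : IsUnit b) (hab : IsUnit (a - b))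
    (hD : IsUnit (opD0 g)) (hN : (opM0 g).toBlocks₁₁.charpoly.Separable) :
    Finite (LatClasses a b g) := by
  obtain ⟨S, hS, hSr⟩ := exists_finite_representatives hD hN
  have hst : ∀ Λ : StableLat a b g, IsStable g Λ.1 := fun Λ => (isStable_iff ha hb hab).2 Λ.2.2
  have : Finite {Λ : StableLat a b g // Λ.1 ∈ S} := by
    have := hS.to_subtype
    refine Finite.of_injective (fun Λ : {Λ : StableLat a b g // Λ.1 ∈ S} => (⟨Λ.1.1, Λ.2⟩ : S)) ?_
    intro Λ Λ' hΛ
    exact Subtype.ext (Subtype.ext (congrArg (fun x : S => x.1) hΛ))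
  refine Finite.of_surjective
    (fun Λ : {Λ : StableLat a b g // Λ.1 ∈ S} => Quotient.mk (latSetoid a b g) Λ.1) ?_
  intro c
  obtain ⟨Λ, rfl⟩ := Quotient.exists_rep c
  obtain ⟨l, hl, hlS⟩ := hSr Λ.1 Λ.2.1 (hst Λ)
  refine ⟨⟨⟨latMap l.val Λ.1, isLattice_latMap l Λ.2.1, (isStable_iff ha hb hab).1
    ((hst Λ).latMap_of_mem (mem_unitsL_iff.1 hl))⟩, hlS⟩, ?_⟩
  exact Quotient.sound ⟨l, hl, rfl⟩

/-! ### The stabilizers and the maximal order -/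

lemma mem_unitsStab_iff {Λ : Submodule 𝒪[F] (Idx h → F)} {u : GL (Idx h) F} :
    u ∈ unitsStab g Λ ↔ u ∈ unitsL g ∧ latMap u.val Λ = Λ := by
  constructor
  · rintro ⟨hu1, hu2⟩
    refine ⟨⟨hu1.1, hu2.1⟩, le_antisymm ?_ fun v hv => ?_⟩
    · rintro _ ⟨v, hv, rfl⟩
      exact hu1.2 v hv
    · rw [mem_latMap_units]
      exact hu2.2 v hv
  · rintro ⟨hu, hΛ⟩
    refine ⟨⟨hu.1, fun v hv => ?_⟩, ⟨hu.2, fun v hv => ?_⟩⟩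
    · exact hΛ.le ⟨v, hv, rfl⟩
    · rw [← hΛ, mem_latMap_units] at hv
      exact hv

/-- A matrix stabilizing a lattice is integral. -/
lemma isIntegral_of_mulVec_mem {X : Matrix (Idx h) (Idx h) F} {Λ : Submodule 𝒪[F] (Idx h → F)}
    (hΛ : Submodule.IsLattice F Λ) (hX : ∀ v ∈ Λ, X *ᵥ v ∈ Λ) : IsIntegral 𝒪[F] X := by
  rw [isLattice_iff] at hΛ
  have : Module.Finite 𝒪[F] Λ := Module.Finite.iff_fg.2 hΛ.1
  let f : Module.End 𝒪[F] Λ :=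
    ((Matrix.mulVecLin X).restrictScalars 𝒪[F]).restrict (p := Λ) (q := Λ) hX
  have hf : ∀ v : Λ, ((f v : Λ) : Idx h → F) = X *ᵥ v := fun v => rfl
  obtain ⟨p, hp, hp0⟩ := (Module.End.isIntegral (R := 𝒪[F]) (M := Λ)).isIntegral f
  rw [← Polynomial.aeval_def] at hp0
  have hq : ∀ (q : Polynomial 𝒪[F]) (v : Λ),
      ((Polynomial.aeval f q v : Λ) : Idx h → F) = Polynomial.aeval X q *ᵥ v := by
    intro q
    induction q using Polynomial.induction_on' with
    | add p q hp hq =>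
      intro v
      rw [map_add, map_add, Matrix.add_mulVec, ← hp, ← hq]
      rfl
    | monomial i c =>
      induction i generalizing c with
      | zero =>
        intro v
        rw [Polynomial.monomial_zero_left, Polynomial.aeval_C, Polynomial.aeval_C,
          Algebra.algebraMap_eq_smul_one (A := Matrix _ _ F), smul_mulVec_int, Matrix.one_mulVec]
        rfl
      | succ n ih =>
        intro v
        rw [← Polynomial.monomial_mul_X, map_mul, map_mul, Polynomial.aeval_X, Polynomial.aeval_X,
          ← Matrix.mulVec_mulVec, ← hf, ← ih]
        rfl
  refine ⟨p, hp, ?_⟩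
  rw [← Polynomial.aeval_def]
  refine Matrix.mulVec_injective (funext fun v => ?_)
  obtain ⟨n, hn⟩ := hΛ.2 v
  have h1 := hq p ⟨_, hn⟩
  rw [hp0, mulVec_smul_unif] at h1
  rw [Matrix.zero_mulVec]
  by_contra hc
  exact unif_smul_ne_zero (F := F) n hc h1.symm

lemma unitsStab_le_unitsIntL {Λ : Submodule 𝒪[F] (Idx h → F)} (hΛ : Submodule.IsLattice F Λ) :
    unitsStab g Λ ≤ unitsIntL g := fun _ hu =>
  ⟨Algebra.subset_adjoin ⟨hu.1.1, isIntegral_of_mulVec_mem hΛ hu.1.2⟩,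
    Algebra.subset_adjoin ⟨hu.2.1, isIntegral_of_mulVec_mem hΛ hu.2.2⟩⟩

variable (hD : IsUnit (opD0 g)) (hN : (opM0 g).toBlocks₁₁.charpoly.Separable)
include hD hN

/-- The elements of `O_L` lie in a fixed multiple of the order `𝒪[x] / (χ)`. -/
lemma exists_forall_intL_eq : ∃ N : ℕ, ∀ z ∈ intL g, z ∈ algL g ∧
    ∃ y ∈ LOrd g, lHom hD y = unif F ^ N • z := by
  have := isReduced_adjoinRoot_charpoly hN
  have := finiteDimensional_LAlg (g := g)
  obtain ⟨N, hNB⟩ := exists_forall_isIntegral_smul_mem (LOrd g) fg_LOrd exists_smul_mem_LOrd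
  refine ⟨N, fun z hz => ?_⟩
  -- Integral elements of the commutative ring `F[x] / (χ)` form a subalgebra, so the algebra
  -- generated by the integral elements of `L` contains no others.
  have hle : intL g ≤ (integralClosure 𝒪[F] (LAlg g)).map ((lHom hD).restrictScalars 𝒪[F]) := by
    refine Algebra.adjoin_le ?_
    rintro z ⟨hz1, hz2⟩
    obtain ⟨y, rfl⟩ := exists_lHom_eq hD hN hz1
    refine ⟨y, ?_, rfl⟩
    exact (isIntegral_algHom_iff ((lHom hD).restrictScalars 𝒪[F]) (lHom_injective hD hN)).1 hz2
  obtain ⟨y, hy, rfl⟩ := hle hz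
  exact ⟨lHom_mem hD y, _, hNB y hy, lHom_smul_int hD _ _⟩

lemma unitsIntL_le_unitsL : unitsIntL g ≤ unitsL g := by
  obtain ⟨N, hN'⟩ := exists_forall_intL_eq hD hN
  exact fun u hu => mem_unitsL_iff.2 (hN' _ hu.1).1

/-- Cosets of `Stab(Λ)ˣ` correspond to the translates of `Λ` by `O_Lˣ`. As `π^N O_L` lies in the
order `𝒪[x] / (χ)`, which preserves `Λ`, all translates lie between `π^N Λ` and `π^{-N} Λ`, so they
are finitely many. An infinite index would have the value `0`. -/
lemma relIndex_unitsStab_ne_zero {Λ : Submodule 𝒪[F] (Idx h → F)} (hΛ : Submodule.IsLattice F Λ)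
    (hst : IsStable g Λ) : (unitsStab g Λ).relIndex (unitsIntL g) ≠ 0 := by
  obtain ⟨N, hNint⟩ := exists_forall_intL_eq hD hN
  rw [isLattice_iff] at hΛ
  have hact : ∀ z ∈ intL g, ∀ v ∈ Λ, unif F ^ N • (z *ᵥ v) ∈ Λ := by
    intro z hz v hv
    obtain ⟨-, y, hy, hyz⟩ := hNint z hz
    have := hst.lHom_mulVec_mem hD hy v hv
    rwa [hyz, smul_mulVec_int] at this
  let m : (Idx h → F) →ₗ[𝒪[F]] (Idx h → F) := unif F ^ N • LinearMap.id
  have hm : ∀ v, m v = unif F ^ N • v := fun v => rfl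
  have hminj : Function.Injective m := fun v w hvw => unif_smul_injective (F := F) N hvw
  have hXfg : (Λ.comap m).FG := Submodule.fg_of_fg_map_injective m hminj
    (hΛ.1.of_le (Submodule.map_comap_le _ _))
  have hfin := (finite_submodules_between hXfg (N + N)).to_subtype
  have hmem : ∀ z ∈ unitsIntL g, latMap z.val Λ ∈ {Y : Submodule 𝒪[F] (Idx h → F) |
      Y ≤ Λ.comap m ∧ ∀ x ∈ Λ.comap m, unif F ^ (N + N) • x ∈ Y} := by
    intro z hz
    refine ⟨?_, fun x hx => ?_⟩
    · rintro _ ⟨v, hv, rfl⟩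
      exact hact _ hz.1 v hv
    · rw [mem_latMap_units, pow_add, mul_smul, mulVec_smul_unif]
      exact hact _ hz.2 _ hx
  rw [Subgroup.relIndex]
  have : Finite (unitsIntL g ⧸ (unitsStab g Λ).subgroupOf (unitsIntL g)) := by
    refine Finite.of_injective (β := {Y : Submodule 𝒪[F] (Idx h → F) |
      Y ≤ Λ.comap m ∧ ∀ x ∈ Λ.comap m, unif F ^ (N + N) • x ∈ Y})
      (fun c => ⟨latMap c.out.1.val Λ, hmem _ c.out.2⟩) ?_
    intro c d hcd
    have h1 : latMap c.out.1.val Λ = latMap d.out.1.val Λ := congrArg Subtype.val hcd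
    rw [← c.out_eq', ← d.out_eq']
    refine QuotientGroup.eq.2 ?_
    rw [Subgroup.mem_subgroupOf, mem_unitsStab_iff]
    refine ⟨unitsIntL_le_unitsL hD hN (c.out⁻¹ * d.out).2, ?_⟩
    change latMap (c.out.1⁻¹.val * d.out.1.val) Λ = Λ
    rw [latMap_mul, ← h1, ← latMap_mul, Units.inv_mul, latMap_one]
  exact Subgroup.index_ne_zero_of_finite

end

section

/-! ### Determinants of the blocks -/

variable {h : ℕ} {a b : 𝒪[F]} {g : GL (Idx h) 𝒪[F]}

/-- The valuation of the determinant of the block on `F^h ⊕ 0`. -/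
def ordP (u : GL (Idx h) F) : ℤ := ord u.val.toBlocks₁₁.det

/-- The valuation of the determinant of the block on `0 ⊕ F^h`. -/
def ordM (u : GL (Idx h) F) : ℤ := ord u.val.toBlocks₂₂.det

lemma det_eq_of_mem_C1 {u : GL (Idx h) F} (hu : u ∈ C1 F h) :
    u.val.det = u.val.toBlocks₁₁.det * u.val.toBlocks₂₂.det := by
  conv_lhs => rw [eq_fromBlocks_of_commute (mem_C1_iff_commute.1 hu), Matrix.det_fromBlocks_zero₁₂]

lemma det_val_ne_zero (u : GL (Idx h) F) : u.val.det ≠ 0 :=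
  ((Matrix.isUnit_iff_isUnit_det _).1 u.isUnit).ne_zero

lemma det_toBlocks₁₁_ne_zero {u : GL (Idx h) F} (hu : u ∈ C1 F h) : u.val.toBlocks₁₁.det ≠ 0 :=
  left_ne_zero_of_mul (det_eq_of_mem_C1 hu ▸ det_val_ne_zero u)

lemma det_toBlocks₂₂_ne_zero {u : GL (Idx h) F} (hu : u ∈ C1 F h) : u.val.toBlocks₂₂.det ≠ 0 :=
  right_ne_zero_of_mul (det_eq_of_mem_C1 hu ▸ det_val_ne_zero u)

lemma ordP_mul {u v : GL (Idx h) F} (hu : u ∈ C1 F h) (hv : v ∈ C1 F h) :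
    ordP (u * v) = ordP u + ordP v := by
  rw [ordP, Units.val_mul, toBlocks₁₁_mul_of_commute (mem_C1_iff_commute.1 hu), Matrix.det_mul,
    ord_mul (det_toBlocks₁₁_ne_zero hu) (det_toBlocks₁₁_ne_zero hv), ordP, ordP]

lemma ordM_mul {u v : GL (Idx h) F} (hu : u ∈ C1 F h) (hv : v ∈ C1 F h) :
    ordM (u * v) = ordM u + ordM v := by
  rw [ordM, Units.val_mul, toBlocks₂₂_mul_of_commute (mem_C1_iff_commute.1 hu), Matrix.det_mul,
    ord_mul (det_toBlocks₂₂_ne_zero hu) (det_toBlocks₂₂_ne_zero hv), ordM, ordM]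

lemma ordP_one : ordP (1 : GL (Idx h) F) = 0 := by
  rw [ordP, Units.val_one, ← Matrix.fromBlocks_one, Matrix.toBlocks_fromBlocks₁₁, Matrix.det_one,
    ord_one]

lemma ordM_one : ordM (1 : GL (Idx h) F) = 0 := by
  rw [ordM, Units.val_one, ← Matrix.fromBlocks_one, Matrix.toBlocks_fromBlocks₂₂, Matrix.det_one,
    ord_one]

lemma ordP_inv {u : GL (Idx h) F} (hu : u ∈ C1 F h) : ordP u⁻¹ = -ordP u := by
  have := ordP_mul hu (inv_mem hu)
  rw [mul_inv_cancel, ordP_one] at this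
  linarith

lemma ordM_inv {u : GL (Idx h) F} (hu : u ∈ C1 F h) : ordM u⁻¹ = -ordM u := by
  have := ordM_mul hu (inv_mem hu)
  rw [mul_inv_cancel, ordM_one] at this
  linarith

lemma det_mem_integers {n : Type*} [Fintype n] [DecidableEq n] {X : Matrix n n F}
    (hX : ∀ i j, X i j ∈ 𝒪[F]) : X.det ∈ 𝒪[F] := by
  rw [Matrix.det_apply]
  refine sum_mem fun σ _ => ?_
  rw [Units.smul_def]
  exact zsmul_mem (prod_mem fun i _ => hX _ _) _

lemma ordP_eq_zero {u : GL (Idx h) F} (hu : u ∈ C1 F h) (hi : u ∈ intGL F h) : ordP u = 0 := by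
  rw [mem_intGL_iff] at hi
  have h1 : 0 ≤ ordP u := (ord_nonneg_iff (det_toBlocks₁₁_ne_zero hu)).2
    (det_mem_integers fun i j => hi.1 _ _)
  have h2 : 0 ≤ ordP u⁻¹ := (ord_nonneg_iff (det_toBlocks₁₁_ne_zero (inv_mem hu))).2
    (det_mem_integers fun i j => hi.2 _ _)
  rw [ordP_inv hu] at h2
  omega

lemma ordM_eq_zero {u : GL (Idx h) F} (hu : u ∈ C1 F h) (hi : u ∈ intGL F h) : ordM u = 0 := by
  rw [mem_intGL_iff] at hi
  have h1 : 0 ≤ ordM u := (ord_nonneg_iff (det_toBlocks₂₂_ne_zero hu)).2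
    (det_mem_integers fun i j => hi.1 _ _)
  have h2 : 0 ≤ ordM u⁻¹ := (ord_nonneg_iff (det_toBlocks₂₂_ne_zero (inv_mem hu))).2
    (det_mem_integers fun i j => hi.2 _ _)
  rw [ordM_inv hu] at h2
  omega

variable (F h) in
/-- The matrix exchanging the two blocks of coordinates. -/
def swapGL : GL (Idx h) F where
  val := Matrix.fromBlocks 0 1 1 0
  inv := Matrix.fromBlocks 0 1 1 0
  val_inv := by rw [Matrix.fromBlocks_multiply]; simp
  inv_val := by rw [Matrix.fromBlocks_multiply]; simp

lemma swapGL_inv : (swapGL F h)⁻¹ = swapGL F h := rfl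

lemma swapGL_mem_intGL : swapGL F h ∈ intGL F h := by
  rw [mem_intGL_iff, swapGL_inv, and_self]
  rintro (i | i) (j | j)
  · exact zero_mem _
  · change (1 : Matrix (Fin h) (Fin h) F) i j ∈ _
    rw [Matrix.one_apply]; split_ifs <;> [exact one_mem _; exact zero_mem _]
  · change (1 : Matrix (Fin h) (Fin h) F) i j ∈ _
    rw [Matrix.one_apply]; split_ifs <;> [exact one_mem _; exact zero_mem _]
  · exact zero_mem _

lemma swapGL_mul_idem1 : (swapGL F h).val * idem1 F h = (1 - idem1 F h) * (swapGL F h).val := by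
  rw [sub_mul, one_mul, eq_sub_iff_add_eq, idem1, swapGL, Matrix.fromBlocks_multiply,
    Matrix.fromBlocks_multiply, Matrix.fromBlocks_add]
  simp

/-- Operators such as `δ` that exchange the two summands become block diagonal after the swap, which
brings `ordP` and `ordM` to bear on them. -/
lemma swapGL_mul_mem_C1 {w : GL (Idx h) F}
    (hw : w.val * idem1 F h = (1 - idem1 F h) * w.val) : swapGL F h * w ∈ C1 F h := by
  rw [mem_C1_iff_commute, Commute, SemiconjBy, Units.val_mul, mul_assoc, hw, ← mul_assoc, mul_sub,
    swapGL_mul_idem1, mul_one, sub_mul, sub_mul, one_mul, sub_mul, sub_sub_cancel, mul_assoc]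

lemma swapGL_conj_val {u : GL (Idx h) F} (hu : u ∈ C1 F h) :
    (swapGL F h * u * swapGL F h).val =
      Matrix.fromBlocks u.val.toBlocks₂₂ 0 0 u.val.toBlocks₁₁ := by
  rw [Units.val_mul, Units.val_mul]
  conv_lhs => rw [eq_fromBlocks_of_commute (mem_C1_iff_commute.1 hu), swapGL,
    Matrix.fromBlocks_multiply, Matrix.fromBlocks_multiply]
  simp

lemma swapGL_conj_mem_C1 {u : GL (Idx h) F} (hu : u ∈ C1 F h) :
    swapGL F h * u * swapGL F h ∈ C1 F h := by
  rw [mem_C1_iff_commute, swapGL_conj_val hu, idem1, Commute, SemiconjBy,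
    Matrix.fromBlocks_multiply, Matrix.fromBlocks_multiply]
  simp

lemma ordP_swapGL_conj {u : GL (Idx h) F} (hu : u ∈ C1 F h) :
    ordP (swapGL F h * u * swapGL F h) = ordM u := by
  rw [ordP, swapGL_conj_val hu, Matrix.toBlocks_fromBlocks₁₁, ordM]

lemma ordM_swapGL_conj {u : GL (Idx h) F} (hu : u ∈ C1 F h) :
    ordM (swapGL F h * u * swapGL F h) = ordP u := by
  rw [ordM, swapGL_conj_val hu, Matrix.toBlocks_fromBlocks₂₂, ordP]

lemma absC_eq (x : C1 F h) : absC x = (resCard F : ℝ) ^ (ordP x.1 - ordM x.1) := by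
  have h1 := det_toBlocks₁₁_ne_zero x.2
  have h2 := det_toBlocks₂₂_ne_zero x.2
  have h3 : (x.1.val.toBlocks₁₁⁻¹ * x.1.val.toBlocks₂₂).det =
      (x.1.val.toBlocks₁₁.det)⁻¹ * x.1.val.toBlocks₂₂.det := by
    rw [Matrix.det_mul, Matrix.det_nonsing_inv, Ring.inverse_eq_inv']
  rw [absC, h3, normAbs_eq (mul_ne_zero (inv_ne_zero h1) h2), ord_mul (inv_ne_zero h1) h2,
    ord_inv h1, ordP, ordM]
  congr 1
  ring

lemma etaC_eq (K : Type*) [Field K] [Algebra F K] [Algebra.IsSeparable F K]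
    (hK : Module.finrank F K = 2)
    (hunr : Algebra.FormallyUnramified 𝒪[F] (integralClosure 𝒪[F] K)) (x : C1 F h) :
    etaC K x = (-1) ^ (ordP x.1 + ordM x.1) := by
  have h1 := det_toBlocks₁₁_ne_zero x.2
  have h2 := det_toBlocks₂₂_ne_zero x.2
  rw [etaC, Matrix.det_mul, quadChar_eq K hK hunr (mul_ne_zero h1 h2), ord_mul h1 h2, ordP, ordM]

/-! ### Lattices as translates of the standard lattice -/

lemma mem_lat0 {v : Idx h → F} : v ∈ lat0 F h ↔ ∀ i, v i ∈ 𝒪[F] := by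
  constructor
  · rintro ⟨c, rfl⟩ i
    exact (c i).2
  · intro hv
    exact ⟨fun i => ⟨v i, hv i⟩, rfl⟩

lemma mulVec_mem_lat0 {X : Matrix (Idx h) (Idx h) F} :
    (∀ v ∈ lat0 F h, X *ᵥ v ∈ lat0 F h) ↔ ∀ i j, X i j ∈ 𝒪[F] := by
  constructor
  · intro hX i j
    have h1 := mem_lat0.1 (hX (Pi.single j 1) (mem_lat0.2 fun k => by
      rw [Pi.single_apply]; split_ifs <;> [exact one_mem _; exact zero_mem _])) i
    rwa [Matrix.mulVec_single_one, Matrix.col_apply] at h1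
  · intro hX v hv
    rw [mem_lat0] at hv ⊢
    intro i
    change ∑ j, X i j * v j ∈ 𝒪[F]
    exact sum_mem fun j _ => mul_mem (hX i j) (hv j)

lemma latMap_lat0_eq_iff {u : GL (Idx h) F} : latMap u.val (lat0 F h) = lat0 F h ↔ u ∈ intGL F h := by
  rw [mem_intGL_iff, ← mulVec_mem_lat0, ← mulVec_mem_lat0]
  constructor
  · intro hu
    refine ⟨fun v hv => hu.le ⟨v, hv, rfl⟩, fun v hv => ?_⟩
    rw [← hu, mem_latMap_units] at hv
    exact hv
  · rintro ⟨h1, h2⟩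
    refine le_antisymm ?_ fun v hv => mem_latMap_units.2 (h2 v hv)
    rintro _ ⟨v, hv, rfl⟩
    exact h1 v hv

lemma latMap_eq_latMap_iff {u w : GL (Idx h) F} {Λ Λ' : Submodule 𝒪[F] (Idx h → F)} :
    latMap u.val Λ = latMap w.val Λ' ↔ latMap (w⁻¹ * u).val Λ = Λ' := by
  rw [Units.val_mul, latMap_mul]
  constructor
  · intro hu
    rw [hu, ← latMap_mul, Units.inv_mul, latMap_one]
  · intro hu
    rw [← hu, ← latMap_mul, Units.mul_inv, latMap_one]

lemma isLattice_lat0 : Submodule.IsLattice F (lat0 F h) := by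
  rw [isLattice_iff]
  refine ⟨?_, fun v => ?_⟩
  · rw [lat0, LinearMap.range_eq_map]
    exact Module.Finite.fg_top.map _
  choose n d hd using fun i => exists_pow_mul_eq (v i)
  refine ⟨Finset.univ.sup n, mem_lat0.2 fun i => ?_⟩
  obtain ⟨j, hj⟩ := Nat.exists_eq_add_of_le (Finset.le_sup (f := n) (Finset.mem_univ i))
  have h1 : (unif F ^ (Finset.univ.sup n) • v) i = ((unif F ^ j * d i : 𝒪[F]) : F) := by
    rw [Pi.smul_apply, hj, add_comm, pow_add, mul_smul]
    change (unif F : F) ^ j * ((unif F : F) ^ n i * v i) = (unif F : F) ^ j * d i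
    rw [hd]
  rw [h1]
  exact (unif F ^ j * d i).2

end

section

/-! ### Lengths of quotients of free modules -/

/-- Matching the two Smith bases writes `f` as an automorphism followed by a diagonal endomorphism.
-/
lemma det_eq_prod_smithNormalFormCoeffs {R M ι : Type*} [CommRing R] [IsDomain R]
    [IsPrincipalIdealRing R] [AddCommGroup M] [Module R M] [Module.Free R M] [Module.Finite R M]
    [Fintype ι] [DecidableEq ι] (b : Module.Basis ι R M) (f : M →ₗ[R] M)
    (hf : Function.Injective f)
    (hr : Module.finrank R (LinearMap.range f) = Module.finrank R M) :
    Associated (∏ i, Submodule.smithNormalFormCoeffs b hr i) (LinearMap.det f) := by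
  set c := Submodule.smithNormalFormCoeffs b hr
  set b' := Submodule.smithNormalFormTopBasis b hr
  set bN := Submodule.smithNormalFormBotBasis b hr
  set T : M →ₗ[R] M := Matrix.toLin b' b' (Matrix.diagonal c)
  have hT : ∀ i, T (b' i) = c i • b' i := by
    intro i
    rw [Matrix.toLin_self]
    simp [Matrix.diagonal_apply]
  have hTdet : LinearMap.det T = ∏ i, c i := by
    rw [LinearMap.det_toLin, Matrix.det_diagonal]
  set φ : LinearMap.range f ≃ₗ[R] M := bN.equiv b' (Equiv.refl _)
  have h1 : f = T ∘ₗ (((LinearEquiv.ofInjective f hf).trans φ : M ≃ₗ[R] M) : M →ₗ[R] M) := by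
    have h2 : (LinearMap.range f).subtype = T ∘ₗ (φ : LinearMap.range f →ₗ[R] M) := by
      refine bN.ext fun i => ?_
      rw [LinearMap.comp_apply, LinearEquiv.coe_coe, Module.Basis.equiv_apply, Equiv.refl_apply, hT]
      exact Submodule.smithNormalFormBotBasis_def b hr i
    ext x
    have h3 := LinearMap.congr_fun h2 (LinearEquiv.ofInjective f hf x)
    exact h3
  obtain ⟨u, hu⟩ := LinearEquiv.isUnit_det' ((LinearEquiv.ofInjective f hf).trans φ)
  refine ⟨u, ?_⟩
  conv_rhs => rw [h1, LinearMap.det_comp, hTdet, ← hu]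

lemma ord_prod {ι : Type*} (s : Finset ι) (c : ι → F) (hc : ∀ i ∈ s, c i ≠ 0) :
    ord (∏ i ∈ s, c i) = ∑ i ∈ s, ord (c i) := by
  classical
  induction s using Finset.induction_on with
  | empty => simp [ord_one]
  | insert i s hi ih =>
    rw [Finset.prod_insert hi, Finset.sum_insert hi, ord_mul (hc i (by simp)), ih]
    · exact fun j hj => hc j (by simp [hj])
    · exact Finset.prod_ne_zero_iff.2 fun j hj => hc j (by simp [hj])

/-- By the Smith normal form the quotient is a product of modules `𝒪 / c_i`, and `∏ c_i` is the
determinant up to a unit. -/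
lemma length_quotient_range_mulVecLin {n : Type*} [Fintype n] [DecidableEq n]
    (Y : Matrix n n 𝒪[F]) (hY : Y.det ≠ 0) :
    Module.length 𝒪[F] ((n → 𝒪[F]) ⧸ LinearMap.range Y.mulVecLin) =
      (ord (Y.det : F)).toNat := by
  have hinj : Function.Injective Y.mulVecLin := Matrix.mulVec_injective_of_det_ne_zero hY
  have hr : Module.finrank 𝒪[F] (LinearMap.range Y.mulVecLin) =
      Module.finrank 𝒪[F] (n → 𝒪[F]) := LinearMap.finrank_range_of_inj hinj
  have h1 := det_eq_prod_smithNormalFormCoeffs (Pi.basisFun 𝒪[F] n) Y.mulVecLin hinj hr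
  have hc := Submodule.smithNormalFormCoeffs_ne_zero (Pi.basisFun 𝒪[F] n) hr
  rw [LinearEquiv.length_eq ((LinearMap.range Y.mulVecLin).quotientEquivPiSpan
    (Pi.basisFun 𝒪[F] n) hr), Module.length_pi_of_fintype]
  set c := Submodule.smithNormalFormCoeffs (Pi.basisFun 𝒪[F] n) hr
  have h2 : ∀ i, Module.length 𝒪[F] (𝒪[F] ⧸ Ideal.span {c i}) = ((ord (c i : F)).toNat : ℕ∞) :=
    fun i => ringOrd_eq (c i) (hc i)
  have hc' : ∀ i, (c i : F) ≠ 0 := fun i h0 => hc i (Subtype.ext h0)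
  have h3 : ord (Y.det : F) = ∑ i, ord (c i : F) := by
    obtain ⟨u, hu⟩ := h1
    rw [← Matrix.toLin'_apply', LinearMap.det_toLin'] at hu
    rw [← hu]
    push_cast
    rw [ord_mul (Finset.prod_ne_zero_iff.2 fun i _ => hc' i)
      (fun h0 => u.ne_zero (Subtype.ext h0)), ord_eq_zero_of_isUnit u.isUnit, add_zero,
      ord_prod _ _ fun i _ => hc' i]
  have h4 : (ord (Y.det : F)).toNat = ∑ i, (ord (c i : F)).toNat := by
    zify
    rw [h3, Int.toNat_of_nonneg (Finset.sum_nonneg fun i _ => ord_nonneg _ (hc i))]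
    exact Finset.sum_congr rfl fun i _ => (Int.toNat_of_nonneg (ord_nonneg _ (hc i))).symm
  rw [h4, Nat.cast_sum]
  exact Finset.sum_congr rfl fun i _ => h2 i

end

section

/-! ### Stable lattices as translates of the standard lattice -/

variable {h : ℕ} {a b : 𝒪[F]} {g : GL (Idx h) 𝒪[F]}

lemma idem1_mulVec (v : Idx h → F) : idem1 F h *ᵥ v = Sum.elim (v ∘ Sum.inl) 0 := by
  conv_lhs => rw [idem1, Matrix.fromBlocks_mulVec]
  simp

lemma exists_GL_forall_mem_iff {n : Type*} [Fintype n] [DecidableEq n]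
    {X : Submodule 𝒪[F] (n → F)} (hX : Submodule.IsLattice F X) :
    ∃ x : GL n F, ∀ v, v ∈ X ↔ ∀ i, (x⁻¹.val *ᵥ v) i ∈ 𝒪[F] := by
  have hr : Module.finrank 𝒪[F] X = Fintype.card n := Submodule.IsLattice.finrank_of_pi F X
  let b : Module.Basis n 𝒪[F] X := (Module.finBasisOfFinrankEq 𝒪[F] X hr).reindex
    (Fintype.equivFin n).symm
  let B : Module.Basis n F (n → F) := b.extendOfIsLattice F
  have hB : ∀ j, B j = (b j).val := fun j => Module.Basis.extendOfIsLattice_apply F b j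
  refine ⟨⟨(Pi.basisFun F n).toMatrix B, B.toMatrix (Pi.basisFun F n),
    Module.Basis.toMatrix_mul_toMatrix_flip _ _, Module.Basis.toMatrix_mul_toMatrix_flip _ _⟩,
    fun v => ?_⟩
  have h1 : B.toMatrix (Pi.basisFun F n) *ᵥ v = B.repr v := by
    rw [← Module.Basis.toMatrix_mulVec_repr (Pi.basisFun F n) B v]
    congr 1
  change v ∈ X ↔ ∀ i, (B.toMatrix (Pi.basisFun F n) *ᵥ v) i ∈ 𝒪[F]
  rw [h1]
  constructor
  · intro hv i
    have h2 := congrArg Subtype.val (b.sum_repr ⟨v, hv⟩)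
    rw [AddSubmonoidClass.coe_finsetSum] at h2
    have h3 : v = ∑ j, (b.repr ⟨v, hv⟩ j : F) • B j := by
      refine h2.symm.trans ?_
      exact Finset.sum_congr rfl fun j _ => by rw [hB]; rfl
    rw [h3, map_sum, Finsupp.finsetSum_apply]
    refine sum_mem fun j _ => ?_
    rw [map_smul, Module.Basis.repr_self, Finsupp.smul_apply, Finsupp.single_apply, smul_eq_mul]
    split_ifs
    · rw [mul_one]; exact Subtype.property _
    · rw [mul_zero]; exact zero_mem _
  · intro hv
    rw [← B.sum_repr v]
    refine sum_mem fun j _ => ?_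
    rw [hB]
    exact X.smul_mem ⟨B.repr v j, hv j⟩ (b j).2

/-- Stability splits `Λ` into its projections to the two blocks; bases of these are the columns of
the diagonal blocks of `u`. -/
lemma exists_latMap_lat0_eq {Λ : Submodule 𝒪[F] (Idx h → F)} (hΛ : Submodule.IsLattice F Λ)
    (h1 : ∀ v ∈ Λ, idem1 F h *ᵥ v ∈ Λ) : ∃ u ∈ C1 F h, latMap u.val (lat0 F h) = Λ := by
  rw [isLattice_iff] at hΛ
  have hl : ∀ f : Fin h → Idx h, Function.Injective f →
      Submodule.IsLattice F (Λ.map (LinearMap.funLeft 𝒪[F] F f)) := by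
    intro f hf
    rw [isLattice_iff]
    refine ⟨hΛ.1.map _, fun v => ?_⟩
    obtain ⟨n, hn⟩ := hΛ.2 (Function.extend f v 0)
    exact ⟨n, _, hn, by
      rw [map_smul]; congr 1; funext i; exact hf.extend_apply _ _ _⟩
  obtain ⟨x, hx⟩ := exists_GL_forall_mem_iff (hl Sum.inl Sum.inl_injective)
  obtain ⟨y, hy⟩ := exists_GL_forall_mem_iff (hl Sum.inr Sum.inr_injective)
  let u : GL (Idx h) F := ⟨Matrix.fromBlocks x.val 0 0 y.val, Matrix.fromBlocks x⁻¹.val 0 0 y⁻¹.val,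
    by rw [Matrix.fromBlocks_multiply, ← Matrix.fromBlocks_one]; simp,
    by rw [Matrix.fromBlocks_multiply, ← Matrix.fromBlocks_one]; simp⟩
  have hu : u⁻¹.val = Matrix.fromBlocks x⁻¹.val 0 0 y⁻¹.val := rfl
  have huv : u.val = Matrix.fromBlocks x.val 0 0 y.val := rfl
  refine ⟨u, ?_, ?_⟩
  · rw [mem_C1_iff_commute, huv, idem1, Commute, SemiconjBy, Matrix.fromBlocks_multiply,
      Matrix.fromBlocks_multiply]
    simp
  ext v
  have h2 : v ∈ Λ ↔ v ∘ Sum.inl ∈ Λ.map (LinearMap.funLeft 𝒪[F] F Sum.inl) ∧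
      v ∘ Sum.inr ∈ Λ.map (LinearMap.funLeft 𝒪[F] F Sum.inr) := by
    constructor
    · exact fun hv => ⟨⟨v, hv, rfl⟩, ⟨v, hv, rfl⟩⟩
    · rintro ⟨⟨w, hw, hwv⟩, z, hz, hzv⟩
      have h3 : v = idem1 F h *ᵥ w + (z - idem1 F h *ᵥ z) := by
        rw [idem1_mulVec, idem1_mulVec]
        funext i
        rcases i with i | i
        · have := congrFun hwv i
          simpa [LinearMap.funLeft_apply] using this.symm
        · have := congrFun hzv i
          simpa [LinearMap.funLeft_apply] using this.symm
      rw [h3]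
      exact Λ.add_mem (h1 w hw) (Λ.sub_mem hz (h1 z hz))
  rw [mem_latMap_units, mem_lat0, h2, hx, hy, hu, Matrix.fromBlocks_mulVec, Sum.forall]
  simp

/-! ### Lengths -/

lemma length_quotient_submoduleOf {R M V : Type*} [CommRing R] [AddCommGroup M] [Module R M]
    [AddCommGroup V] [Module R V] {f : M →ₗ[R] V} (hf : Function.Injective f) {A B : Submodule R V}
    (hA : LinearMap.range f = A) {B' : Submodule R M} (hB : B'.map f = B) :
    Module.length R (A ⧸ B.submoduleOf A) = Module.length R (M ⧸ B') := by
  subst hA hB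
  refine (LinearEquiv.length_eq
    (Submodule.Quotient.equiv B' _ (LinearEquiv.ofInjective f hf) ?_)).symm
  ext ⟨_, x, rfl⟩
  simp only [Submodule.submoduleOf, Submodule.mem_comap, Submodule.mem_map, Submodule.subtype_apply]
  constructor
  · rintro ⟨y, hy, hxy⟩
    exact ⟨y, hy, congrArg Subtype.val hxy⟩
  · rintro ⟨y, hy, hxy⟩
    exact ⟨y, hy, Subtype.ext hxy⟩

variable (F h) in
/-- The inclusion of `𝒪^h ⊕ 0`. -/
def inclP : (Fin h → 𝒪[F]) →ₗ[𝒪[F]] (Idx h → F) where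
  toFun c := Sum.elim (fun i => (c i : F)) 0
  map_add' c d := by funext i; rcases i with i | i <;> simp
  map_smul' r c := by
    funext i
    rcases i with i | i
    · exact rfl
    · simp

variable (F h) in
/-- The inclusion of `0 ⊕ 𝒪^h`. -/
def inclM : (Fin h → 𝒪[F]) →ₗ[𝒪[F]] (Idx h → F) where
  toFun c := Sum.elim 0 (fun i => (c i : F))
  map_add' c d := by funext i; rcases i with i | i <;> simp
  map_smul' r c := by
    funext i
    rcases i with i | i
    · simp
    · exact rfl

lemma inclM_injective : Function.Injective (inclM F h) := fun c d hcd => by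
  funext i
  exact Subtype.ext (congrFun hcd (Sum.inr i))

lemma mem_range_inclP {v : Idx h → F} :
    v ∈ LinearMap.range (inclP F h) ↔ v ∈ lat0 F h ∧ idem1 F h *ᵥ v = v := by
  rw [mem_lat0, idem1_mulVec]
  constructor
  · rintro ⟨c, rfl⟩
    refine ⟨?_, ?_⟩
    · rintro (i | i)
      · exact (c i).2
      · exact zero_mem _
    · funext i; rcases i with i | i <;> rfl
  · rintro ⟨h1, h2⟩
    refine ⟨fun i => ⟨v (Sum.inl i), h1 _⟩, ?_⟩
    exact Eq.trans rfl h2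

lemma mem_range_inclM {v : Idx h → F} :
    v ∈ LinearMap.range (inclM F h) ↔ v ∈ lat0 F h ∧ idem1 F h *ᵥ v = 0 := by
  rw [mem_lat0, idem1_mulVec]
  constructor
  · rintro ⟨c, rfl⟩
    refine ⟨?_, ?_⟩
    · rintro (i | i)
      · exact zero_mem _
      · exact (c i).2
    · funext i; rcases i with i | i <;> rfl
  · rintro ⟨h1, h2⟩
    refine ⟨fun i => ⟨v (Sum.inr i), h1 _⟩, ?_⟩
    funext i
    rcases i with i | i
    · exact (congrFun h2 (Sum.inl i)).symm
    · rfl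

lemma mem_latPlus (hab : IsUnit (a - b)) {Λ : Submodule 𝒪[F] (Idx h → F)} {v : Idx h → F} :
    v ∈ latPlus a b Λ ↔ v ∈ Λ ∧ idem1 F h *ᵥ v = v := by
  have h0 : (a : F) - b ≠ 0 := fun hc => hab.ne_zero (Subtype.ext hc)
  have h1 : toF (tau1 F h (a, b) - a • 1) = ((a : F) - b) • (idem1 F h - 1) := by
    have h2 : a • (1 : Matrix (Idx h) (Idx h) 𝒪[F]) = tau1 F h (a, a) := by
      rw [← Algebra.algebraMap_eq_smul_one, ← AlgHom.commutes (tau1 F h)]; rfl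
    rw [h2, toF_sub, toF_tau1, toF_tau1]
    module
  rw [latPlus, eigenPart, Submodule.mem_inf, LinearMap.mem_ker, LinearMap.restrictScalars_apply,
    Matrix.mulVecLin_apply, h1, Matrix.smul_mulVec, smul_eq_zero_iff_right h0, Matrix.sub_mulVec,
    Matrix.one_mulVec, sub_eq_zero]

lemma mem_latMinus (hab : IsUnit (a - b)) {Λ : Submodule 𝒪[F] (Idx h → F)} {v : Idx h → F} :
    v ∈ latMinus a b Λ ↔ v ∈ Λ ∧ idem1 F h *ᵥ v = 0 := by
  have h0 : (a : F) - b ≠ 0 := fun hc => hab.ne_zero (Subtype.ext hc)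
  have h1 : toF (tau1 F h (a, b) - b • 1) = ((a : F) - b) • idem1 F h := by
    have h2 : b • (1 : Matrix (Idx h) (Idx h) 𝒪[F]) = tau1 F h (b, b) := by
      rw [← Algebra.algebraMap_eq_smul_one, ← AlgHom.commutes (tau1 F h)]; rfl
    rw [h2, toF_sub, toF_tau1, toF_tau1]
    module
  rw [latMinus, eigenPart, Submodule.mem_inf, LinearMap.mem_ker, LinearMap.restrictScalars_apply,
    Matrix.mulVecLin_apply, h1, Matrix.smul_mulVec, smul_eq_zero_iff_right h0]

lemma mulVec_units_injective (u : GL (Idx h) F) : Function.Injective (fun v => u.val *ᵥ v) :=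
  Matrix.mulVec_injective_of_isUnit u.isUnit

lemma latPlus_latMap (hab : IsUnit (a - b)) {u : GL (Idx h) F} (hu : u ∈ C1 F h) :
    latPlus a b (latMap u.val (lat0 F h)) =
      LinearMap.range (((Matrix.mulVecLin u.val).restrictScalars 𝒪[F]) ∘ₗ inclP F h) := by
  rw [LinearMap.range_comp]
  ext v
  rw [mem_latPlus hab, mem_latMap, Submodule.mem_map]
  rw [mem_C1_iff_commute] at hu
  constructor
  · rintro ⟨⟨w, hw, rfl⟩, h1⟩
    refine ⟨w, mem_range_inclP.2 ⟨hw, ?_⟩, rfl⟩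
    rw [Matrix.mulVec_mulVec, ← hu.eq, ← Matrix.mulVec_mulVec] at h1
    exact mulVec_units_injective u h1
  · rintro ⟨w, hw, rfl⟩
    rw [mem_range_inclP] at hw
    refine ⟨⟨w, hw.1, rfl⟩, ?_⟩
    change idem1 F h *ᵥ (u.val *ᵥ w) = u.val *ᵥ w
    rw [Matrix.mulVec_mulVec, ← hu.eq, ← Matrix.mulVec_mulVec, hw.2]

lemma latMinus_latMap (hab : IsUnit (a - b)) {u : GL (Idx h) F} (hu : u ∈ C1 F h) :
    latMinus a b (latMap u.val (lat0 F h)) =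
      LinearMap.range (((Matrix.mulVecLin u.val).restrictScalars 𝒪[F]) ∘ₗ inclM F h) := by
  rw [LinearMap.range_comp]
  ext v
  rw [mem_latMinus hab, mem_latMap, Submodule.mem_map]
  rw [mem_C1_iff_commute] at hu
  constructor
  · rintro ⟨⟨w, hw, rfl⟩, h1⟩
    refine ⟨w, mem_range_inclM.2 ⟨hw, ?_⟩, rfl⟩
    rw [Matrix.mulVec_mulVec, ← hu.eq, ← Matrix.mulVec_mulVec] at h1
    exact mulVec_units_injective u (h1.trans (Matrix.mulVec_zero _).symm)
  · rintro ⟨w, hw, rfl⟩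
    rw [mem_range_inclM] at hw
    refine ⟨⟨w, hw.1, rfl⟩, ?_⟩
    change idem1 F h *ᵥ (u.val *ᵥ w) = 0
    rw [Matrix.mulVec_mulVec, ← hu.eq, ← Matrix.mulVec_mulVec, hw.2, Matrix.mulVec_zero]

/-- In the bases of `Λ₊` and `Λ₋` given by `u`, the map `δ` is the lower left block `Y` of `w =
u⁻¹δu`, so the length is the valuation of `det Y`. With `ς` the swap, `ςw = (ςu⁻¹ς)(ςδ)u` is a
product of block diagonal matrices, and conjugation by `ς` exchanges the blocks of `u⁻¹`.
Nonnegativity is recorded because `toNat` would lose it. -/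
lemma latLength_latMap_lat0 (hab : IsUnit (a - b)) {D : GL (Idx h) F}
    (hD : D.val = toF (opDelta a b g)) {u : GL (Idx h) F} (hu : u ∈ C1 F h)
    (hst : IsStable g (latMap u.val (lat0 F h))) :
    0 ≤ ordP (swapGL F h * D) + ordP u - ordM u ∧
      Module.length 𝒪[F] (latMinus a b (latMap u.val (lat0 F h)) ⧸
        (latMap (toF (opDelta a b g)) (latPlus a b (latMap u.val (lat0 F h)))).submoduleOf
          (latMinus a b (latMap u.val (lat0 F h)))) =
      (ordP (swapGL F h * D) + ordP u - ordM u).toNat := by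
  have hu' := mem_C1_iff_commute.1 hu
  have hDi : D.val * idem1 F h = (1 - idem1 F h) * D.val := by
    rw [hD, toF_opDelta, smul_mul_assoc, opD0_mul_idem1, mul_smul_comm]
  set w : GL (Idx h) F := u⁻¹ * D * u
  have hwi : w.val * idem1 F h = (1 - idem1 F h) * w.val := by
    have h1 := mem_C1_iff_commute.1 (inv_mem hu)
    rw [Units.val_mul, Units.val_mul, mul_assoc, hu'.eq, ← mul_assoc, mul_assoc u⁻¹.val, hDi,
      ← mul_assoc, mul_sub, mul_one, h1.eq]
    simp only [sub_mul, one_mul, mul_assoc]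
  have hint : ∀ i j, w.val i j ∈ 𝒪[F] := by
    rw [← mulVec_mem_lat0]
    intro v hv
    have h1 : D.val *ᵥ (u.val *ᵥ v) ∈ latMap u.val (lat0 F h) := by
      rw [hD, toF_opDelta]
      have h2 : ((a : F) - b) ^ 2 = ((a - b) ^ 2 : 𝒪[F]) := by push_cast; rfl
      rw [h2, Matrix.smul_mulVec]
      exact Submodule.smul_mem _ _ (hst.opD0_mem _ ⟨v, hv, rfl⟩)
    rw [mem_latMap_units] at h1
    rwa [Units.val_mul, Units.val_mul, ← Matrix.mulVec_mulVec, ← Matrix.mulVec_mulVec]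
  set Y : Matrix (Fin h) (Fin h) 𝒪[F] := fun i j => ⟨w.val (Sum.inr i) (Sum.inl j), hint _ _⟩
  have hsw : swapGL F h * D ∈ C1 F h := swapGL_mul_mem_C1 hDi
  have hsww : swapGL F h * w ∈ C1 F h := swapGL_mul_mem_C1 hwi
  have hYw : (Y.det : F) = (swapGL F h * w).val.toBlocks₁₁.det := by
    have h1 : (swapGL F h * w).val.toBlocks₁₁ = Y.map (algebraMap 𝒪[F] F) := by
      rw [Units.val_mul, swapGL]
      conv_lhs => rw [← Matrix.fromBlocks_toBlocks w.val, Matrix.fromBlocks_multiply]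
      simp
      rfl
    rw [h1]
    exact RingHom.map_det (algebraMap 𝒪[F] F) Y
  have hY0 : Y.det ≠ 0 := fun h0 => det_toBlocks₁₁_ne_zero hsww (by rw [← hYw, h0]; rfl)
  have hord : ord (Y.det : F) = ordP (swapGL F h * D) + ordP u - ordM u := by
    have h1 : swapGL F h * w = (swapGL F h * u⁻¹ * swapGL F h) * (swapGL F h * D) * u := by
      have h2 : swapGL F h * swapGL F h = 1 := by
        conv_lhs => rw [← swapGL_inv (F := F) (h := h)]
        rw [swapGL_inv]; exact mul_inv_cancel (swapGL F h)
      simp only [w, mul_assoc]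
      rw [← mul_assoc (swapGL F h) (swapGL F h), h2, one_mul]
    rw [hYw, ← ordP, h1, ordP_mul (mul_mem (swapGL_conj_mem_C1 (inv_mem hu)) hsw) hu,
      ordP_mul (swapGL_conj_mem_C1 (inv_mem hu)) hsw, ordP_swapGL_conj (inv_mem hu), ordM_inv hu]
    ring
  rw [← hord]
  refine ⟨ord_nonneg _ hY0, ?_⟩
  rw [← length_quotient_range_mulVecLin Y hY0]
  refine length_quotient_submoduleOf
    (f := ((Matrix.mulVecLin u.val).restrictScalars 𝒪[F]) ∘ₗ inclM F h)
    ((mulVec_units_injective u).comp inclM_injective) (latMinus_latMap hab hu).symm ?_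
  rw [latPlus_latMap hab hu, latMap, ← LinearMap.range_comp, ← LinearMap.range_comp]
  congr 1
  refine LinearMap.ext fun c => ?_
  have h1 : w.val *ᵥ inclP F h c = inclM F h (Y *ᵥ c) := by
    have h2 : idem1 F h *ᵥ inclP F h c = inclP F h c := (mem_range_inclP.1 ⟨c, rfl⟩).2
    have h3 : w.val *ᵥ inclP F h c = (1 - idem1 F h) *ᵥ (w.val *ᵥ inclP F h c) := by
      rw [Matrix.mulVec_mulVec, ← hwi, ← Matrix.mulVec_mulVec, h2]
    rw [Matrix.sub_mulVec, Matrix.one_mulVec, idem1_mulVec] at h3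
    funext i
    rcases i with i | i
    · rw [h3]
      simp [inclM]
    · change ∑ j, w.val (Sum.inr i) j * inclP F h c j = ((∑ j, Y i j * c j : 𝒪[F]) : F)
      rw [Fintype.sum_sum_type]
      simp [inclP, Y]
  change u.val *ᵥ inclM F h (Y *ᵥ c) = toF (opDelta a b g) *ᵥ (u.val *ᵥ inclP F h c)
  rw [← hD, ← h1, Matrix.mulVec_mulVec, Matrix.mulVec_mulVec, ← Units.val_mul, ← Units.val_mul]
  congr 2
  simp only [w, mul_assoc, mul_inv_cancel_left]

end

section

/-! ### The integrand -/

variable {h : ℕ} {a b : 𝒪[F]} {g : GL (Idx h) 𝒪[F]}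

lemma isStable_lat0 : IsStable g (lat0 F h) := by
  have h1 : toF (tau1 F h (1, 0)) = idem1 F h := by
    rw [toF_tau1]; simp
  have h2 : toF (tau2 g (1, 0)) = idem2 g := by
    rw [toF_tau2]; simp
  constructor
  · rw [mulVec_mem_lat0, ← h1]
    exact fun i j => Subtype.property _
  · rw [mulVec_mem_lat0, ← h2]
    exact fun i j => Subtype.property _

lemma latMap_eq_of_mem_intGL {u₁ u₂ : GL (Idx h) F} :
    latMap u₁.val (lat0 F h) = latMap (glMap g * u₂).val (lat0 F h) ↔
      u₁⁻¹ * glMap g * u₂ ∈ intGL F h := by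
  rw [latMap_eq_latMap_iff, latMap_lat0_eq_iff, ← inv_mem_iff]
  congr! 1
  group

/-- As `u₁Λ₀` the lattice is stable under `τ₁`; as `g u₂Λ₀` it is stable under `gτ₁g⁻¹ = τ₂`. -/
lemma isStable_latMap_lat0 {u₁ u₂ : GL (Idx h) F} (h1 : u₁ ∈ C1 F h) (h2 : u₂ ∈ C1 F h)
    (hu : u₁⁻¹ * glMap g * u₂ ∈ intGL F h) : IsStable g (latMap u₁.val (lat0 F h)) := by
  refine ⟨mulVec_mem_latMap_of_commute (mem_C1_iff_commute.1 h1) (isStable_lat0 (g := g)).1, ?_⟩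
  rw [latMap_eq_of_mem_intGL.2 hu]
  rintro _ ⟨v, hv, rfl⟩
  refine ⟨_, (isStable_lat0 (g := g)).1 v hv, ?_⟩
  change (glMap g * u₂).val *ᵥ (idem1 F h *ᵥ v) = idem2 g *ᵥ ((glMap g * u₂).val *ᵥ v)
  rw [Matrix.mulVec_mulVec, Matrix.mulVec_mulVec, idem2, Units.val_mul, mul_assoc,
    (mem_C1_iff_commute.1 h2).eq]
  simp only [mul_assoc, Units.inv_mul_cancel_left]

lemma exists_unit_toF_opDelta (hδ : IsUnit (toF (opDelta a b g))) :
    ∃ D : GL (Idx h) F, D.val = toF (opDelta a b g) := ⟨hδ.unit, rfl⟩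

lemma opDelta_mul_idem1 {D : GL (Idx h) F} (hD : D.val = toF (opDelta a b g)) :
    D.val * idem1 F h = (1 - idem1 F h) * D.val := by
  rw [hD, toF_opDelta, smul_mul_assoc, opD0_mul_idem1, mul_smul_comm]

/-- This is the length formula at `u = 1`, where the quotient is trivial. -/
lemma ordP_swapGL_mul_opDelta (hab : IsUnit (a - b))
    (hΛ0 : latMinus a b (lat0 F h) = latMap (toF (opDelta a b g)) (latPlus a b (lat0 F h)))
    {D : GL (Idx h) F} (hD : D.val = toF (opDelta a b g)) : ordP (swapGL F h * D) = 0 := by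
  have h1 := latLength_latMap_lat0 (u := 1) hab hD (one_mem _)
    (by rw [Units.val_one, latMap_one]; exact isStable_lat0)
  rw [Units.val_one, latMap_one, ← hΛ0, ordP_one, ordM_one, add_zero, sub_zero,
    Submodule.submoduleOf_self, Module.length_eq_zero_iff.2 inferInstance] at h1
  have h2 : (ordP (swapGL F h * D)).toNat = 0 := by exact_mod_cast h1.2.symm
  have h3 := h1.1
  omega

lemma latLength_eq (hab : IsUnit (a - b)) (hδ : IsUnit (toF (opDelta a b g)))
    (hΛ0 : latMinus a b (lat0 F h) = latMap (toF (opDelta a b g)) (latPlus a b (lat0 F h)))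
    {u : GL (Idx h) F} (hu : u ∈ C1 F h) (hst : IsStable g (latMap u.val (lat0 F h))) :
    (latLength a b g (latMap u.val (lat0 F h)) : ℤ) = ordP u - ordM u := by
  obtain ⟨D, hD⟩ := exists_unit_toF_opDelta hδ
  have h1 := latLength_latMap_lat0 hab hD hu hst
  rw [ordP_swapGL_mul_opDelta hab hΛ0 hD, zero_add] at h1
  rw [latLength, h1.2, ENat.toNat_natCast, Int.toNat_of_nonneg h1.1]

lemma ord_inv_mul_mul {u X : GL (Idx h) F} : ord (u⁻¹ * X * u).val.det = ord X.val.det := by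
  rw [Units.val_mul, Units.val_mul, Matrix.det_mul_right_comm, Units.inv_mul, one_mul]

lemma mem_intGL_of_ord_det {X : GL (Idx h) F} (hX : ∀ i j, X.val i j ∈ 𝒪[F])
    (h0 : ord X.val.det = 0) : X ∈ intGL F h := by
  set Y : Matrix (Idx h) (Idx h) 𝒪[F] := fun i j => ⟨X.val i j, hX i j⟩
  have h1 : (Y.det : F) = X.val.det := RingHom.map_det (algebraMap 𝒪[F] F) Y
  have h2 : IsUnit Y.det := by
    obtain ⟨u, hu⟩ := isUnit_of_ord_eq_zero (det_val_ne_zero X) h0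
    exact ⟨u, Subtype.ext (hu.trans h1.symm)⟩
  refine ⟨((Matrix.isUnit_iff_isUnit_det _).2 h2).unit, Units.ext ?_⟩
  rfl

lemma ord_det_eq_zero_of_mem_intGL {X : GL (Idx h) F} (hX : X ∈ intGL F h) :
    ord X.val.det = 0 := by
  obtain ⟨Y, rfl⟩ := hX
  have h1 : (glMap Y).val.det = (Y.val.det : F) := (RingHom.map_det (algebraMap 𝒪[F] F) Y.val).symm
  rw [h1]
  exact ord_eq_zero_of_isUnit ((Matrix.isUnit_iff_isUnit_det _).1 Y.isUnit)

/-- Stability of `uΛ₀` makes the entries integral, and conjugation leaves the unit determinant of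
`J` unchanged. -/
lemma conj_mem_intGL {u J : GL (Idx h) F} (hJ : J ∈ intGL F h)
    (hJu : ∀ v ∈ latMap u.val (lat0 F h), J.val *ᵥ v ∈ latMap u.val (lat0 F h)) :
    u⁻¹ * J * u ∈ intGL F h := by
  refine mem_intGL_of_ord_det ?_ (by rw [ord_inv_mul_mul, ord_det_eq_zero_of_mem_intGL hJ])
  rw [← mulVec_mem_lat0]
  intro v hv
  have h1 := hJu _ ⟨v, hv, rfl⟩
  rw [mem_latMap_units] at h1
  rwa [Units.val_mul, Units.val_mul, ← Matrix.mulVec_mulVec, ← Matrix.mulVec_mulVec]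

lemma glMap_inv_mul_mem_C1 {J : GL (Idx h) F} (hJ : J.val * idem1 F h = idem2 g * J.val) :
    (glMap g)⁻¹ * J ∈ C1 F h := by
  rw [mem_C1_iff_commute, Commute, SemiconjBy, Units.val_mul, mul_assoc, hJ, idem2]
  simp only [mul_assoc, Units.inv_mul_cancel_left]

lemma glMap_inv_mul_swap {J : GL (Idx h) F} (hJ : J.val * idem1 F h = (1 - idem2 g) * J.val) :
    ((glMap g)⁻¹ * J).val * idem1 F h = (1 - idem1 F h) * ((glMap g)⁻¹ * J).val := by
  rw [Units.val_mul, mul_assoc, hJ, idem2]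
  simp only [sub_mul, mul_sub, one_mul, mul_assoc, Units.inv_mul_cancel_left]

/-- An integrally invertible `i` acts as an automorphism of `Λ = u₁Λ₀ = g u₂Λ₀`, so `u₂⁻¹(g⁻¹i)u₁`
is integrally invertible. Here `g⁻¹i` lies in `C(τ₁) ∩ GL_{2h}(𝒪)`, so both its block determinants
are units and those of `u₁` and `u₂` have equal valuations. -/
lemma ord_eq_of_isUnit_opI (hI : IsUnit (opI a b g)) {u₁ u₂ : GL (Idx h) F} (h1 : u₁ ∈ C1 F h)
    (h2 : u₂ ∈ C1 F h) (hu : u₁⁻¹ * glMap g * u₂ ∈ intGL F h) :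
    ordP u₂ = ordP u₁ ∧ ordM u₂ = ordM u₁ := by
  have hst := isStable_latMap_lat0 h1 h2 hu
  have hJv : (glMap hI.unit).val = toF (opI a b g) := rfl
  have hJC : (glMap g)⁻¹ * glMap hI.unit ∈ C1 F h := glMap_inv_mul_mem_C1 (by
    rw [hJv, toF_opI, smul_mul_assoc, opI0_mul_idem1, mul_smul_comm])
  have hJ : glMap hI.unit ∈ intGL F h := ⟨_, rfl⟩
  have h3 : u₁⁻¹ * glMap hI.unit * u₁ ∈ intGL F h := by
    refine conj_mem_intGL hJ fun v hv => ?_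
    rw [hJv, toF_opI, Matrix.smul_mulVec]
    exact Submodule.smul_mem _ (a - b) (hst.opI0_mem v hv)
  have h4 : u₂⁻¹ * ((glMap g)⁻¹ * glMap hI.unit) * u₁ ∈ intGL F h := by
    have := mul_mem (inv_mem hu) h3
    convert this using 1
    group
  have h0 : (glMap g)⁻¹ * glMap hI.unit ∈ intGL F h := mul_mem (inv_mem ⟨_, rfl⟩) hJ
  have h5 := ordP_eq_zero (mul_mem (mul_mem (inv_mem h2) hJC) h1) h4
  have h6 := ordM_eq_zero (mul_mem (mul_mem (inv_mem h2) hJC) h1) h4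
  rw [ordP_mul (mul_mem (inv_mem h2) hJC) h1, ordP_mul (inv_mem h2) hJC, ordP_inv h2,
    ordP_eq_zero hJC h0] at h5
  rw [ordM_mul (mul_mem (inv_mem h2) hJC) h1, ordM_mul (inv_mem h2) hJC, ordM_inv h2,
    ordM_eq_zero hJC h0] at h6
  omega

lemma swapGL_mul_swapGL_mul (u : GL (Idx h) F) : swapGL F h * (swapGL F h * u) = u :=
  inv_mul_cancel_left (swapGL F h) u

/-- The argument for `i` applies, except that `g⁻¹e` exchanges the two summands; the swap restores
block diagonal form and interchanges the blocks of `u₂`. -/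
lemma ord_eq_of_isUnit_opE (hE : IsUnit (opE a b g)) {u₁ u₂ : GL (Idx h) F} (h1 : u₁ ∈ C1 F h)
    (h2 : u₂ ∈ C1 F h) (hu : u₁⁻¹ * glMap g * u₂ ∈ intGL F h) :
    ordP u₂ = ordM u₁ ∧ ordM u₂ = ordP u₁ := by
  have hst := isStable_latMap_lat0 h1 h2 hu
  have hJv : (glMap hE.unit).val = toF (opE a b g) := rfl
  have hJC : swapGL F h * ((glMap g)⁻¹ * glMap hE.unit) ∈ C1 F h :=
    swapGL_mul_mem_C1 (glMap_inv_mul_swap (by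
      rw [hJv, toF_opE, smul_mul_assoc, opE0_mul_idem1, mul_smul_comm]))
  have hJ : glMap hE.unit ∈ intGL F h := ⟨_, rfl⟩
  have h3 : u₁⁻¹ * glMap hE.unit * u₁ ∈ intGL F h := by
    refine conj_mem_intGL hJ fun v hv => ?_
    rw [hJv, toF_opE, Matrix.smul_mulVec]
    exact Submodule.smul_mem _ (a - b) (hst.opE0_mem v hv)
  have h4 : (swapGL F h * u₂⁻¹ * swapGL F h) * (swapGL F h * ((glMap g)⁻¹ * glMap hE.unit)) * u₁
      ∈ intGL F h := by
    have := mul_mem swapGL_mem_intGL (mul_mem (inv_mem hu) h3)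
    convert this using 1
    simp only [mul_assoc, swapGL_mul_swapGL_mul, mul_inv_rev, inv_inv, mul_inv_cancel_left]
  have h0 : swapGL F h * ((glMap g)⁻¹ * glMap hE.unit) ∈ intGL F h :=
    mul_mem swapGL_mem_intGL (mul_mem (inv_mem ⟨_, rfl⟩) hJ)
  have hs := swapGL_conj_mem_C1 (inv_mem h2)
  have h5 := ordP_eq_zero (mul_mem (mul_mem hs hJC) h1) h4
  have h6 := ordM_eq_zero (mul_mem (mul_mem hs hJC) h1) h4
  rw [ordP_mul (mul_mem hs hJC) h1, ordP_mul hs hJC, ordP_swapGL_conj (inv_mem h2), ordM_inv h2,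
    ordP_eq_zero hJC h0] at h5
  rw [ordM_mul (mul_mem hs hJC) h1, ordM_mul hs hJC, ordM_swapGL_conj (inv_mem h2), ordP_inv h2,
    ordM_eq_zero hJC h0] at h6
  omega

lemma neg_one_zpow_congr {m n : ℤ} (hmn : ∃ r, m = n + 2 * r) : (-1 : ℂ) ^ m = (-1) ^ n := by
  obtain ⟨r, rfl⟩ := hmn
  rw [zpow_add₀ (by norm_num), zpow_mul]
  norm_num

/-! ### The integrand on its support -/

section Value

variable (K : Type*) [Field K] [Algebra F K] [Algebra.IsSeparable F K]
  (hK : Module.finrank F K = 2) (hunr : Algebra.FormallyUnramified 𝒪[F] (integralClosure 𝒪[F] K))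
include hK hunr

lemma orbIntegrand_eq_pow (hab : IsUnit (a - b)) (hδ : IsUnit (toF (opDelta a b g)))
    (hΛ0 : latMinus a b (lat0 F h) = latMap (toF (opDelta a b g)) (latPlus a b (lat0 F h)))
    {k : ℕ} (hk : (k = 2 ∧ IsUnit (opI a b g)) ∨ (k = 0 ∧ IsUnit (opE a b g))) (s : ℂ)
    {u : C1 F h × C1 F h} (hu : u.1.1⁻¹ * glMap g * u.2.1 ∈ intGL F h) :
    orbIntegrand K g (charIntGL F h) s u =
      (-((resCard F : ℂ) ^ ((k : ℂ) * s))) ^ latLength a b g (latMap u.1.1.val (lat0 F h)) := by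
  have hlen := latLength_eq hab hδ hΛ0 u.1.2 (isStable_latMap_lat0 u.1.2 u.2.2 hu)
  set n := latLength a b g (latMap u.1.1.val (lat0 F h))
  rw [orbIntegrand, charIntGL, Set.indicator_of_mem (by exact hu), Pi.one_apply, one_mul,
    etaC_eq K hK hunr, absC_eq, Subgroup.coe_mul, ordP_mul u.1.2 u.2.2, ordM_mul u.1.2 u.2.2]
  -- In both cases `p₂ + m₂ = p₁ + m₁`, which differs from the length `p₁ - m₁` by `2m₁`.
  have h1 : (-1 : ℂ) ^ (ordP u.2.1 + ordM u.2.1) = (-1) ^ (n : ℤ) := by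
    refine neg_one_zpow_congr ⟨ordM u.1.1, ?_⟩
    rcases hk with ⟨rfl, hI⟩ | ⟨rfl, hE⟩
    · have := ord_eq_of_isUnit_opI hI u.1.2 u.2.2 hu
      omega
    · have := ord_eq_of_isUnit_opE hE u.1.2 u.2.2 hu
      omega
  -- For `i` the two contributions agree and double the length; for `e` they cancel. This is the
  -- origin of `k`.
  have h2 : ordP u.1.1 + ordP u.2.1 - (ordM u.1.1 + ordM u.2.1) = ((n * k : ℕ) : ℤ) := by
    rcases hk with ⟨rfl, hI⟩ | ⟨rfl, hE⟩
    · have := ord_eq_of_isUnit_opI hI u.1.2 u.2.2 hu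
      push_cast
      omega
    · have := ord_eq_of_isUnit_opE hE u.1.2 u.2.2 hu
      push_cast
      omega
  rw [h1, h2, neg_pow, zpow_natCast, zpow_natCast]
  congr 1
  push_cast
  rw [← Complex.natCast_cpow_natCast_mul, ← Complex.cpow_nat_mul]
  push_cast
  rw [mul_assoc]

end Value

end

section

/-! ### Invariance of the integrand -/

variable {h : ℕ} {a b : 𝒪[F]} {g : GL (Idx h) 𝒪[F]}

/-- The operator `δ` commutes with `l` and exchanges the two summands, so it conjugates one block of
`l` into the other. -/
lemma ordP_eq_ordM_of_mem_unitsL (hδ : IsUnit (toF (opDelta a b g))) {l : GL (Idx h) F}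
    (hl : l ∈ unitsL g) : ordP l = ordM l := by
  obtain ⟨D, hD⟩ := exists_unit_toF_opDelta hδ
  have hC := unitsL_le_C1 g hl
  have hs : swapGL F h * D ∈ C1 F h := swapGL_mul_mem_C1 (opDelta_mul_idem1 hD)
  have h1 : l * D = D * l := by
    refine Units.ext ?_
    rw [Units.val_mul, Units.val_mul, hD, toF_opDelta, smul_mul_assoc, mul_smul_comm,
      (commute_opD0_of_mem_algL (mem_unitsL_iff.1 hl)).eq]
  have h2 : (swapGL F h * l * swapGL F h) * (swapGL F h * D) = (swapGL F h * D) * l := by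
    simp only [mul_assoc, swapGL_mul_swapGL_mul, h1]
  have h3 := congrArg ordP h2
  rw [ordP_mul (swapGL_conj_mem_C1 hC) hs, ordP_mul hs hC, ordP_swapGL_conj hC] at h3
  omega

lemma isUnit_opI0 (hD : IsUnit (opD0 g)) : IsUnit (opI0 g) := by
  rw [← opI0_mul_opE0, Matrix.isUnit_iff_isUnit_det, Matrix.det_mul, IsUnit.mul_iff] at hD
  exact (Matrix.isUnit_iff_isUnit_det _).2 hD.1

/-- The block diagonal element `g⁻¹i`, rescaled, intertwines `l` with `g⁻¹lg`. -/
lemma ord_conj_glMap (hD : IsUnit (opD0 g)) {l : GL (Idx h) F} (hl : l ∈ unitsL g) :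
    ordP ((glMap g)⁻¹ * l * glMap g) = ordP l ∧ ordM ((glMap g)⁻¹ * l * glMap g) = ordM l := by
  set J : GL (Idx h) F := (isUnit_opI0 hD).unit
  have hJ : J.val = opI0 g := rfl
  have hc : (glMap g)⁻¹ * J ∈ C1 F h := glMap_inv_mul_mem_C1 (by rw [hJ, opI0_mul_idem1])
  have hC := unitsL_le_C1 g hl
  have h1 : J * l = l * J := by
    refine Units.ext ?_
    rw [Units.val_mul, Units.val_mul, hJ, (commute_opI0_of_mem_algL (mem_unitsL_iff.1 hl)).eq]
  have h2 : ((glMap g)⁻¹ * l * glMap g) * ((glMap g)⁻¹ * J) = ((glMap g)⁻¹ * J) * l := by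
    simp only [mul_assoc, mul_inv_cancel_left, h1]
  have h3 := congrArg ordP h2
  have h4 := congrArg ordM h2
  rw [ordP_mul (conj_mem_C1 g hl) hc, ordP_mul hc hC] at h3
  rw [ordM_mul (conj_mem_C1 g hl) hc, ordM_mul hc hC] at h4
  omega

variable (K : Type*) [Field K] [Algebra F K] [Algebra.IsSeparable F K]
  (hK : Module.finrank F K = 2) (hunr : Algebra.FormallyUnramified 𝒪[F] (integralClosure 𝒪[F] K))
include hK hunr

/-- The two blocks of `l` have determinants of the same valuation, as have those of `g⁻¹lg`. The
absolute value is therefore unaffected, and the valuation in the character changes by an even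
number. -/
lemma orbIntegrand_embL_mul (hδ : IsUnit (toF (opDelta a b g))) (f : GL (Idx h) F → ℂ) (s : ℂ)
    (l : unitsL g) (u : C1 F h × C1 F h) :
    orbIntegrand K g f s (embL g l * u) = orbIntegrand K g f s u := by
  have h1 := ordP_eq_ordM_of_mem_unitsL hδ l.2
  have h2 := ord_conj_glMap (isUnit_opD0 hδ) l.2
  have hC := unitsL_le_C1 g l.2
  have hC' := conj_mem_C1 g l.2
  have e1 : (embL g l * u).1.1 = l.1 * u.1.1 := rfl
  have e2 : (embL g l * u).2.1 = (glMap g)⁻¹ * l.1 * glMap g * u.2.1 := rfl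
  simp only [orbIntegrand, etaC_eq K hK hunr, absC_eq, Subgroup.coe_mul]
  rw [ordP_mul (embL g l * u).1.2 (embL g l * u).2.2, ordM_mul (embL g l * u).1.2 (embL g l * u).2.2,
    e1, e2, ordP_mul hC u.1.2, ordP_mul hC' u.2.2, ordM_mul hC u.1.2, ordM_mul hC' u.2.2, h2.1, h2.2,
    ordP_mul u.1.2 u.2.2, ordM_mul u.1.2 u.2.2]
  congr 1
  · congr 1
    · congr 1
      group
    · exact neg_one_zpow_congr ⟨ordM l.1, by rw [h1]; ring⟩
  · congr 3
    rw [h1]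
    ring

lemma orbIntegrand_mul_right (s : ℂ) {u v : C1 F h × C1 F h} (h1 : v.1.1 ∈ intGL F h)
    (h2 : v.2.1 ∈ intGL F h) :
    orbIntegrand K g (charIntGL F h) s (u * v) = orbIntegrand K g (charIntGL F h) s u := by
  have e1 : (u * v).1.1 = u.1.1 * v.1.1 := rfl
  have e2 : (u * v).2.1 = u.2.1 * v.2.1 := rfl
  have e3 : charIntGL F h ((u.1.1 * v.1.1)⁻¹ * glMap g * (u.2.1 * v.2.1)) =
      charIntGL F h (u.1.1⁻¹ * glMap g * u.2.1) := by
    have : (u.1.1 * v.1.1)⁻¹ * glMap g * (u.2.1 * v.2.1) =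
        v.1.1⁻¹ * (u.1.1⁻¹ * glMap g * u.2.1) * v.2.1 := by group
    rw [this, charIntGL]
    refine Set.indicator_eq_indicator ?_ rfl
    rw [SetLike.mem_coe, SetLike.mem_coe, Subgroup.mul_mem_cancel_right _ h2,
      Subgroup.mul_mem_cancel_left _ (inv_mem h1)]
  simp only [orbIntegrand, etaC_eq K hK hunr, absC_eq, Subgroup.coe_mul]
  rw [ordP_mul (u * v).1.2 (u * v).2.2, ordM_mul (u * v).1.2 (u * v).2.2, e1, e2, e3,
    ordP_mul u.1.2 v.1.2, ordP_mul u.2.2 v.2.2, ordM_mul u.1.2 v.1.2, ordM_mul u.2.2 v.2.2,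
    ordP_mul u.1.2 u.2.2, ordM_mul u.1.2 u.2.2, ordP_eq_zero v.1.2 h1, ordP_eq_zero v.2.2 h2,
    ordM_eq_zero v.1.2 h1, ordM_eq_zero v.2.2 h2]
  simp only [add_zero]

end

section

/-! ### Quotients of measures by a subgroup -/

section QuotientMeasure

variable {G H : Type*} [Group G] [TopologicalSpace G] [IsTopologicalGroup G] [MeasurableSpace G]
  [BorelSpace G] [SecondCountableTopology G] [Group H] [MeasurableSpace H] [MeasurableMul H]
  [MeasurableInv H] {Φ : H →* G} (hΦ : Measurable Φ) {μ : Measure G} [SFinite μ]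
  [μ.IsMulLeftInvariant] {ν : Measure H} [SFinite ν] [ν.IsMulRightInvariant] [ν.IsInvInvariant]
  {U : Subgroup G} (hU : IsOpen (U : Set G))

lemma exists_mul_eq_out (Φ : H →* G) (u : G) :
    ∃ l : H, Φ l * u =
      (Quotient.mk (QuotientGroup.rightRel Φ.range) u).out := by
  have h1 : (QuotientGroup.rightRel Φ.range) u
      (Quotient.mk (QuotientGroup.rightRel Φ.range) u).out :=
    (QuotientGroup.rightRel Φ.range).symm
      (Quotient.mk_out (s := QuotientGroup.rightRel Φ.range) u)
  rw [QuotientGroup.rightRel_apply] at h1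
  obtain ⟨l, hl⟩ := h1
  exact ⟨l, by rw [hl, inv_mul_cancel_right]⟩

lemma mk_eq_mk_iff {u v : G} :
    Quotient.mk (QuotientGroup.rightRel Φ.range) u = Quotient.mk _ v ↔ ∃ l, Φ l * u = v := by
  rw [Quotient.eq, QuotientGroup.rightRel_apply]
  constructor
  · rintro ⟨l, hl⟩
    exact ⟨l, by rw [hl, inv_mul_cancel_right]⟩
  · rintro ⟨l, rfl⟩
    exact ⟨l, by rw [mul_inv_cancel_right]⟩

include hΦ in
lemma measurable_comp_orbit {φ : G → ℝ≥0∞} (hφ : Measurable φ) (u : G) :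
    Measurable fun l => φ (Φ l * u) :=
  hφ.comp (hΦ.mul_const u)

include hΦ in
lemma measurable_lintegral_orbit {φ : G → ℝ≥0∞} (hφ : Measurable φ) :
    Measurable fun u => ∫⁻ l, φ (Φ l * u) ∂ν := by
  refine Measurable.lintegral_prod_right' (f := fun p : G × H => φ (Φ p.2 * p.1)) ?_
  exact hφ.comp ((hΦ.comp measurable_snd).mul measurable_fst)

lemma lintegral_orbit_mul_left (φ : G → ℝ≥0∞) (l : H) (u : G) :
    ∫⁻ l', φ (Φ l' * (Φ l * u)) ∂ν = ∫⁻ l', φ (Φ l' * u) ∂ν := by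
  have h1 := lintegral_mul_right_eq_self (μ := ν) (fun l' => φ (Φ l' * u)) l
  rw [← h1]
  simp only [map_mul, mul_assoc]

lemma lintegral_orbit_out (φ : G → ℝ≥0∞) (u : G) :
    ∫⁻ l', φ (Φ l' * (Quotient.mk (QuotientGroup.rightRel Φ.range) u).out) ∂ν =
      ∫⁻ l', φ (Φ l' * u) ∂ν := by
  obtain ⟨l, hl⟩ := exists_mul_eq_out Φ u
  rw [← hl, lintegral_orbit_mul_left]

include hΦ in
lemma measurable_lintegral_orbit_out {φ : G → ℝ≥0∞} (hφ : Measurable φ) :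
    Measurable fun c : Quotient (QuotientGroup.rightRel Φ.range) =>
      ∫⁻ l, φ (Φ l * c.out) ∂ν := by
  refine measurable_from_quotient.2 ?_
  convert measurable_lintegral_orbit (ν := ν) hΦ hφ using 1
  funext u
  exact lintegral_orbit_out φ u

include hΦ in
-- Dividing the weight by its orbit integrals gives `w` with integral `1` along every orbit; the
-- quotient measure is the image of `w μ`. Tonelli, left invariance of `μ` and inversion invariance
-- of `ν` move the translation by `Φ l` from `w` to `φ`.
lemma exists_quotient_measure_of_weight {w₀ : G → ℝ≥0∞} (hw : Measurable w₀)
    (h0 : ∀ u, ∫⁻ l, w₀ (Φ l * u) ∂ν ≠ 0) (htop : ∀ u, ∫⁻ l, w₀ (Φ l * u) ∂ν ≠ ∞) :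
    ∃ m : Measure (Quotient (QuotientGroup.rightRel Φ.range)), ∀ φ : G → ℝ≥0∞, Measurable φ →
      ∫⁻ u, φ u ∂μ = ∫⁻ c, (∫⁻ l, φ (Φ l * c.out) ∂ν) ∂m := by
  set I : G → ℝ≥0∞ := fun u => ∫⁻ l, w₀ (Φ l * u) ∂ν
  have hI : Measurable I := measurable_lintegral_orbit hΦ hw
  set w : G → ℝ≥0∞ := fun u => w₀ u * (I u)⁻¹
  have hwm : Measurable w := hw.mul hI.inv
  have hw1 : ∀ u, ∫⁻ l, w (Φ l * u) ∂ν = 1 := by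
    intro u
    have h1 : ∀ l, I (Φ l * u) = I u := fun l => lintegral_orbit_mul_left w₀ l u
    simp only [w, h1]
    rw [lintegral_mul_const _ (measurable_comp_orbit hΦ hw u)]
    exact ENNReal.mul_inv_cancel (h0 u) (htop u)
  refine ⟨(μ.withDensity w).map (Quotient.mk _), fun φ hφ => ?_⟩
  have hmk : Measurable (Quotient.mk (QuotientGroup.rightRel Φ.range)) := measurable_quotient_mk''
  rw [lintegral_map (measurable_lintegral_orbit_out hΦ hφ) hmk]
  simp only [lintegral_orbit_out]
  rw [lintegral_withDensity_eq_lintegral_mul _ hwm (measurable_lintegral_orbit hΦ hφ)]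
  have hjoint : ∀ {ψ χ : G → ℝ≥0∞}, Measurable ψ → Measurable χ →
      Measurable fun p : G × H => ψ p.1 * χ (Φ p.2 * p.1) := fun hψ hχ =>
    (hψ.comp measurable_fst).mul (hχ.comp ((hΦ.comp measurable_snd).mul measurable_fst))
  calc ∫⁻ u, φ u ∂μ = ∫⁻ u, ∫⁻ l, φ u * w (Φ l * u) ∂ν ∂μ := by
        refine lintegral_congr fun u => ?_
        rw [lintegral_const_mul _ (measurable_comp_orbit hΦ hwm u), hw1, mul_one]
    _ = ∫⁻ l, ∫⁻ u, φ u * w (Φ l * u) ∂μ ∂ν :=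
        lintegral_lintegral_swap (hjoint hφ hwm).aemeasurable
    _ = ∫⁻ l, ∫⁻ u, w u * φ (Φ l⁻¹ * u) ∂μ ∂ν := by
        refine lintegral_congr fun l => ?_
        rw [← lintegral_mul_left_eq_self (μ := μ) (fun u => w u * φ (Φ l⁻¹ * u)) (Φ l)]
        refine lintegral_congr fun u => ?_
        rw [map_inv, inv_mul_cancel_left, mul_comm]
    _ = ∫⁻ l, ∫⁻ u, w u * φ (Φ l * u) ∂μ ∂ν :=
        lintegral_inv_eq_self (μ := ν) (fun l => ∫⁻ u, w u * φ (Φ l * u) ∂μ)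
    _ = ∫⁻ u, ∫⁻ l, w u * φ (Φ l * u) ∂ν ∂μ :=
        (lintegral_lintegral_swap (hjoint hwm hφ).aemeasurable).symm
    _ = ∫⁻ u, (w * fun u => ∫⁻ l, φ (Φ l * u) ∂ν) u ∂μ := by
        refine lintegral_congr fun u => ?_
        rw [lintegral_const_mul _ (measurable_comp_orbit hΦ hφ u)]
        rfl

lemma preimage_orbit_coset (U : Subgroup G) (l : H) (x : G) {k : G} (hk : k ∈ U) :
    {l' | Φ l' * (Φ l * (x * k)) ∈ {y | x⁻¹ * y ∈ U}} =
      (fun l' => l' * l) ⁻¹' {l' | x⁻¹ * Φ l' * x ∈ U} := by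
  ext l'
  simp only [Set.mem_ofPred_eq, Set.mem_preimage, map_mul]
  rw [← Subgroup.mul_mem_cancel_right U hk (y := x⁻¹ * (Φ l' * Φ l) * x)]
  simp only [mul_assoc]

lemma measure_orbit_coset (U : Subgroup G) (l : H) (x : G) {k : G} (hk : k ∈ U) :
    ν {l' | Φ l' * (Φ l * (x * k)) ∈ {y | x⁻¹ * y ∈ U}} = ν {l' | x⁻¹ * Φ l' * x ∈ U} := by
  rw [preimage_orbit_coset U l x hk, measure_preimage_mul_right]

include hU in
lemma isOpen_coset (x : G) : IsOpen {y | x⁻¹ * y ∈ U} :=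
  hU.preimage (continuous_const_mul x⁻¹)

include hΦ hU in
-- An orbit meets `xU` either nowhere or in a right translate of the stabilizer of the coset.
lemma lintegral_orbit_indicator_coset (x u : G) :
    ∫⁻ l, Set.indicator {y | x⁻¹ * y ∈ U} 1 (Φ l * u) ∂ν =
      Set.indicator (Quotient.mk (QuotientGroup.rightRel Φ.range) '' {y | x⁻¹ * y ∈ U})
        (fun _ => ν {l | x⁻¹ * Φ l * x ∈ U}) (Quotient.mk _ u) := by
  have h1 : ∫⁻ l, Set.indicator {y | x⁻¹ * y ∈ U} 1 (Φ l * u) ∂ν =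
      ν {l | Φ l * u ∈ {y | x⁻¹ * y ∈ U}} :=
    lintegral_indicator_one ((isOpen_coset hU x).measurableSet.preimage (hΦ.mul_const u))
  rw [h1]
  by_cases hu : Quotient.mk (QuotientGroup.rightRel Φ.range) u ∈
      Quotient.mk (QuotientGroup.rightRel Φ.range) '' {y | x⁻¹ * y ∈ U}
  · rw [Set.indicator_of_mem hu]
    obtain ⟨y, hy, hyu⟩ := hu
    obtain ⟨l, rfl⟩ := mk_eq_mk_iff.1 hyu
    rw [← measure_orbit_coset U l x hy, mul_inv_cancel_left]
  · rw [Set.indicator_of_notMem hu]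
    convert measure_empty (μ := ν)
    rw [Set.eq_empty_iff_forall_notMem]
    intro l hl
    exact hu ⟨Φ l * u, hl, (mk_eq_mk_iff.2 ⟨l, rfl⟩).symm⟩

include hΦ hU in
-- The weight is a series of indicators of cosets `xₙU`, with `xₙ` dense so that these open cosets
-- cover `G`. The coefficients `εₙ / ν(stabilizer of xₙU)` bound each orbit integral by `∑ εₙ`, and
-- it is positive because the orbit meets some coset.
lemma exists_quotient_measure (h0 : ∀ x, ν {l | x⁻¹ * Φ l * x ∈ U} ≠ 0)
    (htop : ∀ x, ν {l | x⁻¹ * Φ l * x ∈ U} ≠ ∞) :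
    ∃ m : Measure (Quotient (QuotientGroup.rightRel Φ.range)), ∀ φ : G → ℝ≥0∞, Measurable φ →
      ∫⁻ u, φ u ∂μ = ∫⁻ c, (∫⁻ l, φ (Φ l * c.out) ∂ν) ∂m := by
  set x : ℕ → G := TopologicalSpace.denseSeq G
  obtain ⟨ε, hε, hεs⟩ := ENNReal.exists_pos_sum_of_countable' (ε := 1) one_ne_zero ℕ
  set c : ℕ → ℝ≥0∞ := fun n => ε n * (ν {l | (x n)⁻¹ * Φ l * x n ∈ U})⁻¹
  have hm : ∀ n, Measurable fun u => c n * Set.indicator {y | (x n)⁻¹ * y ∈ U} 1 u := fun n =>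
    (measurable_one.indicator (isOpen_coset hU (x n)).measurableSet).const_mul _
  have hI : ∀ u, ∫⁻ l, ∑' n, c n * Set.indicator {y | (x n)⁻¹ * y ∈ U} 1 (Φ l * u) ∂ν =
      ∑' n, c n * Set.indicator
        (Quotient.mk (QuotientGroup.rightRel Φ.range) '' {y | (x n)⁻¹ * y ∈ U})
        (fun _ => ν {l | (x n)⁻¹ * Φ l * x n ∈ U}) (Quotient.mk _ u) := by
    intro u
    rw [lintegral_tsum fun n => (measurable_comp_orbit hΦ (hm n) u).aemeasurable]
    refine tsum_congr fun n => ?_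
    rw [← lintegral_orbit_indicator_coset hΦ hU, lintegral_const_mul]
    exact measurable_comp_orbit hΦ
      (measurable_one.indicator (isOpen_coset hU (x n)).measurableSet) u
  have hc : ∀ n, c n * ν {l | (x n)⁻¹ * Φ l * x n ∈ U} = ε n := fun n => by
    rw [mul_assoc, ENNReal.inv_mul_cancel (h0 _) (htop _), mul_one]
  refine exists_quotient_measure_of_weight hΦ
    (w₀ := fun u => ∑' n, c n * Set.indicator {y | (x n)⁻¹ * y ∈ U} 1 u)
    (Measurable.tsum hm) (fun u => ?_) (fun u => ?_)
  · rw [hI]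
    obtain ⟨n, hn⟩ := (TopologicalSpace.denseRange_denseSeq G).exists_mem_open (isOpen_coset hU u)
      ⟨u, by simp [one_mem]⟩
    have hn' : u ∈ {y | (x n)⁻¹ * y ∈ U} := by
      have h1 : (u⁻¹ * x n)⁻¹ ∈ U := inv_mem hn
      simpa using h1
    have h1 := ENNReal.le_tsum (f := fun n => c n * Set.indicator
        (Quotient.mk (QuotientGroup.rightRel Φ.range) '' {y | (x n)⁻¹ * y ∈ U})
        (fun _ => ν {l | (x n)⁻¹ * Φ l * x n ∈ U}) (Quotient.mk _ u)) n
    rw [Set.indicator_of_mem (Set.mem_image_of_mem _ hn'), hc] at h1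
    exact ((hε n).trans_le h1).ne'
  · rw [hI]
    refine ne_top_of_le_ne_top hεs.ne_top (ENNReal.tsum_le_tsum fun n => ?_)
    rw [← hc n]
    gcongr
    exact Set.indicator_le_self' (fun _ _ => zero_le) _

include hΦ hU in
lemma measurableSet_image_coset (x : G) :
    MeasurableSet (Quotient.mk (QuotientGroup.rightRel Φ.range) '' {y | x⁻¹ * y ∈ U}) := by
  have h1 : Quotient.mk (QuotientGroup.rightRel Φ.range) ⁻¹'
      (Quotient.mk (QuotientGroup.rightRel Φ.range) '' {y | x⁻¹ * y ∈ U}) =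
      ⋃ l : H, (fun u => Φ l * u) ⁻¹' {y | x⁻¹ * y ∈ U} := by
    ext u
    simp only [Set.mem_preimage, Set.mem_iUnion, Set.mem_image]
    constructor
    · rintro ⟨y, hy, hyu⟩
      obtain ⟨l, hl⟩ := mk_eq_mk_iff.1 hyu.symm
      exact ⟨l, by rw [hl]; exact hy⟩
    · rintro ⟨l, hl⟩
      exact ⟨_, hl, (mk_eq_mk_iff.2 ⟨l, rfl⟩).symm⟩
  refine measurableSet_quotient.2 ?_
  change MeasurableSet (Quotient.mk (QuotientGroup.rightRel Φ.range) ⁻¹' _)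
  rw [h1]
  exact (isOpen_iUnion fun l => (isOpen_coset hU x).preimage (continuous_const_mul _)).measurableSet

include hΦ hU in
-- This tests the defining property of `m` on the indicator of `xU`.
lemma measure_image_coset_mul {m : Measure (Quotient (QuotientGroup.rightRel Φ.range))}
    (hm : ∀ φ : G → ℝ≥0∞, Measurable φ →
      ∫⁻ u, φ u ∂μ = ∫⁻ c, (∫⁻ l, φ (Φ l * c.out) ∂ν) ∂m) (x : G) :
    ν {l | x⁻¹ * Φ l * x ∈ U} *
      m (Quotient.mk (QuotientGroup.rightRel Φ.range) '' {y | x⁻¹ * y ∈ U}) = μ (U : Set G) := by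
  have h1 := hm (Set.indicator {y | x⁻¹ * y ∈ U} 1)
    (measurable_one.indicator (isOpen_coset hU x).measurableSet)
  simp only [lintegral_orbit_indicator_coset hΦ hU, Quotient.out_eq] at h1
  rw [lintegral_indicator_one (isOpen_coset hU x).measurableSet,
    lintegral_indicator_const (measurableSet_image_coset hΦ hU x)] at h1
  rw [← h1]
  exact measure_preimage_mul μ x⁻¹ (U : Set G)

include hΦ hU in
/-- The integral over the quotient of a function supported on finitely many double cosets. -/
lemma integrable_and_integral_quotient {m : Measure (Quotient (QuotientGroup.rightRel Φ.range))}
    (hm : ∀ φ : G → ℝ≥0∞, Measurable φ →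
      ∫⁻ u, φ u ∂μ = ∫⁻ c, (∫⁻ l, φ (Φ l * c.out) ∂ν) ∂m)
    (hμ : μ (U : Set G) = 1)
    (h0 : ∀ x, ν {l | x⁻¹ * Φ l * x ∈ U} ≠ 0) {f : G → ℂ} (hf : ∀ l u, f (Φ l * u) = f u)
    (hfU : ∀ u, ∀ k ∈ U, f (u * k) = f u) {ι : Type*} [Fintype ι] (x : ι → G)
    (hx : ∀ i j l, ∀ k ∈ U, Φ l * x i * k = x j → i = j)
    (hsupp : ∀ u, f u ≠ 0 → ∃ i l, ∃ k ∈ U, Φ l * x i * k = u) :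
    Integrable (fun c : Quotient (QuotientGroup.rightRel Φ.range) => f c.out) m ∧
      ∫ c : Quotient (QuotientGroup.rightRel Φ.range), f c.out ∂m =
        ∑ i, f (x i) * ((ν.real {l | (x i)⁻¹ * Φ l * x i ∈ U} : ℝ) : ℂ)⁻¹ := by
  set S : ι → Set (Quotient (QuotientGroup.rightRel Φ.range)) := fun i =>
    Quotient.mk (QuotientGroup.rightRel Φ.range) '' {y | (x i)⁻¹ * y ∈ U}
  have hSm : ∀ i, MeasurableSet (S i) := fun i => measurableSet_image_coset hΦ hU (x i)
  have hmem : ∀ i u, Quotient.mk _ u ∈ S i ↔ ∃ l, ∃ k ∈ U, Φ l * x i * k = u := by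
    intro i u
    constructor
    · rintro ⟨y, hy, hyu⟩
      obtain ⟨l, rfl⟩ := mk_eq_mk_iff.1 hyu
      exact ⟨l, _, hy, by rw [mul_assoc, mul_inv_cancel_left]⟩
    · rintro ⟨l, k, hk, rfl⟩
      refine ⟨x i * k, by simpa using hk, mk_eq_mk_iff.2 ⟨l, by rw [mul_assoc]⟩⟩
  have hfin : ∀ i, ν {l | (x i)⁻¹ * Φ l * x i ∈ U} * m (S i) = 1 := fun i => by
    rw [← hμ]; exact measure_image_coset_mul hΦ hU hm (x i)
  have hS : ∀ i, m (S i) = (ν {l | (x i)⁻¹ * Φ l * x i ∈ U})⁻¹ := fun i =>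
    ENNReal.eq_inv_of_mul_eq_one_left (by rw [mul_comm]; exact hfin i)
  have hS' : ∀ i, m (S i) ≠ ∞ := fun i => by
    rw [hS]; exact ENNReal.inv_ne_top.2 (h0 _)
  have hout : ∀ u, f (Quotient.mk (QuotientGroup.rightRel Φ.range) u).out = f u := fun u => by
    obtain ⟨l, hl⟩ := exists_mul_eq_out Φ u
    rw [← hl, hf]
  -- On the quotient `f` is constant on each of the disjoint sets `S i` and zero elsewhere.
  have hsum : (fun c : Quotient (QuotientGroup.rightRel Φ.range) => f c.out) =
      fun c => ∑ i, (S i).indicator (fun _ => f (x i)) c := by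
    funext c
    induction c using Quotient.inductionOn with | h u => ?_
    rw [hout]
    by_cases hu : ∃ i, Quotient.mk (QuotientGroup.rightRel Φ.range) u ∈ S i
    · obtain ⟨i, hi⟩ := hu
      rw [Finset.sum_eq_single i]
      · rw [Set.indicator_of_mem hi]
        obtain ⟨l, k, hk, rfl⟩ := (hmem i u).1 hi
        rw [hfU _ k hk, hf]
      · intro j _ hj
        refine Set.indicator_of_notMem (fun hj' => hj ?_) _
        obtain ⟨l, k, hk, rfl⟩ := (hmem i u).1 hi
        obtain ⟨l', k', hk', h1⟩ := (hmem j _).1 hj'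
        refine hx j i (l⁻¹ * l') (k' * k⁻¹) (mul_mem hk' (inv_mem hk)) ?_
        rw [map_mul, map_inv, mul_assoc _ _ (x j), mul_assoc, ← mul_assoc _ k', h1, mul_assoc,
          mul_assoc, inv_mul_cancel_left, mul_inv_cancel, mul_one]
      · exact fun hi' => absurd (Finset.mem_univ i) hi'
    · push Not at hu
      rw [Finset.sum_eq_zero fun i _ => Set.indicator_of_notMem (hu i) _]
      by_contra hne
      obtain ⟨i, hi⟩ := hsupp u hne
      exact hu i ((hmem i u).2 hi)
  have hint : ∀ i ∈ Finset.univ, Integrable ((S i).indicator fun _ => f (x i)) m := fun i _ =>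
    (integrable_indicator_iff (hSm i)).2 (integrableOn_const (hS' i))
  rw [hsum]
  refine ⟨integrable_finsetSum _ hint, ?_⟩
  rw [integral_finsetSum _ hint]
  refine Finset.sum_congr rfl fun i _ => ?_
  rw [integral_indicator_const _ (hSm i), measureReal_def, hS, ENNReal.toReal_inv, mul_comm,
    Complex.real_smul, Complex.ofReal_inv, mul_comm, measureReal_def, mul_comm]

end QuotientMeasure

end

section

/-! ### The orbital integral as a sum over lattices -/

open scoped Pointwise in
lemma relIndex_mul_measure {G : Type*} [Group G] [MeasurableSpace G] [MeasurableMul G]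
    (A B : Subgroup G) (hAB : A ≤ B) (hi : A.relIndex B ≠ 0) (hA : MeasurableSet (A : Set G))
    (ν : Measure G) [ν.IsMulLeftInvariant] :
    (A.relIndex B : ℝ≥0∞) * ν (A : Set G) = ν (B : Set G) := by
  have : (A.subgroupOf B).FiniteIndex := ⟨hi⟩
  obtain ⟨s, hs, -⟩ := (A.subgroupOf B).exists_isComplement_left 1
  have hs' : Finite s := hs.finite_left_iff.mpr inferInstance
  have himg : ∀ b : B, Subtype.val '' (b • ((A.subgroupOf B : Subgroup B) : Set B)) =
      b.1 • (A : Set G) := by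
    intro b
    ext y
    simp only [Set.mem_image, Set.mem_smul_set, SetLike.mem_coe, Subgroup.mem_subgroupOf]
    constructor
    · rintro ⟨_, ⟨c, hc, rfl⟩, rfl⟩
      exact ⟨c, hc, rfl⟩
    · rintro ⟨c, hc, rfl⟩
      exact ⟨b * ⟨c, hAB hc⟩, ⟨⟨c, hAB hc⟩, hc, rfl⟩, rfl⟩
  calc (A.relIndex B : ℝ≥0∞) * ν (A : Set G) = ∑' b : s, ν (b.1.1 • (A : Set G)) := by
        simp [measure_smul, hs.encard_left, Subgroup.relIndex]
    _ = ν (⋃ b : s, b.1.1 • (A : Set G)) := by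
        rw [measure_iUnion _ fun _ => hA.const_smul _]
        intro b c hbc
        have h1 := hs.pairwiseDisjoint_smul b.2 c.2 (Subtype.val_injective.ne hbc)
        change Disjoint (b.1.1 • (A : Set G)) (c.1.1 • (A : Set G))
        rw [← himg, ← himg]
        exact (Set.disjoint_image_iff Subtype.val_injective).2 h1
    _ = ν (B : Set G) := by
        congr 1
        simp only [← himg, ← Set.image_iUnion]
        have h1 : ⋃ b : s, b.1 • ((A.subgroupOf B : Subgroup B) : Set B) = Set.univ := by
          rw [← hs.mul_eq, ← Set.iUnion_mul_left_image, Set.iUnion_subtype]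
          rfl
        rw [h1, Set.image_univ]
        exact Subtype.range_coe

lemma isInvInvariant_of_commute {H : Type*} [Group H] [TopologicalSpace H] [IsTopologicalGroup H]
    [LocallyCompactSpace H] [SecondCountableTopology H] [T2Space H] [MeasurableSpace H]
    [BorelSpace H] (hc : ∀ x y : H, x * y = y * x) (ν : Measure H) [ν.IsHaarMeasure] :
    ν.IsInvInvariant := by
  let _ : CommGroup H := { ‹Group H› with mul_comm := hc }
  have : TopologicalSpace.PseudoMetrizableSpace H := inferInstance
  exact Measure.IsHaarMeasure.isInvInvariant_of_regular ν

lemma isMulRightInvariant_of_commute {H : Type*} [Group H] [MeasurableSpace H]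
    (hc : ∀ x y : H, x * y = y * x) (ν : Measure H) [ν.IsMulLeftInvariant] :
    ν.IsMulRightInvariant := by
  refine ⟨fun l => ?_⟩
  have h1 : (fun x => x * l) = fun x => l * x := funext fun x => hc x l
  rw [h1]
  exact map_mul_left_eq_self ν l

variable {h : ℕ} {a b : 𝒪[F]} {g : GL (Idx h) 𝒪[F]}

instance : SecondCountableTopology (C1 F h) :=
  TopologicalSpace.Subtype.secondCountableTopology _

instance : SecondCountableTopology (unitsL g) :=
  TopologicalSpace.Subtype.secondCountableTopology _

variable (F h) in
/-- The compact open subgroup `(C(τ₁) ∩ GL_{2h}(𝒪)) × (C(τ₁) ∩ GL_{2h}(𝒪))`. -/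
def intC1Sq : Subgroup (C1 F h × C1 F h) :=
  ((intGL F h).subgroupOf (C1 F h)).prod ((intGL F h).subgroupOf (C1 F h))

lemma mem_intC1Sq {u : C1 F h × C1 F h} :
    u ∈ intC1Sq F h ↔ u.1.1 ∈ intGL F h ∧ u.2.1 ∈ intGL F h := Iff.rfl

lemma isOpen_intC1Sq : IsOpen (intC1Sq F h : Set (C1 F h × C1 F h)) := by
  have h1 : IsOpen {u : C1 F h | u.1 ∈ intGL F h} := isOpen_intGL.preimage continuous_subtype_val
  exact h1.prod h1

lemma continuous_embL : Continuous (embL g) := by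
  refine Continuous.prodMk ?_ ?_
  · exact Continuous.subtype_mk continuous_subtype_val _
  · exact Continuous.subtype_mk
      ((continuous_const.mul continuous_subtype_val).mul continuous_const) _

lemma isOpen_orbit_stabilizer (x : C1 F h × C1 F h) :
    IsOpen {l : unitsL g | x⁻¹ * embL g l * x ∈ intC1Sq F h} :=
  isOpen_intC1Sq.preimage ((continuous_const.mul continuous_embL).mul continuous_const)

lemma measure_orbit_stabilizer_ne_zero (ν : Measure (unitsL g)) [ν.IsHaarMeasure]
    (x : C1 F h × C1 F h) : ν {l : unitsL g | x⁻¹ * embL g l * x ∈ intC1Sq F h} ≠ 0 :=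
  ((isOpen_orbit_stabilizer x).measure_pos ν ⟨1, by simp [one_mem]⟩).ne'

/-- The first component alone confines `l` to a conjugate of the compact group `GL_{2h}(𝒪)`, and
`Lˣ` is closed. -/
lemma measure_orbit_stabilizer_ne_top (ν : Measure (unitsL g)) [ν.IsHaarMeasure]
    (x : C1 F h × C1 F h) : ν {l : unitsL g | x⁻¹ * embL g l * x ∈ intC1Sq F h} ≠ ∞ := by
  have h1 : IsCompact {u : GL (Idx h) F | x.1.1⁻¹ * u * x.1.1 ∈ intGL F h} := by
    have h2 := isCompact_intGL (F := F) (h := h) |>.image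
      (f := fun u => x.1.1 * u * x.1.1⁻¹)
      ((continuous_const.mul continuous_id).mul continuous_const)
    convert h2 using 1
    ext u
    constructor
    · intro hu
      exact ⟨_, hu, by group⟩
    · rintro ⟨v, hv, rfl⟩
      have : x.1.1⁻¹ * (x.1.1 * v * x.1.1⁻¹) * x.1.1 = v := by group
      change x.1.1⁻¹ * (x.1.1 * v * x.1.1⁻¹) * x.1.1 ∈ intGL F h
      rw [this]; exact hv
  have h3 := (isClosed_unitsL g).isClosedEmbedding_subtypeVal.isCompact_preimage h1
  exact ((measure_mono fun l hl => hl.1).trans_lt h3.measure_lt_top).ne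

lemma exists_isQuotientMeasure (hcomm : ∀ x y : unitsL g, x * y = y * x)
    (μ : Measure (C1 F h × C1 F h)) [SFinite μ] [μ.IsMulLeftInvariant] (ν : Measure (unitsL g))
    [ν.IsHaarMeasure] : IsQuotientMeasure g μ ν (quotientMeasure g μ ν) := by
  have := isInvInvariant_of_commute hcomm ν
  have := isMulRightInvariant_of_commute hcomm ν
  have H : ∃ m, IsQuotientMeasure g μ ν m :=
    exists_quotient_measure continuous_embL.measurable isOpen_intC1Sq
      (measure_orbit_stabilizer_ne_zero ν) (measure_orbit_stabilizer_ne_top ν)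
  rw [quotientMeasure, dif_pos H]
  exact H.choose_spec

/-- Both `Λ` and `g⁻¹Λ` are stable under `τ₁`, the latter because `Λ` is stable under `τ₂`; each is
a translate of `Λ₀` by `C(τ₁)`. -/
lemma exists_translate_of_isStable {Λ : Submodule 𝒪[F] (Idx h → F)}
    (hΛ : Submodule.IsLattice F Λ) (hst : IsStable g Λ) :
    ∃ x : C1 F h × C1 F h, latMap x.1.1.val (lat0 F h) = Λ ∧
      x.1.1⁻¹ * glMap g * x.2.1 ∈ intGL F h := by
  obtain ⟨u₁, hu₁, h1⟩ := exists_latMap_lat0_eq hΛ hst.1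
  obtain ⟨u₂, hu₂, h2⟩ := exists_latMap_lat0_eq (isLattice_latMap (glMap g)⁻¹ hΛ) (by
    rintro _ ⟨v, hv, rfl⟩
    refine ⟨_, hst.2 v hv, ?_⟩
    change (glMap g)⁻¹.val *ᵥ (idem2 g *ᵥ v) = idem1 F h *ᵥ ((glMap g)⁻¹.val *ᵥ v)
    rw [Matrix.mulVec_mulVec, Matrix.mulVec_mulVec, idem2, mul_assoc, Units.inv_mul_cancel_left])
  refine ⟨(⟨u₁, hu₁⟩, ⟨u₂, hu₂⟩), h1, latMap_eq_of_mem_intGL.1 ?_⟩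
  rw [h1, Units.val_mul, latMap_mul, h2, ← latMap_mul, Units.mul_inv, latMap_one]

/-- A pair `(u₁, u₂)` lies in the coset `l x U` if and only if the associated lattices are related
by `l`. -/
lemma inv_mul_mem_intC1Sq_iff {x u : C1 F h × C1 F h}
    (hx : x.1.1⁻¹ * glMap g * x.2.1 ∈ intGL F h) (l : unitsL g) :
    (embL g l * x)⁻¹ * u ∈ intC1Sq F h ↔ u.1.1⁻¹ * glMap g * u.2.1 ∈ intGL F h ∧
      latMap u.1.1.val (lat0 F h) = latMap l.1.val (latMap x.1.1.val (lat0 F h)) := by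
  rw [mem_intC1Sq]
  change (l.1 * x.1.1)⁻¹ * u.1.1 ∈ intGL F h ∧
    ((glMap g)⁻¹ * l.1 * glMap g * x.2.1)⁻¹ * u.2.1 ∈ intGL F h ↔ _
  rw [← latMap_mul, ← Units.val_mul, latMap_eq_latMap_iff, latMap_lat0_eq_iff,
    and_comm (a := u.1.1⁻¹ * glMap g * u.2.1 ∈ intGL F h), and_congr_right_iff]
  intro h1
  have h2 : ((glMap g)⁻¹ * l.1 * glMap g * x.2.1)⁻¹ * u.2.1 =
      (x.1.1⁻¹ * glMap g * x.2.1)⁻¹ * ((l.1 * x.1.1)⁻¹ * u.1.1) * (u.1.1⁻¹ * glMap g * u.2.1) := by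
    group
  rw [h2, Subgroup.mul_mem_cancel_left _ (mul_mem (inv_mem hx) h1)]

lemma setOf_orbit_stabilizer {x : C1 F h × C1 F h}
    (hx : x.1.1⁻¹ * glMap g * x.2.1 ∈ intGL F h) :
    {l : unitsL g | x⁻¹ * embL g l * x ∈ intC1Sq F h} =
      (((unitsStab g (latMap x.1.1.val (lat0 F h))).subgroupOf (unitsL g) :
        Subgroup (unitsL g)) : Set (unitsL g)) := by
  ext l
  have h1 : x⁻¹ * embL g l * x = ((embL g l * x)⁻¹ * x)⁻¹ := by group
  rw [Set.mem_ofPred_eq, h1, inv_mem_iff, inv_mul_mem_intC1Sq_iff hx, SetLike.mem_coe,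
    Subgroup.mem_subgroupOf, mem_unitsStab_iff]
  exact ⟨fun h2 => ⟨l.2, h2.2.symm⟩, fun h2 => ⟨hx, h2.2.symm⟩⟩

lemma unitsStab_lat0 : unitsStab g (lat0 F h) = unitsL g ⊓ intGL F h := by
  ext u
  rw [mem_unitsStab_iff, latMap_lat0_eq_iff, Subgroup.mem_inf]

end

end LinearAFL

end

theorem mainTheorem1 {F : Type*} [Field F] [ValuativeRel F] [TopologicalSpace F]
    [IsNonarchimedeanLocalField F]
    (K : Type*) [Field K] [Algebra F K] [Algebra.IsSeparable F K]
    (hK : Module.finrank F K = 2)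
    (hunr : Algebra.FormallyUnramified 𝒪[F] (integralClosure 𝒪[F] K))
    (h : ℕ) (hh : 0 < h) (a b : 𝒪[F]) (ha : IsUnit a) (hb : IsUnit b)
    (hζ : Algebra.adjoin 𝒪[F] {(a, b)} = (⊤ : Subalgebra 𝒪[F] (𝒪[F] × 𝒪[F])))
    (g : GL (Idx h) 𝒪[F])
    (hsep : (invPoly a b g).Separable)
    (hδ : IsUnit (toF (opDelta a b g)))
    (hΛ0 : latMinus a b (lat0 F h) = latMap (toF (opDelta a b g)) (latPlus a b (lat0 F h)))
    (μ : Measure (C1 F h)) [μ.IsHaarMeasure]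
    (hμ : μ {u | (u : GL (Idx h) F) ∈ intGL F h} = 1)
    (ν : Measure (unitsL g)) [ν.IsHaarMeasure] (s : ℂ) :
    Finite (LatClasses a b g) ∧
    Integrable (fun c : OrbitSpace g => orbIntegrand K g (charIntGL F h) s c.out)
      (quotientMeasure g (μ.prod μ) ν) ∧
    ∀ k : ℕ, (k = 2 ∧ IsUnit (opI a b g)) ∨ (k = 0 ∧ IsUnit (opE a b g)) →
      (ν {l | (l : GL (Idx h) F) ∈ unitsIntL g} = 1 →
        orbitalIntegral K g μ ν (charIntGL F h) s = latticeCount a b g k s) ∧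
      (ν {l | (l : GL (Idx h) F) ∈ intGL F h} = 1 →
        ((unitsL g ⊓ intGL F h).relIndex (unitsIntL g) : ℂ) *
          orbitalIntegral K g μ ν (charIntGL F h) s = latticeCount a b g k s) := by
  have hab : IsUnit (a - b) := isUnit_sub_of_adjoin_eq_top hζ
  have hD : IsUnit (opD0 g) := isUnit_opD0 hδ
  have hN : (opM0 g).toBlocks₁₁.charpoly.Separable := invPoly_eq hab ▸ hsep
  have hfin : Finite (LatClasses a b g) := finite_latClasses ha hb hab hD hN
  have hst : ∀ c : LatClasses a b g, IsStable g c.out.1 := fun c =>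
    (isStable_iff ha hb hab).2 c.out.2.2
  have hcomm : ∀ x y : unitsL g, x * y = y * x := fun x y => Subtype.ext (Units.ext
    (algL_mul_comm hD hN (mem_unitsL_iff.1 x.2) (mem_unitsL_iff.1 y.2)))
  -- One pair per lattice class represents the double cosets in the support.
  choose x hxΛ hxg using fun c : LatClasses a b g =>
    exists_translate_of_isStable c.out.2.1 (hst c)
  let _ : Fintype (LatClasses a b g) := Fintype.ofFinite _
  have := isInvInvariant_of_commute hcomm ν
  have := isMulRightInvariant_of_commute hcomm ν
  have hμU : (μ.prod μ) (intC1Sq F h : Set (C1 F h × C1 F h)) = 1 := by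
    have h1 : (intC1Sq F h : Set (C1 F h × C1 F h)) =
        {u : C1 F h | u.1 ∈ intGL F h} ×ˢ {u : C1 F h | u.1 ∈ intGL F h} := rfl
    rw [h1, Measure.prod_prod, hμ, one_mul]
  have key := integrable_and_integral_quotient (continuous_embL (g := g)).measurable
    isOpen_intC1Sq (exists_isQuotientMeasure hcomm (μ.prod μ) ν) hμU
    (measure_orbit_stabilizer_ne_zero ν) (f := orbIntegrand K g (charIntGL F h) s)
    (orbIntegrand_embL_mul K hK hunr hδ _ s)
    (fun u k hk => orbIntegrand_mul_right K hK hunr s hk.1 hk.2) x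
    (by
      intro c d l k hk hcd
      have h1 : (embL g l * x c)⁻¹ * x d ∈ intC1Sq F h := by
        rw [← hcd, inv_mul_cancel_left]; exact hk
      rw [inv_mul_mem_intC1Sq_iff (hxg c), hxΛ, hxΛ] at h1
      rw [← Quotient.out_eq c, ← Quotient.out_eq d]
      have h2 : (latSetoid a b g) d.out c.out := ⟨l.1, l.2, h1.2⟩
      exact (Quotient.sound h2).symm)
    (by
      intro u hu
      have hug : u.1.1⁻¹ * glMap g * u.2.1 ∈ intGL F h := by
        by_contra hc
        exact hu (by
          rw [orbIntegrand, charIntGL, Set.indicator_of_notMem (by exact hc), zero_mul, zero_mul])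
      have hust := isStable_latMap_lat0 u.1.2 u.2.2 hug
      set Λ : StableLat a b g := ⟨latMap u.1.1.val (lat0 F h), isLattice_latMap _ isLattice_lat0,
        (isStable_iff ha hb hab).1 hust⟩
      obtain ⟨l, hl, h1⟩ := (latSetoid a b g).symm (Quotient.mk_out (s := latSetoid a b g) Λ)
      refine ⟨Quotient.mk _ Λ, ⟨l, hl⟩, _,
        (inv_mul_mem_intC1Sq_iff (u := u) (hxg _) ⟨l, hl⟩).2 ⟨hug, ?_⟩, mul_inv_cancel_left _ _⟩
      rw [hxΛ]
      exact h1)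
  refine ⟨hfin, key.1, fun k hk => ?_⟩
  have hB : ∀ c : LatClasses a b g,
      ((unitsStab g c.out.1).relIndex (unitsIntL g) : ℝ≥0∞) *
        ν {l | (x c)⁻¹ * embL g l * x c ∈ intC1Sq F h} =
      ν {l | (l : GL (Idx h) F) ∈ unitsIntL g} := by
    intro c
    have hS := setOf_orbit_stabilizer (hxg c)
    have hm := (isOpen_orbit_stabilizer (g := g) (x c)).measurableSet
    rw [hxΛ] at hS
    rw [hS] at hm ⊢
    have h1 := Subgroup.relIndex_subgroupOf (H := unitsStab g c.out.1)
      (unitsIntL_le_unitsL hD hN)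
    rw [← h1]
    refine relIndex_mul_measure _ ((unitsIntL g).subgroupOf (unitsL g)) ?_ ?_ hm ν
    · exact fun l hl => unitsStab_le_unitsIntL c.out.2.1 hl
    · rw [h1]
      exact relIndex_unitsStab_ne_zero hD hN c.out.2.1 (hst c)
  -- This identity holds for every Haar measure on `Lˣ`; the two normalizations only evaluate the
  -- factor `ν(O_Lˣ)`.
  have hcount : ((ν.real {l | (l : GL (Idx h) F) ∈ unitsIntL g} : ℝ) : ℂ) *
      orbitalIntegral K g μ ν (charIntGL F h) s = latticeCount a b g k s := by
    rw [orbitalIntegral, key.2, latticeCount, finsum_eq_sum_of_fintype, Finset.mul_sum]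
    refine Finset.sum_congr rfl fun c _ => ?_
    rw [orbIntegrand_eq_pow K hK hunr hab hδ hΛ0 hk s (hxg c), hxΛ, measureReal_def, ← hB c,
      ENNReal.toReal_mul, ENNReal.toReal_natCast, ← measureReal_def]
    have h0 : ((ν.real {l | (x c)⁻¹ * embL g l * x c ∈ intC1Sq F h} : ℝ) : ℂ) ≠ 0 := by
      rw [Complex.ofReal_ne_zero, measureReal_def, ENNReal.toReal_ne_zero]
      exact ⟨measure_orbit_stabilizer_ne_zero ν _, measure_orbit_stabilizer_ne_top ν _⟩
    push_cast
    field_simp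
  constructor
  · intro hν
    rw [← hcount, measureReal_def, hν, ENNReal.toReal_one, Complex.ofReal_one, one_mul]
  · intro hν
    rw [← hcount]
    congr 1
    -- Since `Lˣ ∩ GL_{2h}(𝒪)` is `Stab(Λ₀)ˣ`, giving it volume 1 makes `ν(O_Lˣ)` its index in
    -- `O_Lˣ`.
    have h1 := Subgroup.relIndex_subgroupOf (H := unitsStab g (lat0 F h))
      (unitsIntL_le_unitsL hD hN)
    have hS : (((unitsStab g (lat0 F h)).subgroupOf (unitsL g) : Subgroup (unitsL g)) :
        Set (unitsL g)) = {l : unitsL g | (l : GL (Idx h) F) ∈ intGL F h} := by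
      ext l
      rw [SetLike.mem_coe, Subgroup.mem_subgroupOf, unitsStab_lat0]
      exact and_iff_right l.2
    have hm : MeasurableSet {l : unitsL g | (l : GL (Idx h) F) ∈ intGL F h} :=
      (isOpen_intGL.preimage continuous_subtype_val).measurableSet
    rw [← hS] at hm hν
    have h2 := relIndex_mul_measure ((unitsStab g (lat0 F h)).subgroupOf (unitsL g))
      ((unitsIntL g).subgroupOf (unitsL g))
      (fun l hl => unitsStab_le_unitsIntL isLattice_lat0 hl)
      (by rw [h1]; exact relIndex_unitsStab_ne_zero hD hN isLattice_lat0 isStable_lat0) hm ν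
    rw [hν, mul_one, h1, unitsStab_lat0] at h2
    rw [measureReal_def]
    change _ = (((ν (((unitsIntL g).subgroupOf (unitsL g) : Subgroup (unitsL g)) :
      Set (unitsL g))).toReal : ℝ) : ℂ)
    rw [← h2, ENNReal.toReal_natCast, Complex.ofReal_natCast]
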